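/- Let $F=\mathbb F_q$ be a finite field, $V$ a finite-dimensional vector space over $F$, and let $W$ be a classical formed space on $V$: either a nondegenerate alternating bilinear form $B$ (symplectic case), or a nondegenerate $\sigma$-Hermitian form $B$ with $\sigma$ an automorphism of $F$ of order two (unitary case), or a quadratic form $Q$ with polar form $B$ such that no nonzero $x$ with $Q(x)=0$ lies in the radical of $B$ (orthogonal case). A subspace $U$ of $V$ is called singular if $B$ vanishes on $U\times U$ and, in the orthogonal case, $Q$ vanishes on $U$. The Witt index $\omega$ is the largest dimension of a singular subspace. For $1\le k<\omega$ let $\Gamma=\mathrm{PG}_W(k)$ be the polar Grassmann graph: its vertices are the singular $k$-subspaces of $V$, and $X,Y$ are adjacent if and only if $X+Y$ is a singular $(k+1)$-subspace. Two distinct vertices $X,Y$ are called opposite if for every $y\in Y\setminus X$ there is some $x\in X\setminus Y$ with $B(x,y)\ne0$ (equivalently, $X\cap Y=X^\perp\cap Y$). A geodesic of length $\ell$ is a path $(X_0,\dots,X_\ell)$ in $\Gamma$ such that $X_0$ and $X_\ell$ have distance $\ell$; its ends are $X_0$ and $X_\ell$. Proposition 4.2. Let $1\le k<\omega$ and $2\le\ell\le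 k+1$, and let $\mathcal S$ be the set of geodesics of length $\ell$ in $\mathrm{PG}_W(k)$ whose ends are opposite. Then: 1. $\mathcal S$ is nonempty and is a single orbit of the isometry group of $W$ (the group of all linear automorphisms of $V$ preserving the form), and also a single orbit of the group of all semilinear automorphisms of $V$ that preserve the form up to a field automorphism and a nonzero scalar. 2. $\mathcal S$ is a single orbit of the full automorphism group $\mathrm{Aut}\,\Gamma$, except possibly if $W$ is the orthogonal space $\Omega^+(8,q)$ (that is, orthogonal with $\omega=4$ and $\dim V=8$) and $k=\ell=2$. -/

import Mathlib

/-- A classical formed space on the vector space `V` over `F`: a nondegenerate alternating form,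
a nonsingular quadratic form, or a nondegenerate Hermitian form. For finite `F` and
finite-dimensional `V` these are the symplectic, orthogonal and unitary spaces
`Sp(2ω,q)`, `Ω(2ω+1,q)`, `Ω⁺(2ω,q)`, `Ω⁻(2ω+2,q)`, `U(2ω+1,√q)`, `U(2ω,√q)`.
In the orthogonal case the nonsingularity condition says that the radical of the polar form has
no nonzero singular vector (so in odd characteristic the polar form is nondegenerate). -/
inductive FormedSpace (F V : Type*) [Field F] [AddCommGroup V] [Module F V] where
  | symplectic (B : V →ₗ[F] V →ₗ[F] F) (alt : ∀ x, B x x = 0)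
      (nondeg : ∀ x, (∀ y, B x y = 0) → x = 0)
  | orthogonal (Q : QuadraticForm F V)
      (nonsing : ∀ x, Q x = 0 → (∀ y, QuadraticMap.polar Q x y = 0) → x = 0)
  | unitary (σ : F →+* F) (invol : ∀ a, σ (σ a) = a) (nontriv : σ ≠ RingHom.id F)
      (B : V →ₛₗ[σ] V →ₗ[F] F) (herm : ∀ x y, B y x = σ (B x y))
      (nondeg : ∀ x, (∀ y, B x y = 0) → x = 0)

namespace FormedSpace

variable {F V : Type*} [Field F] [AddCommGroup V] [Module F V]

/-- The reflexive sesquilinear form `B` of `W` (the polar form in the orthogonal case). -/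
def form : FormedSpace F V → V → V → F
  | symplectic B _ _, x, y => B x y
  | orthogonal Q _, x, y => QuadraticMap.polar Q x y
  | unitary _ _ _ B _ _, x, y => B x y

/-- The quadratic form in the orthogonal case, and `x ↦ B x x` in the other cases. -/
def quad : FormedSpace F V → V → F
  | symplectic B _ _, x => B x x
  | orthogonal Q _, x => Q x
  | unitary _ _ _ B _ _, x => B x x

/-- Singular subspaces: `B` vanishes on `U`, and in the orthogonal case so does the quadratic
form (which is automatic from the first part if the characteristic is not two). -/
def IsSingular (W : FormedSpace F V) (U : Submodule F V) : Prop :=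
  (∀ x ∈ U, ∀ y ∈ U, W.form x y = 0) ∧ ∀ x ∈ U, W.quad x = 0

/-- The Witt index: the largest dimension of a singular subspace (for finite-dimensional `V`). -/
noncomputable def wittIndex (W : FormedSpace F V) : ℕ :=
  sSup {d : ℕ | ∃ U : Submodule F V, W.IsSingular U ∧ Module.finrank F U = d}

/-- `W` is an orthogonal space of plus type, `Ω⁺(2ω,q)`. -/
def IsOrthogonalPlus (W : FormedSpace F V) : Prop :=
  (∃ Q h, W = orthogonal Q h) ∧ Module.finrank F V = 2 * W.wittIndex

/-- The bijection `g` of `V` is `τ`-semilinear and preserves the form up to `τ` and the scalar `c`. -/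
def PreservesForm (W : FormedSpace F V) (τ : F ≃+* F) (c : F) (g : Equiv.Perm V) : Prop :=
  (∀ x y : V, g (x + y) = g x + g y) ∧
  (∀ (a : F) (x : V), g (a • x) = τ a • g x) ∧
  (∀ x y, W.form (g x) (g y) = c * τ (W.form x y)) ∧
  ∀ x, W.quad (g x) = c * τ (W.quad x)

theorem PreservesForm.one (W : FormedSpace F V) : W.PreservesForm (RingEquiv.refl F) 1 1 := by
  refine ⟨fun x y => rfl, fun a x => rfl, fun x y => ?_, fun x => ?_⟩ <;> simp

theorem PreservesForm.mul {W : FormedSpace F V} {τ τ' : F ≃+* F} {c c' : F} {g g' : Equiv.Perm V}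
    (h : W.PreservesForm τ c g) (h' : W.PreservesForm τ' c' g') :
    W.PreservesForm (τ'.trans τ) (c * τ c') (g * g') := by
  obtain ⟨h0, h1, h2, h3⟩ := h
  obtain ⟨h0', h1', h2', h3'⟩ := h'
  refine ⟨fun x y => ?_, fun a x => ?_, fun x y => ?_, fun x => ?_⟩
  · simp [Equiv.Perm.mul_apply, h0, h0']
  · simp [Equiv.Perm.mul_apply, h1, h1']
  · simp [Equiv.Perm.mul_apply, h2, h2', mul_assoc]
  · simp [Equiv.Perm.mul_apply, h3, h3', mul_assoc]

theorem PreservesForm.inv {W : FormedSpace F V} {τ : F ≃+* F} {c : F} (hc : c ≠ 0)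
    {g : Equiv.Perm V} (h : W.PreservesForm τ c g) :
    W.PreservesForm τ.symm (τ.symm c)⁻¹ g⁻¹ := by
  obtain ⟨h0, h1, h2, h3⟩ := h
  have hg : ∀ x, g (g⁻¹ x) = x := fun x => g.apply_symm_apply x
  have hc' : τ.symm c ≠ 0 := by simpa using hc
  refine ⟨fun x y => g.injective ?_, fun a x => g.injective ?_, fun x y => ?_, fun x => ?_⟩
  · rw [hg, h0, hg, hg]
  · rw [hg, h1, hg, RingEquiv.apply_symm_apply]
  · have := h2 (g⁻¹ x) (g⁻¹ y)
    rw [hg, hg] at this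
    rw [this, map_mul, RingEquiv.symm_apply_apply, inv_mul_cancel_left₀ hc']
  · have := h3 (g⁻¹ x)
    rw [hg] at this
    rw [this, map_mul, RingEquiv.symm_apply_apply, inv_mul_cancel_left₀ hc']

/-- The isometry group of `W`: the linear automorphisms of `V` preserving the form. -/
def isometryGroup (W : FormedSpace F V) : Subgroup (Equiv.Perm V) where
  carrier := {g | W.PreservesForm (RingEquiv.refl F) 1 g}
  one_mem' := PreservesForm.one W
  mul_mem' {g g'} h h' := by
    have := PreservesForm.mul h h'
    rwa [map_one, mul_one] at this
  inv_mem' {g} h := by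
    have := PreservesForm.inv one_ne_zero h
    simpa using this

/-- The group of all semilinear automorphisms of `V` preserving the form up to a field
automorphism and a nonzero scalar. -/
def semisimilarityGroup (W : FormedSpace F V) : Subgroup (Equiv.Perm V) where
  carrier := {g | ∃ (τ : F ≃+* F) (c : F), c ≠ 0 ∧ W.PreservesForm τ c g}
  one_mem' := ⟨RingEquiv.refl F, 1, one_ne_zero, PreservesForm.one W⟩
  mul_mem' := by
    rintro g g' ⟨τ, c, hc, h⟩ ⟨τ', c', hc', h'⟩
    exact ⟨τ'.trans τ, c * τ c', mul_ne_zero hc (by simpa using hc'), h.mul h'⟩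
  inv_mem' := by
    rintro g ⟨τ, c, hc, h⟩
    exact ⟨τ.symm, (τ.symm c)⁻¹, inv_ne_zero (by simpa using hc), h.inv hc⟩

/-- The set of singular `k`-subspaces of `W`. -/
abbrev Singular (W : FormedSpace F V) (k : ℕ) : Type _ :=
  {U : Submodule F V // W.IsSingular U ∧ Module.finrank F U = k}

/-- The polar Grassmann graph `PG_W(k)` for `k` smaller than the Witt index: singular
`k`-subspaces `X`, `Y` are adjacent when `X + Y` is a singular `(k+1)`-subspace. -/
def polarGrassmannGraph (W : FormedSpace F V) (k : ℕ) : SimpleGraph (W.Singular k) where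
  Adj X Y := W.IsSingular (X.1 ⊔ Y.1) ∧
    Module.finrank F (X.1 ⊔ Y.1 : Submodule F V) = k + 1
  symm := ⟨fun X Y h => by rwa [sup_comm] at h⟩
  loopless := ⟨fun X h => by
    have h1 := h.2
    rw [sup_idem, X.2.2] at h1
    omega⟩

/-- Opposite vertices: distinct, and every vector of `Y` outside `X` fails to be orthogonal to
some vector of `X` outside `Y`. -/
def Opposite (W : FormedSpace F V) {k : ℕ} (X Y : W.Singular k) : Prop :=
  X ≠ Y ∧ ∀ y ∈ Y.1, y ∉ X.1 → ∃ x ∈ X.1, x ∉ Y.1 ∧ W.form x y ≠ 0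

end FormedSpace

/-- The sequence `(p 0, …, p ℓ)` of vertices is a geodesic of length `ℓ`: a path which is a
shortest path between its ends. -/
def SimpleGraph.IsGeodesicSeq {A : Type*} (Γ : SimpleGraph A) {l : ℕ} (p : Fin (l + 1) → A) :
    Prop :=
  (∀ i : Fin l, Γ.Adj (p i.castSucc) (p i.succ)) ∧ Γ.dist (p 0) (p (Fin.last l)) = l

/-- `S` is a single orbit, where `R p p'` means that some group element maps `p` to `p'`. -/
def IsSingleOrbit {A : Type*} (R : A → A → Prop) (S : Set A) : Prop :=
  S.Nonempty ∧ ∀ p ∈ S, ∀ p', p' ∈ S ↔ R p p'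

namespace FormedSpace

variable {F V : Type*} [Field F] [AddCommGroup V] [Module F V]

/-- The geodesics of length `l` in `PG_W(k)` whose ends are opposite. -/
def oppositeGeodesics (W : FormedSpace F V) (k l : ℕ) : Set (Fin (l + 1) → W.Singular k) :=
  {p | (W.polarGrassmannGraph k).IsGeodesicSeq p ∧ W.Opposite (p 0) (p (Fin.last l))}

/-- Some element of `G` maps the sequence `p` of subspaces to `p'`. -/
def MovedBy {W : FormedSpace F V} {k l : ℕ} (G : Subgroup (Equiv.Perm V))
    (p p' : Fin (l + 1) → W.Singular k) : Prop :=
  ∃ g ∈ G, ∀ i, ((p' i).1 : Set V) = g '' ((p i).1 : Set V)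

/-- Some automorphism of the graph `PG_W(k)` maps `p` to `p'`. -/
def MovedByAut {W : FormedSpace F V} {k l : ℕ} (p p' : Fin (l + 1) → W.Singular k) : Prop :=
  ∃ φ : W.polarGrassmannGraph k ≃g W.polarGrassmannGraph k, ∀ i, p' i = φ (p i)

end FormedSpace

/-!
The three types of spaces are treated uniformly: `form` is sesquilinear and reflexive, and
`W.quad (x + y) = W.quad x + W.quad y + W.tr (W.form x y)` for an additive map `W.tr`.

*Transitivity.* Two vertices `X`, `Y` have distance `k - dim (X ∩ Y)` if they are not opposite,
and `k - dim (X ∩ Y) + 1` if they are (`dist_add_of_not_opposite`, `Opposite.dist_add`). Hence the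
ends of a geodesic of length `j + 1` with opposite ends meet in a subspace of dimension `k - j`.
All inner vertices of such a geodesic contain a common vector orthogonal to both ends, and the
geodesic is determined by dimensions up to the choice of a basis: there is a family of mutually
orthogonal hyperbolic pairs `E a, G a` such that it runs from the span of some of the `E a` to a
space in which the first few of them are replaced by their partners, exchanging one vector at each
step (`IsOppositePath.exists_isFrame`, `framePath`). By an explicit form of Witt's theorem, the
isometry group is transitive on such frames (`IsFrame.exists_isometry`), hence on the geodesics.
Nonemptiness follows from the existence of a frame of length `ω`. Since semisimilarities preserve
distances and opposite vertices, the same set is an orbit of the larger group.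

*Graph automorphisms.* Distances are invariant under automorphisms, so it remains to recognize in
the graph whether `X`, `Y` are opposite. Consider the first layer, the neighbours `Z` of `X` on
geodesics from `X` to `Y`. If `X`, `Y` are not opposite, then `Z` is determined by `X ∩ Z` and
`Z ∩ Y`, and two nonadjacent vertices of the layer have at least one and at most two common
neighbours in it (`exists_adj_of_not_opposite`, `eq_or_eq_of_not_opposite`). If `X`, `Y` are
opposite, then `Z` is determined by a hyperplane of `X` containing `X ∩ Y` and a point of the
polar space of rank `ω - k` on `(X + Y)ᗮ / (X ∩ Y)`. When there are several hyperplanes, some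
nonadjacent vertices have no common neighbour (`Opposite.exists_no_common`). When there is only
one, the layer is the polar space itself, where noncollinear points have none or at least three
common neighbours unless it is a grid (`Opposite.exists_common`). The grid arises only for
`Ω⁺(2k + 4, q)` and length two. There, for `k ≥ 3`, the two cases are told apart by the number of
vertices equal or adjacent to each member of a triangle formed by `X` and an edge of the layer: it
is at most `q ^ 2 + q + 1` for opposite ends, while it is at least `q ^ k` for some edge otherwise
(`Opposite.ncard_triangleHull_le`, `pow_le_ncard_triangleHull`).
-/

namespace FormedSpace

variable {F V : Type*} [Field F] [AddCommGroup V] [Module F V]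

/-! ### Uniform calculus for the three types of forms -/

/-- The field automorphism for which the first argument of `W.form` is semilinear. -/
def conj : FormedSpace F V → F →+* F
  | symplectic _ _ _ => RingHom.id F
  | orthogonal _ _ => RingHom.id F
  | unitary σ _ _ _ _ _ => σ

/-- The sign `ε` with `B y x = ε * σ (B x y)`. -/
def sign : FormedSpace F V → F
  | symplectic _ _ _ => -1
  | orthogonal _ _ => 1
  | unitary _ _ _ _ _ _ => 1

/-- The additive map `t` with `q (x + y) = q x + q y + t (B x y)`, where `q` is `W.quad`: zero in
the symplectic case, the identity in the orthogonal case, the trace in the unitary case. -/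
def tr : FormedSpace F V → F →+ F
  | symplectic _ _ _ => 0
  | orthogonal _ _ => AddMonoidHom.id F
  | unitary σ _ _ _ _ _ => AddMonoidHom.id F + σ.toAddMonoidHom

variable (W : FormedSpace F V)

@[simp] theorem form_add_left (x y z : V) : W.form (x + y) z = W.form x z + W.form y z := by
  cases W <;> simp [form, QuadraticMap.polar_add_left]

@[simp] theorem form_add_right (x y z : V) : W.form x (y + z) = W.form x y + W.form x z := by
  cases W <;> simp [form, QuadraticMap.polar_add_right]

@[simp] theorem form_smul_left (a : F) (x y : V) : W.form (a • x) y = W.conj a * W.form x y := by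
  cases W <;> simp [form, conj, QuadraticMap.polar_smul_left]

@[simp] theorem form_smul_right (a : F) (x y : V) : W.form x (a • y) = a * W.form x y := by
  cases W <;> simp [form, QuadraticMap.polar_smul_right]

theorem form_swap (x y : V) : W.form y x = W.sign * W.conj (W.form x y) := by
  cases W with
  | symplectic B alt nd =>
    have h := alt (x + y)
    simp only [map_add, LinearMap.add_apply, alt, zero_add, add_zero] at h
    simp only [form, sign, conj, RingHom.id_apply]
    linear_combination h
  | orthogonal Q h => simp [form, sign, conj, QuadraticMap.polar_comm]
  | unitary σ i nt B herm nd => simpa [form, sign, conj] using herm x y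

theorem quad_add (x y : V) : W.quad (x + y) = W.quad x + W.quad y + W.tr (W.form x y) := by
  cases W with
  | symplectic B alt nd => change B (x + y) (x + y) = B x x + B y y + 0; simp only [alt, add_zero]
  | orthogonal Q h => simp [form, quad, tr, QuadraticMap.polar]
  | unitary σ i nt B herm nd =>
    simp only [quad, map_add, LinearMap.add_apply, form, tr, AddMonoidHom.add_apply,
      AddMonoidHom.id_apply]
    have := herm x y
    change _ = _ + (_ + σ (B x y))
    rw [← this]; ring

theorem quad_smul (a : F) (x : V) : W.quad (a • x) = a * W.conj a * W.quad x := by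
  cases W with
  | symplectic B alt nd => simp [quad, alt]
  | orthogonal Q h => simp [quad, conj, QuadraticMap.map_smul]
  | unitary σ i nt B herm nd => simp [quad, conj, mul_assoc]

theorem conj_conj (a : F) : W.conj (W.conj a) = a := by
  cases W with
  | symplectic B alt nd => rfl
  | orthogonal Q h => rfl
  | unitary σ i nt B herm nd => exact i a

theorem sign_mul_sign : W.sign * W.sign = 1 := by cases W <;> simp [sign]

theorem conj_sign : W.conj W.sign = W.sign := by cases W <;> simp [sign]

theorem sign_ne_zero : W.sign ≠ 0 := by cases W <;> simp [sign]

theorem tr_swap (a : F) : W.tr (W.sign * W.conj a) = W.tr a := by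
  cases W with
  | symplectic B alt nd => rfl
  | orthogonal Q h => simp [tr, sign, conj]
  | unitary σ i nt B herm nd =>
    change 1 * σ a + σ (1 * σ a) = a + σ a
    rw [one_mul, i, add_comm]

theorem tr_norm_mul (a b : F) : W.tr (a * W.conj a * b) = a * W.conj a * W.tr b := by
  cases W with
  | symplectic B alt nd => simp [tr]
  | orthogonal Q h => simp [tr]
  | unitary σ i nt B herm nd =>
    change a * σ a * b + σ (a * σ a * b) = a * σ a * (b + σ b)
    rw [map_mul, map_mul, i]; ring

theorem form_self {x : V} (h : W.quad x = 0) : W.form x x = 0 := by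
  cases W with
  | symplectic B alt nd => exact h
  | orthogonal Q hQ =>
    change QuadraticMap.polar Q x x = 0
    rw [QuadraticMap.polar_self]
    simp [show Q x = 0 from h]
  | unitary σ i nt B herm nd => exact h

theorem eq_zero_of_form {x : V} (h : W.quad x = 0) (h' : ∀ y, W.form x y = 0) : x = 0 := by
  cases W with
  | symplectic B alt nd => exact nd x h'
  | orthogonal Q hQ => exact hQ x h h'
  | unitary σ i nt B herm nd => exact nd x h'

theorem exists_tr (x : V) : ∃ t, W.tr t = W.quad x := by
  cases W with
  | symplectic B alt nd => exact ⟨0, by simp [quad, alt]⟩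
  | orthogonal Q hQ => exact ⟨Q x, rfl⟩
  | unitary σ i nt B herm nd =>
    -- some element has nonzero trace, since otherwise `σ = -1`, hence `-1 = 1` and `σ = 1`
    obtain ⟨a, ha⟩ : ∃ a, a + σ a ≠ 0 := by
      by_contra! h
      refine nt (RingHom.ext fun a => ?_)
      have h1 := h 1
      have h2 := h a
      rw [map_one] at h1
      simp only [RingHom.id_apply]
      linear_combination h2 - a * h1
    refine ⟨B x x * (a / (a + σ a)), ?_⟩
    change B x x * (a / (a + σ a)) + σ (B x x * (a / (a + σ a))) = B x x
    rw [map_mul, map_div₀, map_add, i, ← herm x x, add_comm (σ a) a]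
    field_simp

@[simp] theorem form_zero_left (y : V) : W.form 0 y = 0 := by
  simpa using W.form_smul_left 0 0 y

@[simp] theorem form_zero_right (x : V) : W.form x 0 = 0 := by
  simpa using W.form_smul_right 0 x 0

@[simp] theorem form_neg_left (x y : V) : W.form (-x) y = -W.form x y := by
  simpa using W.form_smul_left (-1) x y

@[simp] theorem form_neg_right (x y : V) : W.form x (-y) = -W.form x y := by
  simpa using W.form_smul_right (-1) x y

@[simp] theorem form_sub_left (x y z : V) : W.form (x - y) z = W.form x z - W.form y z := by
  simp [sub_eq_add_neg]

@[simp] theorem form_sub_right (x y z : V) : W.form x (y - z) = W.form x y - W.form x z := by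
  simp [sub_eq_add_neg]

@[simp] theorem quad_zero : W.quad 0 = 0 := by simpa using W.quad_smul 0 0

theorem form_comm_zero {x y : V} (h : W.form x y = 0) : W.form y x = 0 := by
  rw [W.form_swap x y, h, map_zero, mul_zero]

theorem form_comm_zero_iff {x y : V} : W.form x y = 0 ↔ W.form y x = 0 :=
  ⟨W.form_comm_zero, W.form_comm_zero⟩

theorem quad_sub_of_singular {x y : V} (hx : W.quad x = 0) (hy : W.quad y = 0) :
    W.quad (x - y) = -W.tr (W.form x y) := by
  have h := W.quad_add x ((-1 : F) • y)
  rw [quad_smul, form_smul_right, hx, hy, mul_zero, add_zero, zero_add, neg_one_mul, map_neg,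
    neg_one_smul, ← sub_eq_add_neg] at h
  exact h

/-- A vector not orthogonal to a singular vector `z` becomes singular after adding a suitable
multiple of `z`. -/
theorem exists_quad_add_smul_eq_zero {y z : V} (hz : W.quad z = 0) (hzy : W.form z y ≠ 0) :
    ∃ c : F, W.quad (y + c • z) = 0 := by
  have hyz : W.form y z ≠ 0 := fun h => hzy (W.form_comm_zero h)
  obtain ⟨t, ht⟩ := W.exists_tr y
  refine ⟨-t / W.form y z, ?_⟩
  rw [quad_add, quad_smul, hz, form_smul_right, div_mul_cancel₀ _ hyz, ← ht, map_neg]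
  ring

/-- `W.form x` as a linear functional. -/
def formLin (x : V) : V →ₗ[F] F where
  toFun := W.form x
  map_add' := W.form_add_right x
  map_smul' a y := W.form_smul_right a x y

@[simp] theorem formLin_apply (x y : V) : W.formLin x y = W.form x y := rfl

/-! ### Transitivity of the isometry group on hyperbolic frames -/

variable {W}

section

variable [FiniteDimensional F V]

/-- A linear map preserving the form is injective because the form is nonsingular, hence it is an
isometry. -/
theorem exists_isometry (g : V →ₗ[F] V) (hB : ∀ x y, W.form (g x) (g y) = W.form x y)
    (hq : ∀ x, W.quad (g x) = W.quad x) : ∃ g' ∈ W.isometryGroup, ∀ x, g' x = g x := by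
  have hinj : Function.Injective g := by
    rw [← LinearMap.ker_eq_bot, LinearMap.ker_eq_bot']
    intro x hx
    refine W.eq_zero_of_form ?_ fun y => ?_
    · rw [← hq, hx, quad_zero]
    · rw [← hB, hx, form_zero_left]
  refine ⟨(LinearEquiv.ofInjectiveEndo g hinj).toEquiv, ⟨?_, ?_, ?_, ?_⟩, fun x => rfl⟩
  · intro x y; simp
  · intro a x; simp
  · intro x y; simp [hB]
  · intro x; simp [hq]

/-- Two nonorthogonal singular vectors `u`, `w` are swapped by the isometry
`x ↦ x - B(r,x)/B(r,u) r`, where `r = u - w`. -/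
theorem exists_isometry_of_form_ne_zero {u w : V} (hu : W.quad u = 0) (hw : W.quad w = 0)
    (huw : W.form u w ≠ 0) : ∃ g ∈ W.isometryGroup, g u = w ∧
      ∀ x, W.form u x = 0 → W.form w x = 0 → g x = x := by
  have hwu : W.form w u ≠ 0 := fun h => huw (W.form_comm_zero h)
  have huu := W.form_self hu
  have hww := W.form_self hw
  set μ : F := (W.form w u)⁻¹ with hμ
  have hμw : μ * W.form w u = 1 := inv_mul_cancel₀ hwu
  have hcμ : W.conj μ * W.form u w = W.sign := by
    rw [W.form_swap w u, mul_left_comm, ← map_mul, hμw, map_one, mul_one]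
  let g : V →ₗ[F] V := LinearMap.id + (μ • W.formLin (u - w)).smulRight (u - w)
  have hg : ∀ x, g x = x + (μ * W.form (u - w) x) • (u - w) := fun x => rfl
  have hrr : W.form (u - w) (u - w) = - W.form u w - W.form w u := by
    simp [huu, hww]; ring
  have key : W.conj μ + W.sign * μ + W.conj μ * μ * W.form (u - w) (u - w) = 0 := by
    rw [hrr]
    linear_combination (-μ) * hcμ - W.conj μ * hμw
  have hgB : ∀ x y, W.form (g x) (g y) = W.form x y := by
    intro x y
    rw [hg, hg]
    rw [form_add_left, form_add_right, form_add_right, form_smul_left, form_smul_left,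
      form_smul_right, form_smul_right, map_mul, W.form_swap (u - w) x]
    linear_combination (W.conj (W.form (u - w) x) * W.form (u - w) y) * key
  have hgq : ∀ x, W.quad (g x) = W.quad x := by
    intro x
    have hqr := W.quad_sub_of_singular hu hw
    rw [hg, quad_add, quad_smul, hqr, form_smul_right, W.form_swap (u - w) x, mul_neg,
      ← tr_norm_mul]
    have : μ * W.form (u - w) x * W.conj (μ * W.form (u - w) x) * W.form u w =
        μ * W.form (u - w) x * (W.sign * W.conj (W.form (u - w) x)) := by
      rw [map_mul]
      linear_combination (μ * W.form (u - w) x * W.conj (W.form (u - w) x)) * hcμ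
    rw [this]; ring
  obtain ⟨g', hg', hgg⟩ := exists_isometry g hgB hgq
  refine ⟨g', hg', ?_, fun x h1 h2 => ?_⟩
  · rw [hgg, hg, form_sub_left, huu, zero_sub, mul_neg, hμw]; module
  · rw [hgg, hg, form_sub_left, h1, h2]; simp

/-- Two singular vectors `v`, `v'` having the same nonzero product with a singular vector `u`
are related by a Siegel (Eichler) transformation centred at `u`. -/
theorem exists_isometry_of_form_eq_one {u v v' : V} (hu : W.quad u = 0) (hv : W.quad v = 0)
    (hv' : W.quad v' = 0) (huv : W.form u v = 1) (huv' : W.form u v' = 1) :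
    ∃ g ∈ W.isometryGroup, g u = u ∧ g v = v' ∧
      ∀ x, W.form u x = 0 → W.form v x = 0 → W.form v' x = 0 → g x = x := by
  have huu := W.form_self hu
  have hvv := W.form_self hv
  have hvv' := W.form_self hv'
  have hvu : W.form v u = W.sign := by rw [W.form_swap u v, huv, map_one, mul_one]
  have hvu' : W.form v' u = W.sign := by rw [W.form_swap u v', huv', map_one, mul_one]
  have hss := W.sign_mul_sign
  have hcs := W.conj_sign
  set b := W.form v' v with hb
  have hbc : W.form v v' = W.sign * W.conj b := W.form_swap v' v
  let g : V →ₗ[F] V := LinearMap.id + (W.formLin u).smulRight (v' - v)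
    - (W.sign • (W.formLin (v' - v) - b • W.formLin u)).smulRight u
  have hg : ∀ x, g x = x + W.form u x • (v' - v)
      - (W.sign * (W.form (v' - v) x - b * W.form u x)) • u := fun x => rfl
  have hwu : W.form (v' - v) u = 0 := by simp [hvu, hvu']
  have huw : W.form u (v' - v) = 0 := by simp [huv, huv']
  have hww : W.form (v' - v) (v' - v) = - b - W.sign * W.conj b := by
    simp [hvv, hvv', hbc, ← hb]; ring
  have hgB : ∀ x y, W.form (g x) (g y) = W.form x y := by
    intro x y
    rw [hg, hg]
    generalize v' - v = w at *
    simp only [form_add_left, form_add_right, form_sub_left, form_sub_right, form_smul_left,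
      form_smul_right, map_mul, map_sub, W.form_swap w x, W.form_swap u x, huw, huu, hwu, hcs, hww]
    linear_combination (W.conj (W.form u x) * (b * W.form u y - W.form w y)) * hss
  have hgq : ∀ x, W.quad (g x) = W.quad x := by
    intro x
    have hqr := W.quad_sub_of_singular hv' hv
    rw [hg]
    generalize v' - v = w at *
    rw [sub_eq_add_neg, ← neg_smul, quad_add, quad_add, quad_smul, quad_smul, hqr, hu,
      form_smul_right, form_smul_right, form_add_left, form_smul_left, hwu, mul_neg,
      ← tr_norm_mul, W.form_swap w x, W.form_swap u x]
    have h1 : W.tr (W.form u x * (W.sign * W.conj (W.form w x))) =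
        W.tr (W.conj (W.form u x) * W.form w x) := by
      rw [← W.tr_swap (W.conj (W.form u x) * W.form w x), map_mul W.conj, conj_conj]
      congr 1; ring
    have h2 : W.tr (-(W.sign * (W.form w x - b * W.form u x)) *
        (W.sign * W.conj (W.form u x) + W.conj (W.form u x) * 0)) =
        - W.tr (W.conj (W.form u x) * W.form w x)
        + W.tr (W.form u x * W.conj (W.form u x) * b) := by
      rw [← map_neg, ← map_add]
      congr 1
      linear_combination (- (W.form w x - b * W.form u x) * W.conj (W.form u x)) * hss
    rw [h1, h2]; ring
  obtain ⟨g', hg', hgg⟩ := exists_isometry g hgB hgq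
  refine ⟨g', hg', ?_, ?_, fun x h1 h2 h3 => ?_⟩
  · rw [hgg, hg, huu, hwu]; simp
  · rw [hgg, hg, huv, form_sub_left, hvv, ← hb]; simp
  · rw [hgg, hg, form_sub_left, h1, h2, h3]; simp

/-- The isometries fixing a set `S` pointwise are transitive on the hyperbolic pairs orthogonal
to `S`. -/
theorem exists_isometry_pair {S : Set V} {u v u' v' : V} (hu : W.quad u = 0) (hv : W.quad v = 0)
    (hu' : W.quad u' = 0) (hv' : W.quad v' = 0) (huv : W.form u v = 1) (huv' : W.form u' v' = 1)
    (hS : ∀ s ∈ S, W.form u s = 0 ∧ W.form v s = 0 ∧ W.form u' s = 0 ∧ W.form v' s = 0) :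
    ∃ g ∈ W.isometryGroup, g u = u' ∧ g v = v' ∧ ∀ s ∈ S, g s = s := by
  have hvu : W.form v u ≠ 0 := fun h => one_ne_zero (huv ▸ W.form_comm_zero h)
  obtain ⟨g, hg, hgu, hgS⟩ : ∃ g ∈ W.isometryGroup, g u = u' ∧ ∀ s ∈ S, g s = s := by
    by_cases c3 : W.form u u' = 0
    · -- a singular vector orthogonal to `S`, but not to `u` and not to `u'`
      obtain ⟨w, hw, h1, h2, h3⟩ : ∃ w, W.quad w = 0 ∧ W.form u w ≠ 0 ∧ W.form w u' ≠ 0 ∧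
          ∀ s ∈ S, W.form w s = 0 := by
        by_cases c1 : W.form u v' = 0
        · by_cases c2 : W.form v u' = 0
          · refine ⟨v + v' + (-W.form v v' / W.form v u) • u, ?_, ?_, ?_, ?_⟩
            · rw [quad_add, quad_add, quad_smul, hu, hv, hv', form_add_left, form_smul_right,
                form_smul_right, W.form_comm_zero c1, div_mul_cancel₀ _ hvu]
              simp
            · simp [huv, c1, W.form_self hu]
            · simp only [form_add_left, form_smul_left, c2, c3, zero_add, mul_zero, add_zero]
              exact fun h => one_ne_zero (huv' ▸ W.form_comm_zero h)
            · intro s hs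
              obtain ⟨a1, a2, a3, a4⟩ := hS s hs
              simp [a1, a2, a4]
          · exact ⟨v, hv, huv ▸ one_ne_zero, c2, fun s hs => (hS s hs).2.1⟩
        · exact ⟨v', hv', c1, fun h => one_ne_zero (huv' ▸ W.form_comm_zero h),
            fun s hs => (hS s hs).2.2.2⟩
      obtain ⟨g, hg, hgu, hgS⟩ := exists_isometry_of_form_ne_zero hu hw h1
      obtain ⟨g', hg', hgu', hgS'⟩ := exists_isometry_of_form_ne_zero hw hu' h2
      refine ⟨g' * g, mul_mem hg' hg, ?_, fun s hs => ?_⟩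
      · rw [Equiv.Perm.mul_apply, hgu, hgu']
      · rw [Equiv.Perm.mul_apply, hgS s (hS s hs).1 (h3 s hs), hgS' s (h3 s hs) (hS s hs).2.2.1]
    · obtain ⟨g, hg, hgu, hgS⟩ := exists_isometry_of_form_ne_zero hu hu' c3
      exact ⟨g, hg, hgu, fun s hs => hgS s (hS s hs).1 (hS s hs).2.2.1⟩
  have hgB : ∀ x y, W.form (g x) (g y) = W.form x y := fun x y => by simpa using hg.2.2.1 x y
  have hgq : ∀ x, W.quad (g x) = W.quad x := fun x => by simpa using hg.2.2.2 x
  obtain ⟨g', hg', hgu', hgv', hgS'⟩ := exists_isometry_of_form_eq_one (v := g v) (v' := v') hu'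
    (by rw [hgq, hv]) hv' (by rw [← hgu, hgB, huv]) huv'
  refine ⟨g' * g, mul_mem hg' hg, ?_, ?_, fun s hs => ?_⟩
  · rw [Equiv.Perm.mul_apply, hgu, hgu']
  · rw [Equiv.Perm.mul_apply, hgv']
  · obtain ⟨a1, a2, a3, a4⟩ := hS s hs
    rw [Equiv.Perm.mul_apply, hgS s hs, hgS' s a3 ?_ a4]
    have := hgB v s
    rwa [hgS s hs, a2] at this

end

/-- A hyperbolic frame of length `n`: singular vectors `E 0, …, E (n - 1)` and
`G 0, …, G (n - 1)`, any two of them orthogonal except that `B (E a) (G a) = 1`. The values of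
`E` and `G` from `n` on are irrelevant. -/
structure IsFrame (W : FormedSpace F V) (n : ℕ) (E G : ℕ → V) : Prop where
  quad_left : ∀ a < n, W.quad (E a) = 0
  quad_right : ∀ a < n, W.quad (G a) = 0
  left_left : ∀ a < n, ∀ b < n, W.form (E a) (E b) = 0
  right_right : ∀ a < n, ∀ b < n, W.form (G a) (G b) = 0
  left_right : ∀ a < n, ∀ b < n, W.form (E a) (G b) = if a = b then 1 else 0

theorem IsFrame.mono {n m : ℕ} {E G : ℕ → V} (h : W.IsFrame n E G) (hm : m ≤ n) :
    W.IsFrame m E G where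
  quad_left a ha := h.quad_left a (by omega)
  quad_right a ha := h.quad_right a (by omega)
  left_left a ha b hb := h.left_left a (by omega) b (by omega)
  right_right a ha b hb := h.right_right a (by omega) b (by omega)
  left_right a ha b hb := h.left_right a (by omega) b (by omega)

theorem IsFrame.right_left {n : ℕ} {E G : ℕ → V} (h : W.IsFrame n E G) {a b : ℕ} (ha : a < n)
    (hb : b < n) : W.form (G a) (E b) = if a = b then W.sign else 0 := by
  rw [W.form_swap, h.left_right b hb a ha]
  split_ifs <;> first | omega | simp

/-- Witt's theorem for hyperbolic frames. -/
theorem IsFrame.exists_isometry [FiniteDimensional F V] {n : ℕ} {E G E' G' : ℕ → V}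
    (h : W.IsFrame n E G) (h' : W.IsFrame n E' G') :
    ∃ g ∈ W.isometryGroup, ∀ a < n, g (E a) = E' a ∧ g (G a) = G' a := by
  induction n with
  | zero => exact ⟨1, one_mem _, fun a ha => absurd ha (Nat.not_lt_zero a)⟩
  | succ n ih =>
    obtain ⟨g, hg, hgE⟩ := ih (h.mono n.le_succ) (h'.mono n.le_succ)
    have hgB : ∀ x y, W.form (g x) (g y) = W.form x y := fun x y => by simpa using hg.2.2.1 x y
    have hgq : ∀ x, W.quad (g x) = W.quad x := fun x => by simpa using hg.2.2.2 x
    obtain ⟨g', hg', h1, h2, h3⟩ := exists_isometry_pair (S := {s | ∃ a < n, s = E' a ∨ s = G' a})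
      (u := g (E n)) (v := g (G n)) (u' := E' n) (v' := G' n)
      (by rw [hgq, h.quad_left n (by omega)]) (by rw [hgq, h.quad_right n (by omega)])
      (h'.quad_left n (by omega)) (h'.quad_right n (by omega))
      (by rw [hgB, h.left_right n (by omega) n (by omega), if_pos rfl])
      (by rw [h'.left_right n (by omega) n (by omega), if_pos rfl]) (by
        rintro s ⟨a, ha, rfl | rfl⟩
        · rw [h'.left_left n (by omega) a (by omega), h'.right_left (by omega) (by omega),
            ← (hgE a ha).1, hgB, hgB, h.left_left n (by omega) a (by omega),
            h.right_left (by omega) (by omega), if_neg (by omega)]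
          simp
        · rw [h'.right_right n (by omega) a (by omega), h'.left_right n (by omega) a (by omega),
            ← (hgE a ha).2, hgB, hgB, h.right_right n (by omega) a (by omega),
            h.left_right n (by omega) a (by omega), if_neg (by omega)]
          simp)
    refine ⟨g' * g, mul_mem hg' hg, fun a ha => ?_⟩
    rw [Equiv.Perm.mul_apply, Equiv.Perm.mul_apply]
    rcases Nat.lt_succ_iff_lt_or_eq.mp ha with ha | rfl
    · rw [(hgE a ha).1, (hgE a ha).2]
      exact ⟨h3 _ ⟨a, ha, Or.inl rfl⟩, h3 _ ⟨a, ha, Or.inr rfl⟩⟩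
    · exact ⟨h1, h2⟩

end FormedSpace

/-! ### Dimensions of subspaces -/

namespace Submodule

open Module

variable {F V : Type*} [Field F] [AddCommGroup V] [Module F V]

theorem sup_span_singleton_le {A B : Submodule F V} {v : V} (h : A ≤ B) (hv : v ∈ B) :
    A ⊔ span F {v} ≤ B :=
  sup_le h ((span_singleton_le_iff_mem v B).mpr hv)

theorem mem_sup_span_singleton_self (A : Submodule F V) (v : V) : v ∈ A ⊔ span F {v} :=
  mem_sup_right (mem_span_singleton_self v)

variable [FiniteDimensional F V]

theorem exists_mem_notMem_of_finrank_lt {A B : Submodule F V} (h : finrank F A < finrank F B) :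
    ∃ v ∈ B, v ∉ A := by
  by_contra! hc
  exact absurd (finrank_mono (show B ≤ A from hc)) (by omega)

/-- Subspaces between two given ones exist in each possible dimension. -/
theorem exists_between_finrank_eq {A K : Submodule F V} (hAK : A ≤ K) {n : ℕ}
    (h1 : finrank F A ≤ n) (h2 : n ≤ finrank F K) :
    ∃ H, A ≤ H ∧ H ≤ K ∧ finrank F H = n := by
  induction n, h1 using Nat.le_induction with
  | base => exact ⟨A, le_rfl, hAK, rfl⟩
  | succ n hn ih =>
    obtain ⟨H, h3, h4, h5⟩ := ih (by omega)
    obtain ⟨v, hv, hvH⟩ := exists_mem_notMem_of_finrank_lt (A := H) (B := K) (by omega)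
    exact ⟨H ⊔ span F {v}, h3.trans le_sup_left, sup_span_singleton_le h4 hv,
      by rw [finrank_sup_span_singleton hvH, h5]⟩

theorem finrank_add_finrank_le_of_le {A B C : Submodule F V} (hA : A ≤ C) (hB : B ≤ C) :
    finrank F A + finrank F B ≤ finrank F (A ⊓ B : Submodule F V) + finrank F C := by
  have h := finrank_sup_add_finrank_inf_eq A B
  have := finrank_mono (sup_le hA hB)
  omega

theorem finrank_le_finrank_inf_ker_add_one (T : Submodule F V) (f : V →ₗ[F] F) :
    finrank F T ≤ finrank F (T ⊓ LinearMap.ker f : Submodule F V) + 1 := by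
  have h := finrank_sup_add_finrank_inf_eq T (LinearMap.ker f)
  have h1 := f.finrank_range_add_finrank_ker
  have h2 := (LinearMap.range f).finrank_le
  rw [finrank_self] at h2
  have h3 := (T ⊔ LinearMap.ker f).finrank_le
  omega

end Submodule

namespace FormedSpace

open Module Submodule

variable {F V : Type*} [Field F] [AddCommGroup V] [Module F V]

/-! ### Orthogonal complements and singular subspaces -/

/-- The orthogonal complement of `A` with respect to `W.form`. -/
def perp (W : FormedSpace F V) (A : Submodule F V) : Submodule F V where
  carrier := {y | ∀ x ∈ A, W.form x y = 0}
  add_mem' h h' x hx := by rw [form_add_right, h x hx, h' x hx, add_zero]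
  zero_mem' x _ := by simp
  smul_mem' a y h x hx := by rw [form_smul_right, h x hx, mul_zero]

variable {W : FormedSpace F V}

theorem mem_perp_iff {A : Submodule F V} {y : V} : y ∈ W.perp A ↔ ∀ x ∈ A, W.form y x = 0 :=
  forall₂_congr fun _ _ => W.form_comm_zero_iff

theorem perp_anti {A B : Submodule F V} (h : A ≤ B) : W.perp B ≤ W.perp A :=
  fun _ hy x hx => hy x (h hx)

theorem le_perp_comm {A B : Submodule F V} : A ≤ W.perp B ↔ B ≤ W.perp A :=
  ⟨fun h _ hx _ hy => W.form_comm_zero (h hy _ hx), fun h _ hx _ hy => W.form_comm_zero (h hy _ hx)⟩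

theorem span_singleton_le_perp {A : Submodule F V} {v : V} :
    span F {v} ≤ W.perp A ↔ v ∈ W.perp A := span_singleton_le_iff_mem v _

theorem mem_perp_sup {A B : Submodule F V} {y : V} :
    y ∈ W.perp (A ⊔ B) ↔ y ∈ W.perp A ∧ y ∈ W.perp B := by
  rw [← span_singleton_le_perp, le_perp_comm, sup_le_iff, le_perp_comm, le_perp_comm (A := B),
    span_singleton_le_perp, span_singleton_le_perp]

theorem mem_perp_span_singleton {v y : V} : y ∈ W.perp (span F {v}) ↔ W.form v y = 0 := by
  rw [← span_singleton_le_perp, le_perp_comm, span_singleton_le_perp, mem_perp_iff]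
  exact ⟨fun h => h y (mem_span_singleton_self y), fun h x hx => by
    obtain ⟨a, rfl⟩ := mem_span_singleton.mp hx; rw [form_smul_right, h, mul_zero]⟩

theorem IsSingular.mono {A B : Submodule F V} (h : W.IsSingular B) (hAB : A ≤ B) :
    W.IsSingular A :=
  ⟨fun x hx y hy => h.1 x (hAB hx) y (hAB hy), fun x hx => h.2 x (hAB hx)⟩

theorem IsSingular.le_perp {A : Submodule F V} (h : W.IsSingular A) : A ≤ W.perp A :=
  fun y hy x hx => h.1 x hx y hy

theorem IsSingular.sup {A B : Submodule F V} (hA : W.IsSingular A) (hB : W.IsSingular B)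
    (h : B ≤ W.perp A) : W.IsSingular (A ⊔ B) := by
  refine ⟨?_, ?_⟩
  · refine fun x hx => mem_perp_iff.mp (mem_perp_sup.mpr ⟨?_, ?_⟩)
    · exact sup_le hA.le_perp h hx
    · exact sup_le (le_perp_comm.mp h) hB.le_perp hx
  · intro x hx
    obtain ⟨a, ha, b, hb, rfl⟩ := mem_sup.mp hx
    rw [quad_add, hA.2 a ha, hB.2 b hb, h hb a ha, map_zero, add_zero, add_zero]

theorem isSingular_bot : W.IsSingular ⊥ := by
  refine ⟨fun x hx y _ => ?_, fun x hx => ?_⟩ <;> rw [(mem_bot F).mp hx] <;> simp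

theorem isSingular_span_singleton {v : V} (h : W.quad v = 0) : W.IsSingular (span F {v}) := by
  refine ⟨fun x hx y hy => ?_, fun x hx => ?_⟩
  · obtain ⟨a, rfl⟩ := mem_span_singleton.mp hx
    obtain ⟨b, rfl⟩ := mem_span_singleton.mp hy
    rw [form_smul_left, form_smul_right, W.form_self h, mul_zero, mul_zero]
  · obtain ⟨a, rfl⟩ := mem_span_singleton.mp hx
    rw [quad_smul, h, mul_zero]

theorem IsSingular.sup_span_singleton {A : Submodule F V} (hA : W.IsSingular A) {v : V}
    (hv : W.quad v = 0) (h : v ∈ W.perp A) : W.IsSingular (A ⊔ span F {v}) :=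
  hA.sup (isSingular_span_singleton hv) (span_singleton_le_perp.mpr h)

section

variable {k : ℕ} {X Y : W.Singular k}

theorem Adj.le_perp (h : (W.polarGrassmannGraph k).Adj X Y) : Y.1 ≤ W.perp X.1 :=
  (le_sup_right.trans h.1.le_perp).trans (perp_anti le_sup_left)

theorem opposite_iff : W.Opposite X Y ↔ X ≠ Y ∧ Y.1 ⊓ W.perp X.1 ≤ X.1 := by
  refine and_congr_right fun _ => ⟨fun h y ⟨hy, hy'⟩ => ?_, fun h y hy hyX => ?_⟩
  · by_contra hyX
    obtain ⟨x, hx, -, hxy⟩ := h y hy hyX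
    exact hxy (hy' x hx)
  · by_contra! hc
    refine hyX (h ⟨hy, fun x hx => ?_⟩)
    by_cases hxY : x ∈ Y.1
    · exact Y.2.1.1 x hxY y hy
    · exact hc x hx hxY

theorem Opposite.inf_perp_le (h : W.Opposite X Y) : Y.1 ⊓ W.perp X.1 ≤ X.1 ⊓ Y.1 :=
  le_inf (opposite_iff.mp h).2 inf_le_left

end

variable [FiniteDimensional F V]

/-- Passing from the orthogonal complement of `A'` to that of a larger space `A` lowers the
dimension by at most `dim A - dim A'`. -/
theorem finrank_inf_perp_le (Y : Submodule F V) {A' A : Submodule F V} (h : A' ≤ A) :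
    finrank F (Y ⊓ W.perp A' : Submodule F V) + finrank F A' ≤
      finrank F (Y ⊓ W.perp A : Submodule F V) + finrank F A := by
  obtain ⟨n, hn⟩ := Nat.exists_eq_add_of_le (finrank_mono h)
  induction n generalizing A' with
  | zero => rw [eq_of_le_of_finrank_eq h (by omega)]
  | succ n ih =>
    obtain ⟨v, hv, hvA⟩ := exists_mem_notMem_of_finrank_lt (A := A') (B := A) (by omega)
    have h1 := finrank_sup_span_singleton hvA
    have h2 := ih (sup_span_singleton_le h hv) (by omega)
    have h3 := finrank_le_finrank_inf_ker_add_one (Y ⊓ W.perp A') (W.formLin v)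
    have h4 : (Y ⊓ W.perp A') ⊓ LinearMap.ker (W.formLin v) ≤ Y ⊓ W.perp (A' ⊔ span F {v}) := by
      rintro y ⟨⟨hy, hy'⟩, hyv⟩
      exact ⟨hy, mem_perp_sup.mpr ⟨hy', mem_perp_span_singleton.mpr hyv⟩⟩
    have h5 := finrank_mono h4
    omega

theorem finrank_add_le_of_le_perp {Y A' A : Submodule F V} (h : A' ≤ A) (h' : Y ≤ W.perp A') :
    finrank F Y + finrank F A' ≤ finrank F (Y ⊓ W.perp A : Submodule F V) + finrank F A := by
  have h1 := finrank_inf_perp_le (W := W) Y h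
  rwa [inf_eq_left.mpr h'] at h1

theorem bddAbove_singular (W : FormedSpace F V) :
    BddAbove {d : ℕ | ∃ U : Submodule F V, W.IsSingular U ∧ finrank F U = d} :=
  ⟨finrank F V, by rintro d ⟨U, -, rfl⟩; exact U.finrank_le⟩

theorem IsSingular.finrank_le {U : Submodule F V} (h : W.IsSingular U) :
    finrank F U ≤ W.wittIndex := le_csSup W.bddAbove_singular ⟨U, h, rfl⟩

theorem exists_finrank_eq_wittIndex (W : FormedSpace F V) :
    ∃ M : Submodule F V, W.IsSingular M ∧ finrank F M = W.wittIndex :=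
  Nat.sSup_mem (s := {d : ℕ | ∃ U : Submodule F V, W.IsSingular U ∧ finrank F U = d})
    ⟨0, ⊥, isSingular_bot, finrank_bot F V⟩ W.bddAbove_singular

/-- All maximal singular subspaces have the same dimension. -/
theorem IsSingular.exists_le_finrank_eq {U : Submodule F V} (h : W.IsSingular U) :
    ∃ M, U ≤ M ∧ W.IsSingular M ∧ finrank F M = W.wittIndex := by
  obtain ⟨n, hn⟩ := Nat.exists_eq_add_of_le h.finrank_le
  induction n generalizing U with
  | zero => exact ⟨U, le_rfl, h, by omega⟩
  | succ n ih =>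
    obtain ⟨M, hM, hMd⟩ := W.exists_finrank_eq_wittIndex
    have h1 := finrank_add_le_of_le_perp (W := W) (Y := M) (A' := U ⊓ M) (A := U) inf_le_left
      (hM.le_perp.trans (perp_anti inf_le_right))
    obtain ⟨v, ⟨hvM, hvU⟩, hv⟩ := exists_mem_notMem_of_finrank_lt
      (A := U ⊓ M) (B := M ⊓ W.perp U) (by omega)
    have hv' : v ∉ U := fun hh => hv ⟨hh, hvM⟩
    obtain ⟨M', h2, h3⟩ := ih (h.sup_span_singleton (hM.2 v hvM) hvU)
      (by rw [finrank_sup_span_singleton hv']; omega)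
    exact ⟨M', le_sup_left.trans h2, h3⟩

/-- A singular vector orthogonal to a singular subspace `U` and to a subspace `T` of dimension less
than the Witt index, and lying outside `U ∩ T`: a maximal singular subspace through `U` is too
large to meet `Tᗮ` in a subspace of `T`. -/
theorem IsSingular.exists_mem_perp {U T : Submodule F V} (hU : W.IsSingular U)
    (hT : finrank F T < W.wittIndex) :
    ∃ z, W.quad z = 0 ∧ z ∈ W.perp U ∧ z ∈ W.perp T ∧ z ∉ U ⊓ T := by
  obtain ⟨M, hUM, hM, hMd⟩ := hU.exists_le_finrank_eq
  have h1 := finrank_add_le_of_le_perp (W := W) (Y := M) (A' := U ⊓ T) (A := T) inf_le_right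
    (hM.le_perp.trans (perp_anti (inf_le_left.trans hUM)))
  obtain ⟨z, ⟨hzM, hzT⟩, hz⟩ := exists_mem_notMem_of_finrank_lt
    (A := U ⊓ T) (B := M ⊓ W.perp T) (by omega)
  exact ⟨z, hM.2 z hzM, perp_anti hUM (hM.le_perp hzM), hzT, hz⟩

/-! ### Adjacency, opposite vertices and distances -/

variable {k : ℕ} {X Y Z : W.Singular k}

theorem Adj.finrank_inf (h : (W.polarGrassmannGraph k).Adj X Y) :
    finrank F (X.1 ⊓ Y.1 : Submodule F V) + 1 = k := by
  have h1 := finrank_sup_add_finrank_inf_eq X.1 Y.1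
  rw [h.2, X.2.2, Y.2.2] at h1
  omega

theorem adj_of_le {S : Submodule F V} (hS : W.IsSingular S) (hSd : finrank F S = k + 1)
    (hX : X.1 ≤ S) (hY : Y.1 ≤ S) (hXY : X ≠ Y) : (W.polarGrassmannGraph k).Adj X Y := by
  refine ⟨hS.mono (sup_le hX hY), le_antisymm ((finrank_mono (sup_le hX hY)).trans hSd.le) ?_⟩
  by_contra! hlt
  have h1 : X.1 = X.1 ⊔ Y.1 := eq_of_le_of_finrank_le le_sup_left (by rw [X.2.2]; omega)
  have h2 : Y.1 = X.1 ⊔ Y.1 := eq_of_le_of_finrank_le le_sup_right (by rw [Y.2.2]; omega)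
  exact hXY (Subtype.ext (h1.trans h2.symm))

theorem adj_of_le_finrank_inf (hXY : X ≠ Y) (h : Y.1 ≤ W.perp X.1)
    (hd : k ≤ finrank F (X.1 ⊓ Y.1 : Submodule F V) + 1) : (W.polarGrassmannGraph k).Adj X Y := by
  refine ⟨X.2.1.sup Y.2.1 h, ?_⟩
  have h1 := finrank_sup_add_finrank_inf_eq X.1 Y.1
  have h2 := finrank_mono (inf_le_left : X.1 ⊓ Y.1 ≤ X.1)
  rw [X.2.2, Y.2.2] at h1
  rw [X.2.2] at h2
  refine le_antisymm (by omega) ?_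
  by_contra! hlt
  have h3 : X.1 ⊓ Y.1 = X.1 := eq_of_le_of_finrank_le inf_le_left (by rw [X.2.2]; omega)
  have h4 : X.1 ⊓ Y.1 = Y.1 := eq_of_le_of_finrank_le inf_le_right (by rw [Y.2.2]; omega)
  exact hXY (Subtype.ext (h3.symm.trans h4))

theorem eq_of_le (h : X.1 ≤ Y.1) : X = Y :=
  Subtype.ext (eq_of_le_of_finrank_eq h (by rw [X.2.2, Y.2.2]))

theorem Opposite.symm (h : W.Opposite X Y) : W.Opposite Y X := by
  rw [opposite_iff] at h ⊢
  refine ⟨h.1.symm, fun x ⟨hx, hxY⟩ => ?_⟩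
  by_contra hxY'
  have h1 := finrank_add_le_of_le_perp (W := W) (Y := Y.1) (A' := (X.1 ⊓ Y.1) ⊔ span F {x})
    (A := X.1) (sup_span_singleton_le inf_le_left hx) (by
      rw [le_perp_comm]
      exact sup_span_singleton_le (inf_le_right.trans Y.2.1.le_perp) hxY)
  rw [finrank_sup_span_singleton (fun hh => hxY' (mem_inf.mp hh).2), X.2.2, Y.2.2] at h1
  have h2 := finrank_mono (le_inf h.2 inf_le_left : Y.1 ⊓ W.perp X.1 ≤ X.1 ⊓ Y.1)
  omega

/-- The vertex `H + ⟨z⟩`, where `H` is a hyperplane of a vertex `X` and `z` is a singular vector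
orthogonal to `X`, and not in `X`. -/
theorem exists_adj_hyperplane_sup {H : Submodule F V} {z : V} (hH : H ≤ X.1)
    (hHd : finrank F H + 1 = k) (hz : W.quad z = 0) (hzX : z ∈ W.perp X.1) (hzX' : z ∉ X.1) :
    ∃ Z : W.Singular k, Z.1 = H ⊔ span F {z} ∧ (W.polarGrassmannGraph k).Adj X Z := by
  have hS := X.2.1.sup_span_singleton hz hzX
  have hle : H ⊔ span F {z} ≤ X.1 ⊔ span F {z} := sup_le_sup_right hH _
  refine ⟨⟨H ⊔ span F {z}, hS.mono hle, ?_⟩, rfl, adj_of_le hS ?_ le_sup_left hle ?_⟩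
  · rw [finrank_sup_span_singleton (fun h => hzX' (hH h)), hHd]
  · rw [finrank_sup_span_singleton hzX', X.2.2]
  · intro h
    exact hzX' (h ▸ mem_sup_span_singleton_self H z : z ∈ X.1)

theorem Adj.finrank_inf_le (h : (W.polarGrassmannGraph k).Adj X Z) :
    finrank F (Z.1 ⊓ Y.1 : Submodule F V) ≤ finrank F (X.1 ⊓ Y.1 : Submodule F V) + 1 := by
  have h1 := finrank_add_finrank_le_of_le (A := X.1 ⊓ Z.1) (B := Z.1 ⊓ Y.1) inf_le_right inf_le_left
  have h2 := Adj.finrank_inf h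
  have h3 : (X.1 ⊓ Z.1) ⊓ (Z.1 ⊓ Y.1) ≤ X.1 ⊓ Y.1 :=
    le_inf (inf_le_left.trans inf_le_left) (inf_le_right.trans inf_le_right)
  have h4 := finrank_mono h3
  rw [Z.2.2] at h1
  omega

/-- Each step of a path enlarges the intersection with `Y` by at most one dimension. -/
theorem le_finrank_inf_add_length (w : (W.polarGrassmannGraph k).Walk X Y) :
    k ≤ finrank F (X.1 ⊓ Y.1 : Submodule F V) + w.length := by
  induction w with
  | @nil X => rw [inf_idem, X.2.2]; omega
  | @cons X Z Y h w ih =>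
    have := Adj.finrank_inf_le (Y := Y) h
    rw [SimpleGraph.Walk.length_cons]
    omega

theorem exists_walk_of_not_opposite (hXY : X ≠ Y) (h : ¬ W.Opposite X Y) :
    ∃ w : (W.polarGrassmannGraph k).Walk X Y,
      finrank F (X.1 ⊓ Y.1 : Submodule F V) + w.length = k := by
  have hle := finrank_mono (inf_le_left : X.1 ⊓ Y.1 ≤ X.1)
  rw [X.2.2] at hle
  obtain ⟨n, hn⟩ := Nat.exists_eq_add_of_le hle
  induction n generalizing X with
  | zero =>
    exact absurd (eq_of_le (inf_eq_left.mp
      (eq_of_le_of_finrank_eq inf_le_left (by rw [X.2.2]; omega)))) hXY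
  | succ n ih =>
    obtain ⟨y, ⟨hyY, hyX⟩, hyX'⟩ := Set.not_subset.mp (fun hh => h (opposite_iff.mpr ⟨hXY, hh⟩))
    have hqy := Y.2.1.2 y hyY
    rcases Nat.eq_zero_or_pos n with rfl | hn0
    · obtain ⟨Z, hZ, hadj⟩ := exists_adj_hyperplane_sup (H := X.1 ⊓ Y.1) inf_le_left (by omega)
        hqy hyX hyX'
      have : Z = Y := eq_of_le (by rw [hZ]; exact sup_span_singleton_le inf_le_right hyY)
      subst this
      exact ⟨hadj.toWalk, by simp; omega⟩
    · -- a second vector `y'` of `Y` keeps the next vertex `H + ⟨y⟩` from being opposite to `Y`,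
      -- where `H` is a hyperplane of `X` orthogonal to `y'`
      obtain ⟨y', hyY', hy'⟩ := exists_mem_notMem_of_finrank_lt
        (A := X.1 ⊓ Y.1 ⊔ span F {y}) (B := Y.1)
        (by rw [finrank_sup_span_singleton (fun hh => hyX' (mem_inf.mp hh).1), Y.2.2]; omega)
      have h1 := finrank_le_finrank_inf_ker_add_one X.1 (W.formLin y')
      rw [X.2.2] at h1
      obtain ⟨H, hDH, hHX, hHd⟩ := exists_between_finrank_eq (A := X.1 ⊓ Y.1)
        (K := X.1 ⊓ LinearMap.ker (W.formLin y')) (n := k - 1)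
        (le_inf inf_le_left fun x hx => Y.2.1.1 y' hyY' x hx.2) (by omega) (by omega)
      obtain ⟨Z, hZ, hadj⟩ := exists_adj_hyperplane_sup (H := H) (hHX.trans inf_le_left) (by omega)
        hqy hyX hyX'
      have hZY : Z.1 ⊓ Y.1 = X.1 ⊓ Y.1 ⊔ span F {y} := by
        rw [hZ]
        refine le_antisymm ?_ ?_
        · rintro x ⟨hx, hxY⟩
          obtain ⟨u, hu, v, hv, rfl⟩ := mem_sup.mp hx
          have hvY : v ∈ Y.1 := (span_singleton_le_iff_mem y Y.1).mpr hyY hv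
          exact add_mem (mem_sup_left ⟨(hHX hu).1, by simpa using sub_mem hxY hvY⟩)
            (mem_sup_right hv)
        · exact le_inf (sup_le_sup_right hDH _) (sup_span_singleton_le inf_le_right hyY)
      have hZYd : finrank F (Z.1 ⊓ Y.1 : Submodule F V) =
          finrank F (X.1 ⊓ Y.1 : Submodule F V) + 1 := by
        rw [hZY, finrank_sup_span_singleton (fun hh => hyX' (mem_inf.mp hh).1)]
      have hyZ' : y' ∉ Z.1 := fun hh => hy' (hZY ▸ ⟨hh, hyY'⟩)
      obtain ⟨w, hw⟩ := ih (X := Z) (by rintro rfl; exact hyZ' hyY') (fun hop => by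
        refine hyZ' ((opposite_iff.mp hop).2 ⟨hyY', ?_⟩)
        rw [hZ]
        refine mem_perp_sup.mpr ⟨fun x hx => W.form_comm_zero (hHX hx).2, ?_⟩
        exact mem_perp_span_singleton.mpr (Y.2.1.1 y hyY y' hyY')) (by omega) (by omega)
      exact ⟨.cons hadj w, by rw [SimpleGraph.Walk.length_cons]; omega⟩

/-- Nonopposite vertices `X`, `Y` have distance `k - dim (X ∩ Y)`. -/
theorem dist_add_of_not_opposite (hXY : X ≠ Y) (h : ¬ W.Opposite X Y) :
    (W.polarGrassmannGraph k).Reachable X Y ∧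
    (W.polarGrassmannGraph k).dist X Y + finrank F (X.1 ⊓ Y.1 : Submodule F V) = k := by
  obtain ⟨w, hw⟩ := exists_walk_of_not_opposite hXY h
  refine ⟨⟨w⟩, ?_⟩
  obtain ⟨w', hw'⟩ := SimpleGraph.Reachable.exists_walk_length_eq_dist ⟨w⟩
  have h1 := le_finrank_inf_add_length w'
  have h2 := SimpleGraph.dist_le w
  omega

theorem finrank_inf_lt (hXY : X ≠ Y) : finrank F (X.1 ⊓ Y.1 : Submodule F V) < k := by
  have hle := finrank_mono (inf_le_left : X.1 ⊓ Y.1 ≤ X.1)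
  rw [X.2.2] at hle
  refine lt_of_le_of_ne hle fun h => hXY (eq_of_le (inf_eq_left.mp
      (eq_of_le_of_finrank_eq inf_le_left (by rw [X.2.2, h]))))

namespace Opposite

theorem inf_perp_le' (h : W.Opposite X Y) : X.1 ⊓ W.perp Y.1 ≤ X.1 ⊓ Y.1 :=
  le_inf inf_le_left (opposite_iff.mp h.symm).2

/-- Between opposite vertices `X`, `Y`, the vertices `H + ⟨z⟩`, with `H` a hyperplane of `X`
containing `X ∩ Y` and `z` orthogonal to both ends, meet `Y` only in `X ∩ Y` and are no longer
opposite to `Y`, so that the distance formula for nonopposite vertices applies to them. -/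
theorem exists_adj (h : W.Opposite X Y) {H : Submodule F V} {z : V} (hDH : X.1 ⊓ Y.1 ≤ H)
    (hH : H ≤ X.1) (hHd : finrank F H + 1 = k) (hz : W.quad z = 0) (hzX : z ∈ W.perp X.1)
    (hzY : z ∈ W.perp Y.1) (hzD : z ∉ X.1 ⊓ Y.1) :
    ∃ Z : W.Singular k, Z.1 = H ⊔ span F {z} ∧ (W.polarGrassmannGraph k).Adj X Z ∧
      Z ≠ Y ∧ ¬ W.Opposite Z Y ∧ Z.1 ⊓ Y.1 = X.1 ⊓ Y.1 := by
  have hzX' : z ∉ X.1 := fun hh => hzD (h.inf_perp_le' ⟨hh, hzY⟩)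
  obtain ⟨Z, hZ, hadj⟩ := exists_adj_hyperplane_sup hH hHd hz hzX hzX'
  have hZY : Z.1 ⊓ Y.1 = X.1 ⊓ Y.1 := by
    refine le_antisymm ?_ (le_inf (by rw [hZ]; exact hDH.trans le_sup_left) inf_le_right)
    exact fun y hy => h.inf_perp_le ⟨hy.2, Adj.le_perp hadj hy.1⟩
  have hlt := finrank_inf_lt h.1
  have h1 := finrank_add_le_of_le_perp (W := W) (Y := Y.1) hDH
    (le_perp_comm.mp (inf_le_right.trans Y.2.1.le_perp))
  rw [Y.2.2] at h1
  obtain ⟨y, ⟨hyY, hyH⟩, hy⟩ := exists_mem_notMem_of_finrank_lt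
    (A := X.1 ⊓ Y.1) (B := Y.1 ⊓ W.perp H) (by omega)
  have hyZ : y ∉ Z.1 := fun hh => hy (hZY ▸ ⟨hh, hyY⟩)
  refine ⟨Z, hZ, hadj, by rintro rfl; exact hyZ hyY, fun hop => ?_, hZY⟩
  refine hyZ ((opposite_iff.mp hop).2 ⟨hyY, ?_⟩)
  rw [hZ]
  exact mem_perp_sup.mpr ⟨hyH, mem_perp_span_singleton.mpr (W.form_comm_zero (hzY y hyY))⟩

/-- Opposite vertices `X`, `Y` have distance `k - dim (X ∩ Y) + 1`: the first step of a path from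
`X` to `Y` cannot enlarge the intersection with `Y`. -/
theorem dist_add (h : W.Opposite X Y) (hk : k < W.wittIndex) :
    (W.polarGrassmannGraph k).Reachable X Y ∧
    (W.polarGrassmannGraph k).dist X Y + finrank F (X.1 ⊓ Y.1 : Submodule F V) = k + 1 := by
  have hlt := finrank_inf_lt h.1
  obtain ⟨z, hz, hzX, hzY, hzD⟩ := X.2.1.exists_mem_perp (T := Y.1) (by rwa [Y.2.2])
  obtain ⟨H, hDH, hHX, hHd⟩ := exists_between_finrank_eq (A := X.1 ⊓ Y.1) (K := X.1) (n := k - 1)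
    inf_le_left (by omega) (by rw [X.2.2]; omega)
  obtain ⟨Z, -, hadj, hZY, hop, hZYD⟩ := h.exists_adj hDH hHX (by omega) hz hzX hzY hzD
  obtain ⟨w, hw⟩ := exists_walk_of_not_opposite hZY hop
  have hr : (W.polarGrassmannGraph k).Reachable X Y := ⟨.cons hadj w⟩
  refine ⟨hr, ?_⟩
  have h1 := SimpleGraph.dist_le (.cons hadj w)
  rw [SimpleGraph.Walk.length_cons] at h1
  rw [hZYD] at hw
  obtain ⟨w', hw'⟩ := hr.exists_walk_length_eq_dist
  have h2 := le_finrank_inf_add_length w'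
  rw [← hw'] at h1 ⊢
  clear hw'
  cases w' with
  | nil => exact absurd rfl h.1
  | @cons _ Z' _ hadj' w' =>
    have h3 := le_finrank_inf_add_length w'
    rw [SimpleGraph.Walk.length_cons] at *
    -- `Z' ∩ Y` is orthogonal to `X`, so it is contained in `X ∩ Y`
    have h4 : Z'.1 ⊓ Y.1 ≤ X.1 ⊓ Y.1 := fun y hy => h.inf_perp_le ⟨hy.2, Adj.le_perp hadj' hy.1⟩
    have h5 := finrank_mono h4
    omega

end Opposite

end FormedSpace

namespace FormedSpace

open Module Submodule

variable {F V : Type*} [Field F] [AddCommGroup V] [Module F V] {W : FormedSpace F V}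

/-! ### Completing a singular family to a hyperbolic frame -/

theorem form_sum_left {ι : Type*} (s : Finset ι) (c : ι → F) (v : ι → V) (y : V) :
    W.form (∑ i ∈ s, c i • v i) y = ∑ i ∈ s, W.conj (c i) * W.form (v i) y := by
  classical
  induction s using Finset.induction_on with
  | empty => simp
  | insert i s hi ih => rw [Finset.sum_insert hi, Finset.sum_insert hi, form_add_left, ih,
      form_smul_left]

theorem linearIndepOn_of_form {ι : Type*} {s : Finset ι} {v u : ι → V}
    (h : ∀ i ∈ s, W.form (v i) (u i) ≠ 0)
    (h' : ∀ i ∈ s, ∀ j ∈ s, i ≠ j → W.form (v i) (u j) = 0) : LinearIndepOn F v (s : Set ι) := by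
  rw [linearIndepOn_finset_iff]
  intro c hc i hi
  have h1 := W.form_sum_left s c v (u i)
  rw [hc, form_zero_left, Finset.sum_eq_single i
    (fun j hj hji => by rw [h' j hj i hi hji, mul_zero]) (fun hh => absurd hi hh)] at h1
  exact (map_eq_zero W.conj).mp ((mul_eq_zero.mp h1.symm).resolve_right (h i hi))

theorem finrank_span_image_of_linearIndepOn {ι : Type*} {s : Finset ι} {v : ι → V}
    (h : LinearIndepOn F v (s : Set ι)) : finrank F (span F (v '' s)) = s.card := by
  rw [Set.image_eq_range]
  exact (finrank_span_eq_card h).trans (by simp)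

theorem IsFrame.linearIndepOn {n : ℕ} {E G : ℕ → V} (h : W.IsFrame n E G) (i : ℕ) :
    LinearIndepOn F (fun c => if c < i then G c else E c) (Finset.range n : Set ℕ) := by
  refine linearIndepOn_of_form (W := W) (u := fun c => if c < i then E c else G c) ?_ ?_
  · intro a ha
    rw [Finset.mem_range] at ha
    by_cases hai : a < i
    · simp only [hai, if_true, h.right_left ha ha]; exact W.sign_ne_zero
    · simp only [hai, if_false, h.left_right a ha a ha, if_true]; exact one_ne_zero
  · intro a ha b hb hab
    rw [Finset.mem_range] at ha hb
    by_cases hai : a < i <;> by_cases hbi : b < i <;>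
      simp [hai, hbi, h.right_left ha hb, h.left_right a ha b hb, h.right_right a ha b hb,
        h.left_left a ha b hb, hab]

theorem isSingular_span_image {ι : Type*} {s : Set ι} {v : ι → V}
    (hq : ∀ a ∈ s, W.quad (v a) = 0) (hB : ∀ a ∈ s, ∀ b ∈ s, W.form (v a) (v b) = 0) :
    W.IsSingular (span F (v '' s)) := by
  have hperp : span F (v '' s) ≤ W.perp (span F (v '' s)) := by
    rw [span_le]
    rintro _ ⟨a, ha, rfl⟩
    rw [SetLike.mem_coe, ← span_singleton_le_perp, le_perp_comm, span_le]
    rintro _ ⟨b, hb, rfl⟩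
    exact mem_perp_span_singleton.mpr (hB a ha b hb)
  refine ⟨fun u hu w hw => hperp hw u hu, fun u hu => ?_⟩
  induction hu using span_induction with
  | mem u hu => obtain ⟨a, ha, rfl⟩ := hu; exact hq a ha
  | zero => exact W.quad_zero
  | add u w hu hw ihu ihw => rw [quad_add, ihu, ihw, hperp hw u hu, map_zero]; simp
  | smul c u _ ihu => rw [quad_smul, ihu, mul_zero]

variable [FiniteDimensional F V]

/-- The double orthogonal complement of `K` is `K` plus the radical of the form. -/
theorem exists_sub_mem_radical {K : Submodule F V} {v : V}
    (h : ∀ y ∈ W.perp K, W.form v y = 0) : ∃ x ∈ K, ∀ y, W.form (v - x) y = 0 := by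
  let Φ : Submodule F (Dual F V) :=
    { carrier := {f | ∃ x ∈ K, W.formLin x = f}
      add_mem' := by
        rintro _ _ ⟨x, hx, rfl⟩ ⟨y, hy, rfl⟩
        exact ⟨x + y, add_mem hx hy, by ext z; simp⟩
      zero_mem' := ⟨0, K.zero_mem, by ext z; simp⟩
      smul_mem' := by
        rintro c _ ⟨x, hx, rfl⟩
        exact ⟨W.conj c • x, K.smul_mem _ hx, by ext z; simp [conj_conj]⟩ }
  have h1 : W.formLin v ∈ Φ := by
    rw [← Subspace.dualCoannihilator_dualAnnihilator_eq (W := Φ), mem_dualAnnihilator]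
    intro y hy
    rw [mem_dualCoannihilator] at hy
    exact h y fun x hx => hy _ ⟨x, hx, rfl⟩
  obtain ⟨x, hx, hxv⟩ := h1
  refine ⟨x, hx, fun y => ?_⟩
  rw [form_sub_left, sub_eq_zero]
  exact (LinearMap.congr_fun hxv y).symm

/-- A linearly independent family spanning a singular subspace, together with some of the partners
required in a hyperbolic frame, extends to a hyperbolic frame. -/
theorem exists_isFrame {n m : ℕ} (hm : m ≤ n) {E G : ℕ → V}
    (hE : LinearIndepOn F E (Set.Iio n)) (hq : ∀ a < n, W.quad (E a) = 0)
    (hB : ∀ a < n, ∀ b < n, W.form (E a) (E b) = 0) (hGq : ∀ a < m, W.quad (G a) = 0)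
    (hGB : ∀ a < m, ∀ b < m, W.form (G a) (G b) = 0)
    (hEG : ∀ a < n, ∀ b < m, W.form (E a) (G b) = if a = b then 1 else 0) :
    ∃ G', W.IsFrame n E G' ∧ ∀ b < m, G' b = G b := by
  induction hd : n - m generalizing m G with
  | zero =>
    obtain rfl : m = n := by omega
    exact ⟨G, ⟨hq, hGq, hB, hGB, hEG⟩, fun _ _ => rfl⟩
  | succ d ih =>
    have hmn : m < n := by omega
    have hGE : ∀ b < m, ∀ a < n, W.form (G b) (E a) = if b = a then W.sign else 0 := by
      intro b hb a ha
      rw [W.form_swap, hEG a ha b hb]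
      split_ifs <;> first | omega | simp
    obtain ⟨y, hyE, hyG, hy⟩ : ∃ y, (∀ a < n, a ≠ m → W.form (E a) y = 0) ∧
        (∀ b < m, W.form (G b) y = 0) ∧ W.form (E m) y ≠ 0 := by
      by_contra! hc
      obtain ⟨x, hx, hrad⟩ := exists_sub_mem_radical (W := W) (v := E m)
        (K := span F (E '' (Set.Iio n \ {m})) ⊔ span F (G '' (Finset.range m : Set ℕ)))
        fun y hy => hc y
          (fun a ha ham => hy _ (mem_sup_left (subset_span ⟨a, ⟨ha, ham⟩, rfl⟩)))
          (fun b hb => hy _ (mem_sup_right (subset_span ⟨b, by simpa using hb, rfl⟩)))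
      obtain ⟨x₁, hx₁, x₂, hx₂, rfl⟩ := mem_sup.mp hx
      have hS : W.IsSingular (span F (E '' Set.Iio n)) :=
        isSingular_span_image (fun a ha => hq a ha) (fun a ha b hb => hB a ha b hb)
      have hx₁' : x₁ ∈ span F (E '' Set.Iio n) := span_mono (Set.image_mono Set.sdiff_subset) hx₁
      have hEm : ∀ b < n, E b ∈ span F (E '' Set.Iio n) := fun b hb => subset_span ⟨b, hb, rfl⟩
      have hx₂' : x₂ = 0 := by
        obtain ⟨c, rfl⟩ := (mem_span_image_finset_iff_exists_fun F).mp hx₂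
        refine Finset.sum_eq_zero fun b hb => ?_
        have hb' : (b : ℕ) < m := Finset.mem_range.mp b.2
        have h1 := hrad (E b)
        rw [form_sub_left, form_add_left, hB m hmn b (by omega), hS.1 _ hx₁' _ (hEm b (by omega)),
          form_sum_left, Finset.sum_eq_single b (fun a ha hab => by
            rw [hGE a (Finset.mem_range.mp a.2) b (by omega), if_neg (Subtype.coe_injective.ne hab),
              mul_zero])
            (fun hh => absurd hb hh), hGE b hb' b (by omega), if_pos rfl, zero_add, zero_sub,
          neg_eq_zero] at h1
        rw [(map_eq_zero W.conj).mp ((mul_eq_zero.mp h1).resolve_right W.sign_ne_zero), zero_smul]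
      rw [hx₂', add_zero] at hrad
      have h2 := W.eq_zero_of_form (hS.2 _ (sub_mem (hEm m hmn) hx₁')) hrad
      rw [sub_eq_zero] at h2
      exact linearIndepOn_iff_notMem_span.mp hE m hmn (h2 ▸ hx₁)
    -- normalize `y` and make it singular by adding a multiple of `E m`
    set y₁ := (W.form (E m) y)⁻¹ • y with hy₁
    have hEy₁ : ∀ a < n, W.form (E a) y₁ = if a = m then 1 else 0 := by
      intro a ha
      rw [hy₁, form_smul_right]
      split_ifs with ham
      · rw [ham, inv_mul_cancel₀ hy]
      · rw [hyE a ha ham, mul_zero]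
    have hGy₁ : ∀ b < m, W.form (G b) y₁ = 0 := fun b hb => by
      rw [hy₁, form_smul_right, hyG b hb, mul_zero]
    clear_value y₁
    obtain ⟨c, hqy⟩ := W.exists_quad_add_smul_eq_zero (y := y₁) (hq m hmn)
      (by rw [hEy₁ m hmn, if_pos rfl]; exact one_ne_zero)
    set y₂ := y₁ + c • E m with hy₂
    have hEy : ∀ a < n, W.form (E a) y₂ = if a = m then 1 else 0 := by
      intro a ha
      rw [hy₂, form_add_right, form_smul_right, hB a ha m hmn, mul_zero, add_zero, hEy₁ a ha]
    have hGy : ∀ b < m, W.form (G b) y₂ = 0 := by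
      intro b hb
      rw [hy₂, form_add_right, form_smul_right, hGE b hb m hmn, if_neg (by omega),
        hGy₁ b hb, mul_zero, add_zero]
    have h1 : ∀ a < m + 1, W.quad (Function.update G m y₂ a) = 0 := by
      intro a ha
      rcases Nat.lt_succ_iff_lt_or_eq.mp ha with ha | rfl
      · rw [Function.update_of_ne (by omega), hGq a ha]
      · rw [Function.update_self, hqy]
    have h2 : ∀ a < m + 1, ∀ b < m + 1,
        W.form (Function.update G m y₂ a) (Function.update G m y₂ b) = 0 := by
      intro a ha b hb
      rcases Nat.lt_succ_iff_lt_or_eq.mp ha with ha | rfl <;>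
        rcases Nat.lt_succ_iff_lt_or_eq.mp hb with hb | rfl
      · rw [Function.update_of_ne (by omega), Function.update_of_ne (by omega), hGB a ha b hb]
      · rw [Function.update_of_ne (by omega), Function.update_self, hGy a ha]
      · rw [Function.update_self, Function.update_of_ne (by omega), W.form_comm_zero (hGy b hb)]
      · rw [Function.update_self, W.form_self hqy]
    have h3 : ∀ a < n, ∀ b < m + 1,
        W.form (E a) (Function.update G m y₂ b) = if a = b then 1 else 0 := by
      intro a ha b hb
      rcases Nat.lt_succ_iff_lt_or_eq.mp hb with hb | rfl
      · rw [Function.update_of_ne (by omega), hEG a ha b hb]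
      · rw [Function.update_self, hEy a ha]
    obtain ⟨G', hG', hGG⟩ := ih hmn h1 h2 h3 (by omega)
    refine ⟨G', hG', fun b hb => ?_⟩
    rw [hGG b (by omega), Function.update_of_ne (by omega)]

end FormedSpace

namespace FormedSpace

open Module Submodule

variable {F V : Type*} [Field F] [AddCommGroup V] [Module F V] {W : FormedSpace F V}

/-! ### Geodesics with opposite ends -/

/-- The sequence `X 0, …, X (j + 1)` of vertices is a path with opposite ends meeting in a subspace
of dimension `k - j`; by the distance formula such a path is a geodesic. The values of `X` from
`j + 2` on are irrelevant. -/
structure IsOppositePath {k : ℕ} (j : ℕ) (X : ℕ → W.Singular k) : Prop where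
  adj : ∀ i ≤ j, (W.polarGrassmannGraph k).Adj (X i) (X (i + 1))
  opposite : W.Opposite (X 0) (X (j + 1))
  finrank_inf : finrank F ((X 0).1 ⊓ (X (j + 1)).1 : Submodule F V) + j = k

namespace IsOppositePath

variable {k j : ℕ} {X : ℕ → W.Singular k}

theorem one_inf_last_le (h : IsOppositePath j X) :
    (X 1).1 ⊓ (X (j + 1)).1 ≤ (X 0).1 ⊓ (X (j + 1)).1 :=
  fun _ hy => h.opposite.inf_perp_le ⟨hy.2, Adj.le_perp (h.adj 0 (by omega)) hy.1⟩

variable [FiniteDimensional F V]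

theorem pos (h : IsOppositePath j X) : 1 ≤ j := by
  have := finrank_inf_lt h.opposite.1
  have := h.finrank_inf
  omega

theorem reverse (h : IsOppositePath j X) : IsOppositePath j (fun i => X (j + 1 - i)) where
  adj i hi := by
    have := (h.adj (j - i) (by omega)).symm
    rwa [show j - i + 1 = j + 1 - i by omega, show j - i = j + 1 - (i + 1) by omega] at this
  opposite := by simpa using h.opposite.symm
  finrank_inf := by rw [Nat.sub_self, inf_comm]; exact h.finrank_inf

theorem le_finrank_inf_add (h : IsOppositePath j X) {i d : ℕ} (hd : i + d ≤ j + 1) :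
    k ≤ finrank F ((X i).1 ⊓ (X (i + d)).1 : Submodule F V) + d := by
  induction d generalizing i with
  | zero =>
    change k ≤ finrank F ((X i).1 ⊓ (X i).1 : Submodule F V) + 0
    rw [inf_idem, (X i).2.2, add_zero]
  | succ d ih =>
    have h1 := ih (i := i + 1) (by omega)
    have h2 := Adj.finrank_inf_le (Y := X (i + 1 + d)) (h.adj i (by omega))
    rw [show i + (d + 1) = i + 1 + d by omega]
    omega

/-- Along a path, the intersection of two members lies in all members between them if its
dimension is as small as possible. -/
theorem inf_le_of_finrank_le (h : IsOppositePath j X) {a i b : ℕ} (ha : a ≤ i) (hib : i ≤ b)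
    (hb : b ≤ j + 1)
    (hab : finrank F ((X a).1 ⊓ (X b).1 : Submodule F V) + (b - a) ≤ k) :
    (X a).1 ⊓ (X b).1 ≤ (X i).1 := by
  have h1 := h.le_finrank_inf_add (i := a) (d := i - a) (by omega)
  have h2 := h.le_finrank_inf_add (i := i) (d := b - i) (by omega)
  rw [show a + (i - a) = i by omega] at h1
  rw [show i + (b - i) = b by omega] at h2
  have h3 := finrank_add_finrank_le_of_le (A := (X a).1 ⊓ (X i).1) (B := (X i).1 ⊓ (X b).1)
    (C := (X i).1) inf_le_right inf_le_left
  rw [(X i).2.2] at h3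
  have h4 : ((X a).1 ⊓ (X i).1) ⊓ ((X i).1 ⊓ (X b).1) ≤ (X a).1 ⊓ (X b).1 :=
    inf_le_inf inf_le_left inf_le_right
  rw [← eq_of_le_of_finrank_le h4 (by omega)]
  exact inf_le_left.trans inf_le_right

theorem inf_le_one (h : IsOppositePath j X) : (X 0).1 ⊓ (X (j + 1)).1 ≤ (X 1).1 := by
  have h1 := h.le_finrank_inf_add (i := 1) (d := j) (by omega)
  have h2 := h.finrank_inf
  rw [add_comm 1 j] at h1
  rw [← eq_of_le_of_finrank_le h.one_inf_last_le (by omega)]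
  exact inf_le_left

theorem inf_le_prev (h : IsOppositePath j X) : (X 0).1 ⊓ (X (j + 1)).1 ≤ (X j).1 := by
  simpa [inf_comm] using h.reverse.inf_le_one

theorem zero_inf_prev_le (h : IsOppositePath j X) :
    (X 0).1 ⊓ (X j).1 ≤ (X 0).1 ⊓ (X (j + 1)).1 := by
  simpa [inf_comm] using h.reverse.one_inf_last_le

theorem one_inf_prev_le (h : IsOppositePath j X) {i : ℕ} (h1 : 1 ≤ i) (hi : i ≤ j) :
    (X 1).1 ⊓ (X j).1 ≤ (X i).1 := by
  refine h.inf_le_of_finrank_le h1 hi (by omega) ?_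
  have h2 := h.finrank_inf
  have h3 := finrank_add_finrank_le_of_le (A := (X 1).1 ⊓ (X j).1) (B := (X 0).1 ⊓ (X 1).1)
    (C := (X 1).1) inf_le_left inf_le_right
  rw [(X 1).2.2] at h3
  have h4 := Adj.finrank_inf (h.adj 0 (by omega))
  have h5 : ((X 1).1 ⊓ (X j).1) ⊓ ((X 0).1 ⊓ (X 1).1) ≤ (X 0).1 ⊓ (X (j + 1)).1 :=
    le_trans (le_inf (inf_le_right.trans inf_le_left) (inf_le_left.trans inf_le_right))
      h.zero_inf_prev_le
  have h6 := finrank_mono h5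
  rw [zero_add] at h4
  omega

theorem inf_le (h : IsOppositePath j X) {i : ℕ} (hi : i ≤ j + 1) :
    (X 0).1 ⊓ (X (j + 1)).1 ≤ (X i).1 := by
  rcases Nat.eq_zero_or_pos i with rfl | h0
  · exact inf_le_left
  · rcases Nat.lt_succ_iff_lt_or_eq.mp (Nat.lt_succ_of_le hi) with h1 | rfl
    · exact (le_inf h.inf_le_one h.inf_le_prev).trans (h.one_inf_prev_le h0 (by omega))
    · exact inf_le_right

/-- All inner members of the path contain a common vector orthogonal to both ends. -/
theorem exists_apex (h : IsOppositePath j X) :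
    ∃ z, z ∈ W.perp (X 0).1 ∧ z ∈ W.perp (X (j + 1)).1 ∧ z ∉ (X 0).1 ∧
    z ∉ (X (j + 1)).1 ∧ ∀ i, 1 ≤ i → i ≤ j → z ∈ (X i).1 := by
  have h0 := h.pos
  have h1 := h.le_finrank_inf_add (i := 1) (d := j - 1) (by omega)
  have h2 := h.finrank_inf
  rw [show 1 + (j - 1) = j by omega] at h1
  obtain ⟨z, hz, hzD⟩ := exists_mem_notMem_of_finrank_lt
    (A := (X 0).1 ⊓ (X (j + 1)).1) (B := (X 1).1 ⊓ (X j).1) (by omega)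
  have h3 := Adj.le_perp (h.adj 0 (by omega)) hz.1
  have h4 := Adj.le_perp (h.adj j le_rfl).symm hz.2
  exact ⟨z, h3, h4, fun hh => hzD (h.opposite.inf_perp_le' ⟨hh, h4⟩),
    fun hh => hzD (h.opposite.inf_perp_le ⟨hh, h3⟩), fun i h1 h2 => h.one_inf_prev_le h1 h2 hz⟩

theorem finrank_zero_inf_add (h : IsOppositePath j X) {i : ℕ} (hi : i ≤ j) :
    finrank F ((X 0).1 ⊓ (X i).1 : Submodule F V) + i = k := by
  have h8 := h.le_finrank_inf_add (i := 0) (d := i) (by omega)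
  rw [zero_add] at h8
  refine le_antisymm ?_ h8
  rcases Nat.eq_zero_or_pos i with rfl | h0
  · rw [inf_idem, (X 0).2.2, add_zero]
  · obtain ⟨z, hz0, hz1, hzX, -, hzi⟩ := h.exists_apex
    have h1 := finrank_sup_add_finrank_inf_eq ((X 0).1 ⊓ (X i).1) ((X i).1 ⊓ (X (j + 1)).1)
    have h2 : ((X 0).1 ⊓ (X i).1) ⊓ ((X i).1 ⊓ (X (j + 1)).1) ≤ (X 0).1 ⊓ (X (j + 1)).1 :=
      inf_le_inf inf_le_left inf_le_right
    have h3 := finrank_mono h2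
    have h4 := h.le_finrank_inf_add (i := i) (d := j + 1 - i) (by omega)
    rw [show i + (j + 1 - i) = j + 1 by omega] at h4
    have h5 := h.finrank_inf
    -- the apex is not in `X 0 + X (j + 1)`
    have hz : z ∉ (X 0).1 ⊓ (X i).1 ⊔ (X i).1 ⊓ (X (j + 1)).1 := by
      intro hz
      obtain ⟨x, hx, y, hy, rfl⟩ := mem_sup.mp hz
      have hy' : y ∈ W.perp (X 0).1 := by
        simpa using sub_mem hz0 ((X 0).2.1.le_perp hx.1)
      exact hzX (add_mem hx.1 (h.opposite.inf_perp_le ⟨hy.2, hy'⟩).1)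
    have h6 := finrank_sup_span_singleton hz
    have h7 := finrank_mono (sup_span_singleton_le
      (sup_le (inf_le_right (a := (X 0).1)) (inf_le_left (b := (X (j + 1)).1))) (hzi i h0 hi))
    rw [(X i).2.2] at h7
    omega

/-- A basis of `X 0 + ⟨z⟩` adapted to the flag cut out by the path: `E j` is the apex `z`, the
vectors `E a` with `a > j` form a basis of the intersection of the two ends, and for `a < j` the
vector `E a` lies in `X 0, …, X a` only. -/
theorem exists_left (h : IsOppositePath j X) : ∃ E : ℕ → V, LinearIndepOn F E (Set.Iio (k + 1)) ∧
    (∀ a < k + 1, W.quad (E a) = 0) ∧ (∀ a < k + 1, ∀ b < k + 1, W.form (E a) (E b) = 0) ∧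
    (∀ a < k + 1, a ≠ j → E a ∈ (X 0).1) ∧ (∀ i a, 1 ≤ i → i ≤ a → a ≤ j → E a ∈ (X i).1) ∧
    (∀ a, j < a → a < k + 1 → E a ∈ (X 0).1 ⊓ (X (j + 1)).1) ∧
    E j ∈ W.perp (X 0).1 ∧ E j ∈ W.perp (X (j + 1)).1 := by
  have hD := h.finrank_inf
  have hj := h.pos
  obtain ⟨z, hz0, hz1, hzX, hzY, hzi⟩ := h.exists_apex
  have he : ∀ a, ∃ e, a < j → e ∈ (X 0).1 ⊓ (X a).1 ∧ e ∉ (X 0).1 ⊓ (X (a + 1)).1 := by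
    intro a
    by_cases ha : a < j
    · have h1 := h.finrank_zero_inf_add (i := a) (by omega)
      have h2 := h.finrank_zero_inf_add (i := a + 1) (by omega)
      obtain ⟨e, he⟩ := exists_mem_notMem_of_finrank_lt
        (A := (X 0).1 ⊓ (X (a + 1)).1) (B := (X 0).1 ⊓ (X a).1) (by omega)
      exact ⟨e, fun _ => he⟩
    · exact ⟨0, fun hh => absurd hh ha⟩
  choose e he using he
  let d := finBasisOfFinrankEq F ((X 0).1 ⊓ (X (j + 1)).1 : Submodule F V)
    (show _ = k - j by omega)
  set E : ℕ → V := fun a => if a < j then e a else if a = j then z else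
    if ha : a - (j + 1) < k - j then (d ⟨a - (j + 1), ha⟩ : V) else 0 with hE
  have hE1 : ∀ a < j, E a = e a := fun a ha => by simp [hE, ha]
  have hE2 : E j = z := by simp [hE]
  have hE3 : ∀ a (h1 : j < a) (h2 : a < k + 1), E a = d ⟨a - (j + 1), by omega⟩ := by
    intro a h1 h2
    simp only [hE]
    rw [if_neg (by omega), if_neg (by omega), dif_pos]
  have hEX0 : ∀ a < k + 1, a ≠ j → E a ∈ (X 0).1 := by
    intro a ha haj
    rcases lt_or_gt_of_ne haj with hlt | hgt
    · rw [hE1 a hlt]; exact (he a hlt).1.1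
    · rw [hE3 a hgt ha]; exact (d _).2.1
  have hEXi : ∀ i a, 1 ≤ i → i ≤ a → a ≤ j → E a ∈ (X i).1 := by
    intro i a h1 hia ha
    rcases Nat.lt_or_eq_of_le ha with hlt | rfl
    · rw [hE1 a hlt]
      refine h.inf_le_of_finrank_le (a := 0) (b := a) (by omega) hia (by omega) ?_ (he a hlt).1
      have := h.finrank_zero_inf_add (i := a) (by omega)
      omega
    · rw [hE2]; exact hzi i h1 hia
  have hED : ∀ a, j < a → a < k + 1 → E a ∈ (X 0).1 ⊓ (X (j + 1)).1 := by
    intro a h1 h2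
    rw [hE3 a h1 h2]; exact (d _).2
  have hmem : ∀ a < k + 1, E a ∈ (X 0).1 ⊔ span F {z} := by
    intro a ha
    by_cases haj : a = j
    · rw [haj, hE2]; exact mem_sup_span_singleton_self _ _
    · exact mem_sup_left (hEX0 a ha haj)
  have hS := (X 0).2.1.sup_span_singleton ((X 1).2.1.2 z (hzi 1 le_rfl hj)) hz0
  refine ⟨E, ?_, fun a ha => hS.2 _ (hmem a ha), fun a ha b hb => hS.1 _ (hmem a ha) _ (hmem b hb),
    hEX0, hEXi, hED, hE2 ▸ hz0, hE2 ▸ hz1⟩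
  -- linear independence, by adding the vectors `E j, …, E 0` in turn to the basis of the
  -- intersection
  have key : ∀ i, i ≤ j + 1 → LinearIndepOn F E (Set.Ico (j + 1 - i) (k + 1)) := by
    intro i
    induction i with
    | zero =>
      intro _
      have h1 : LinearIndependent F (fun t : Fin (k - j) => (d t : V)) :=
        d.linearIndependent.map' (Submodule.subtype _) (Submodule.ker_subtype _)
      have h2 : LinearIndependent F (fun a : Set.Ico (j + 1) (k + 1) => E a) := by
        let f : Set.Ico (j + 1) (k + 1) → Fin (k - j) :=
          fun a => ⟨a - (j + 1), by have := a.2.1; have := a.2.2; omega⟩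
        have hf : Function.Injective f := by
          rintro ⟨a, ha⟩ ⟨b, hb⟩ hab
          have := Fin.mk.inj_iff.mp hab
          have := ha.1; have := hb.1
          ext; simp only at *; omega
        convert h1.comp f hf using 1
        ext a
        exact hE3 a a.2.1 a.2.2
      exact h2
    | succ i ih =>
      intro hi
      have h1 := ih (by omega)
      set a := j + 1 - (i + 1) with ha
      rw [show j + 1 - i = a + 1 by omega] at h1
      have hins : Set.Ico a (k + 1) = insert a (Set.Ico (a + 1) (k + 1)) := by
        ext x; simp only [Set.mem_Ico, Set.mem_insert_iff]; omega
      rw [hins]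
      refine h1.insert fun hmem => ?_
      have hle : span F (E '' Set.Ico (a + 1) (k + 1)) ≤ (X (a + 1)).1 := by
        rw [span_le]
        rintro _ ⟨b, ⟨hb1, hb2⟩, rfl⟩
        rcases Nat.lt_or_ge j b with hjb | hjb
        · exact h.inf_le (by omega) (hED b hjb hb2)
        · exact hEXi (a + 1) b (by omega) hb1 hjb
      have h2 := hle hmem
      rcases Nat.lt_or_ge a j with haj | haj
      · rw [hE1 a haj] at h2
        exact (he a haj).2 ⟨(he a haj).1.1, h2⟩
      · rw [show a = j by omega, hE2] at h2
        exact hzY h2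
  have := key (j + 1) le_rfl
  rwa [Nat.sub_self, ← Nat.bot_eq_zero, Set.Ico_bot] at this

end IsOppositePath

/-- The `i`-th vertex of the standard path belonging to a frame of length `k + 1`. With
`o = j` if `i = 0` and `o = i - 1` otherwise, it is spanned by the vectors `G c` with `c < i` and
`E c` with `i ≤ c ≤ k`, except for the index `c = o`. -/
def framePath (k j : ℕ) (E G : ℕ → V) (i : ℕ) : Submodule F V :=
  span F ((fun c => if c < i then G c else E c) ''
    ((Finset.range (k + 1)).erase (if i = 0 then j else i - 1) : Finset ℕ))

variable [FiniteDimensional F V]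

/-- Every geodesic with opposite ends is the standard path of some hyperbolic frame. -/
theorem IsOppositePath.exists_isFrame {k j : ℕ} {X : ℕ → W.Singular k} (h : IsOppositePath j X) :
    ∃ E G, W.IsFrame (k + 1) E G ∧ ∀ i ≤ j + 1, (X i).1 = framePath k j E G i := by
  classical
  have hD := h.finrank_inf
  have hj := h.pos
  obtain ⟨E, hli, hq, hB, hEX0, hEXi, hED, hz0, hz1⟩ := h.exists_left
  have hcard : ∀ s : Finset ℕ, (∀ a ∈ s, a < k + 1) →
      finrank F (span F (E '' (s : Set ℕ))) = s.card := fun s hs =>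
    finrank_span_image_of_linearIndepOn (hli.mono fun a ha => hs a ha)
  -- the dual vectors in `X (j + 1)`
  have hG : ∀ b, ∃ g, b < j → g ∈ (X (j + 1)).1 ∧
      ∀ a < k + 1, W.form (E a) g = if a = b then 1 else 0 := by
    intro b
    by_cases hb : b < j
    swap
    · exact ⟨0, fun hh => absurd hh hb⟩
    set K := span F (E '' (((Finset.range (k + 1)).erase j).erase b : Finset ℕ)) with hK
    have hDK : (X 0).1 ⊓ (X (j + 1)).1 ≤ K := by
      have h1 : span F (E '' (Finset.Ioo j (k + 1) : Finset ℕ)) ≤ (X 0).1 ⊓ (X (j + 1)).1 := by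
        rw [span_le]
        rintro _ ⟨a, ha, rfl⟩
        rw [Finset.mem_coe, Finset.mem_Ioo] at ha
        exact hED a ha.1 ha.2
      rw [← eq_of_le_of_finrank_le h1 (by
        rw [hcard _ (fun a ha => (Finset.mem_Ioo.mp ha).2), Nat.card_Ioo]; omega)]
      refine span_mono (Set.image_mono fun a ha => ?_)
      simp only [Finset.coe_Ioo, Set.mem_Ioo, Finset.coe_erase, Finset.coe_range, Set.mem_sdiff,
        Set.mem_Iio, Set.mem_singleton_iff] at ha ⊢
      omega
    have hKX : K ≤ (X 0).1 := by
      rw [hK, span_le]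
      rintro _ ⟨a, ha, rfl⟩
      simp only [Finset.mem_coe, Finset.mem_erase, Finset.mem_range] at ha
      exact hEX0 a ha.2.2 ha.2.1
    have hKd : finrank F K + 1 = k := by
      rw [hK, hcard _ (fun a ha => by
        simp only [Finset.mem_erase, Finset.mem_range] at ha; exact ha.2.2),
        Finset.card_erase_of_mem (by simp; omega), Finset.card_erase_of_mem (by simp; omega),
        Finset.card_range]
      omega
    have h1 := finrank_add_le_of_le_perp (W := W) (Y := (X (j + 1)).1) hDK
      (le_perp_comm.mp (inf_le_right.trans (X (j + 1)).2.1.le_perp))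
    rw [(X (j + 1)).2.2] at h1
    obtain ⟨y, ⟨hyY, hyK⟩, hyD⟩ := exists_mem_notMem_of_finrank_lt
      (A := (X 0).1 ⊓ (X (j + 1)).1) (B := (X (j + 1)).1 ⊓ W.perp K) (by omega)
    have hKb : K ⊔ span F {E b} = (X 0).1 := by
      refine eq_of_le_of_finrank_le
        (sup_span_singleton_le hKX (hEX0 b (by omega) (by omega))) ?_
      rw [finrank_sup_span_singleton, hKd, (X 0).2.2]
      rw [hK]
      intro hmem
      refine linearIndepOn_iff_notMem_span.mp hli b (show b < k + 1 by omega)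
        (span_mono (Set.image_mono fun a ha => ?_) hmem)
      simp only [Finset.coe_erase, Finset.coe_range, Set.mem_sdiff,
        Set.mem_Iio, Set.mem_singleton_iff] at ha ⊢
      omega
    have hyb : W.form (E b) y ≠ 0 := by
      intro h0
      refine hyD (h.opposite.inf_perp_le ⟨hyY, ?_⟩)
      rw [← hKb]
      exact mem_perp_sup.mpr ⟨hyK, mem_perp_span_singleton.mpr h0⟩
    refine ⟨(W.form (E b) y)⁻¹ • y, fun _ => ⟨smul_mem _ _ hyY, fun a ha => ?_⟩⟩
    rw [form_smul_right]
    split_ifs with hab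
    · rw [hab, inv_mul_cancel₀ hyb]
    · by_cases haj : a = j
      · rw [haj, W.form_comm_zero (hz1 y hyY), mul_zero]
      · rw [hyK (E a) (subset_span ⟨a, by simp; omega, rfl⟩), mul_zero]
  choose G₀ hG₀ using hG
  obtain ⟨G, hF, hG⟩ := FormedSpace.exists_isFrame (m := j) (n := k + 1) (by omega) hli hq hB
    (fun b hb => (X (j + 1)).2.1.2 _ (hG₀ b hb).1)
    (fun a ha b hb => (X (j + 1)).2.1.1 _ (hG₀ a ha).1 _ (hG₀ b hb).1)
    (fun a ha b hb => (hG₀ b hb).2 a ha)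
  refine ⟨E, G, hF, fun i hi => ?_⟩
  have hGX : ∀ b, b + 1 < i → G b ∈ (X i).1 := by
    intro b hb
    have h1 := finrank_inf_perp_le (W := W) (X (j + 1)).1
      (inf_le_left : (X 0).1 ⊓ (X (i - 1)).1 ≤ (X 0).1)
    rw [(X 0).2.2] at h1
    have h2 := finrank_mono h.opposite.inf_perp_le
    have h3 := h.finrank_zero_inf_add (i := i - 1) (by omega)
    have h4 := h.le_finrank_inf_add (i := i) (d := j + 1 - i) (by omega)
    rw [show i + (j + 1 - i) = j + 1 by omega] at h4
    have h5 : (X i).1 ⊓ (X (j + 1)).1 ≤ (X (j + 1)).1 ⊓ W.perp ((X 0).1 ⊓ (X (i - 1)).1) := by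
      refine le_inf inf_le_right (inf_le_left.trans ?_)
      have := h.adj (i - 1) (by omega)
      rw [show i - 1 + 1 = i by omega] at this
      exact (Adj.le_perp this).trans (perp_anti inf_le_right)
    have hspan : span F (E '' ((Finset.Ico (i - 1) (k + 1)).erase j : Finset ℕ)) =
        (X 0).1 ⊓ (X (i - 1)).1 := by
      refine eq_of_le_of_finrank_le ?_ ?_
      · rw [span_le]
        rintro _ ⟨a, ha, rfl⟩
        simp only [Finset.mem_coe, Finset.mem_erase, Finset.mem_Ico] at ha
        refine ⟨hEX0 a ha.2.2 ha.1, ?_⟩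
        rcases Nat.lt_or_ge j a with hja | hja
        · exact h.inf_le (by omega) (hED a hja ha.2.2)
        · exact hEXi (i - 1) a (by omega) ha.2.1 hja
      · rw [hcard _ (fun a ha => by
          simp only [Finset.mem_erase, Finset.mem_Ico] at ha; exact ha.2.2),
          Finset.card_erase_of_mem (by simp; omega), Nat.card_Ico]
        omega
    have h6 : G b ∈ (X (j + 1)).1 ⊓ W.perp ((X 0).1 ⊓ (X (i - 1)).1) := by
      refine ⟨by rw [hG b (by omega)]; exact (hG₀ b (by omega)).1,
        (?_ : G b ∈ W.perp ((X 0).1 ⊓ (X (i - 1)).1))⟩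
      rw [← hspan, ← span_singleton_le_perp, le_perp_comm, span_le]
      rintro _ ⟨a, ha, rfl⟩
      simp only [Finset.mem_coe, Finset.mem_erase, Finset.mem_Ico] at ha
      refine mem_perp_span_singleton.mpr (W.form_comm_zero ?_)
      rw [hF.left_right a (by omega) b (by omega), if_neg (by omega)]
    rw [← eq_of_le_of_finrank_le h5 (by omega)] at h6
    exact h6.1
  symm
  refine eq_of_le_of_finrank_eq ?_ ?_
  · rw [framePath, span_le]
    rintro _ ⟨c, hc, rfl⟩
    simp only [Finset.mem_coe, Finset.mem_erase, Finset.mem_range] at hc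
    change (if c < i then G c else E c) ∈ (X i).1
    rcases Nat.eq_zero_or_pos i with rfl | hi0
    · rw [if_neg (by omega)]; exact hEX0 c hc.2 (by simpa using hc.1)
    rw [if_neg (by omega)] at hc
    split_ifs with hci
    · exact hGX c (by omega)
    · rcases Nat.lt_or_ge j c with hjc | hjc
      · exact h.inf_le hi (hED c hjc hc.2)
      · exact hEXi i c (by omega) (by omega) hjc
  · rw [framePath, finrank_span_image_of_linearIndepOn ((hF.linearIndepOn i).mono (by simp)),
      Finset.card_erase_of_mem (by simp; split_ifs <;> omega), Finset.card_range, (X i).2.2]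
    omega

end FormedSpace

namespace FormedSpace

open Module Submodule

variable {F V : Type*} [Field F] [AddCommGroup V] [Module F V] {W : FormedSpace F V}

/-! ### The action of the semisimilarity group -/

theorem isometryGroup_le (W : FormedSpace F V) : W.isometryGroup ≤ W.semisimilarityGroup :=
  fun _ hg => ⟨RingEquiv.refl F, 1, one_ne_zero, hg⟩

section

variable [FiniteDimensional F V] {k : ℕ} {X Y : W.Singular k}

/-- Adjacency in terms of containment only, which every semisimilarity preserves. -/
theorem adj_iff : (W.polarGrassmannGraph k).Adj X Y ↔
    X ≠ Y ∧ ∃ S : W.Singular (k + 1), X.1 ≤ S.1 ∧ Y.1 ≤ S.1 :=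
  ⟨fun h => ⟨h.ne, ⟨_, h⟩, le_sup_left, le_sup_right⟩,
    fun ⟨hXY, S, hX, hY⟩ => adj_of_le S.2.1 S.2.2 hX hY hXY⟩

theorem exists_image [Finite F] {g : Equiv.Perm V} (hg : g ∈ W.semisimilarityGroup)
    (X : W.Singular k) : ∃ Y : W.Singular k, (Y.1 : Set V) = g '' (X.1 : Set V) := by
  obtain ⟨τ, c, hc, h1, h2, h3, h4⟩ := hg
  let U : Submodule F V :=
    { carrier := g '' (X.1 : Set V)
      add_mem' := by
        rintro _ _ ⟨x, hx, rfl⟩ ⟨y, hy, rfl⟩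
        exact ⟨x + y, add_mem hx hy, h1 x y⟩
      zero_mem' := ⟨0, X.1.zero_mem, by simpa using h2 0 0⟩
      smul_mem' := by
        rintro a _ ⟨x, hx, rfl⟩
        exact ⟨τ.symm a • x, smul_mem _ _ hx, by rw [h2, RingEquiv.apply_symm_apply]⟩ }
  refine ⟨⟨U, ⟨?_, ?_⟩, ?_⟩, rfl⟩
  · rintro _ ⟨x, hx, rfl⟩ _ ⟨y, hy, rfl⟩
    rw [h3, X.2.1.1 x hx y hy, map_zero, mul_zero]
  · rintro _ ⟨x, hx, rfl⟩
    rw [h4, X.2.1.2 x hx, map_zero, mul_zero]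
  · have e : X.1 ≃ U := g.image (X.1 : Set V)
    have hcard := Nat.card_congr e
    rw [natCard_eq_pow_finrank (K := F) (V := X.1), natCard_eq_pow_finrank (K := F) (V := U)]
      at hcard
    rw [← X.2.2]
    exact (Nat.pow_right_injective Finite.one_lt_card hcard).symm

theorem exists_iso [Finite F] {g : Equiv.Perm V} (hg : g ∈ W.semisimilarityGroup) (k : ℕ) :
    ∃ φ : W.polarGrassmannGraph k ≃g W.polarGrassmannGraph k,
      ∀ X, ((φ X).1 : Set V) = g '' (X.1 : Set V) := by
  choose f hf using fun X : W.Singular k => exists_image hg X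
  choose f' hf' using fun X : W.Singular k => exists_image (inv_mem hg) X
  have himg : ∀ s : Set V, (g⁻¹ : Equiv.Perm V) '' (g '' s) = s := g.symm_image_image
  have himg' : ∀ s : Set V, g '' ((g⁻¹ : Equiv.Perm V) '' s) = s := g.image_symm_image
  have hadj : ∀ g' ∈ W.semisimilarityGroup, ∀ X Y X' Y' : W.Singular k,
      (X'.1 : Set V) = g' '' (X.1 : Set V) → (Y'.1 : Set V) = g' '' (Y.1 : Set V) →
      (W.polarGrassmannGraph k).Adj X Y → (W.polarGrassmannGraph k).Adj X' Y' := by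
    intro g' hg' X Y X' Y' hX hY h
    obtain ⟨hXY, S, hXS, hYS⟩ := adj_iff.mp h
    obtain ⟨S', hS'⟩ := exists_image hg' S
    refine adj_iff.mpr ⟨?_, S', ?_, ?_⟩
    · rintro rfl
      exact hXY (Subtype.ext (SetLike.coe_injective (g'.injective.image_injective (hX ▸ hY))))
    · rw [← SetLike.coe_subset_coe, hX, hS']; exact Set.image_mono hXS
    · rw [← SetLike.coe_subset_coe, hY, hS']; exact Set.image_mono hYS
  let e : W.Singular k ≃ W.Singular k :=
    { toFun := f
      invFun := f'
      left_inv := fun X => Subtype.ext (SetLike.coe_injective (by rw [hf', hf, himg]))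
      right_inv := fun X => Subtype.ext (SetLike.coe_injective (by rw [hf, hf', himg'])) }
  refine ⟨⟨e, fun {X Y} => ⟨fun h => ?_, fun h => ?_⟩⟩, hf⟩
  · exact hadj _ (inv_mem hg) _ _ X Y (by change _ = _ '' ((f X).1 : Set V); rw [hf, himg])
      (by change _ = _ '' ((f Y).1 : Set V); rw [hf, himg]) h
  · exact hadj _ hg X Y _ _ (hf X) (hf Y) h

end

theorem Opposite.of_image {k : ℕ} {X Y X' Y' : W.Singular k} {g : Equiv.Perm V}
    (hg : g ∈ W.semisimilarityGroup) (hX : (X'.1 : Set V) = g '' (X.1 : Set V))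
    (hY : (Y'.1 : Set V) = g '' (Y.1 : Set V)) (h : W.Opposite X Y) : W.Opposite X' Y' := by
  obtain ⟨τ, c, hc, h1, h2, h3, h4⟩ := hg
  refine ⟨?_, fun y hy hyX => ?_⟩
  · rintro rfl
    exact h.1 (Subtype.ext (SetLike.coe_injective (g.injective.image_injective (hX ▸ hY))))
  · rw [← SetLike.mem_coe, hY] at hy
    obtain ⟨y, hy, rfl⟩ := hy
    obtain ⟨x, hx, hxY, hxy⟩ := h.2 y hy (fun hh => hyX (by
      rw [← SetLike.mem_coe, hX]; exact ⟨y, hh, rfl⟩))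
    refine ⟨g x, ?_, ?_, ?_⟩
    · rw [← SetLike.mem_coe, hX]; exact ⟨x, hx, rfl⟩
    · rw [← SetLike.mem_coe, hY, g.injective.mem_set_image]; exact hxY
    · rw [h3]; exact mul_ne_zero hc (by simpa using hxy)

end FormedSpace

/-! ### Distances under graph isomorphisms -/

theorem SimpleGraph.Reachable.dist_map_le {A B : Type*} {Γ : SimpleGraph A} {Δ : SimpleGraph B}
    {x y : A} (h : Γ.Reachable x y) (f : Γ →g Δ) : Δ.dist (f x) (f y) ≤ Γ.dist x y := by
  obtain ⟨w, hw⟩ := h.exists_walk_length_eq_dist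
  rw [← hw, ← w.length_map f]
  exact SimpleGraph.dist_le _

theorem SimpleGraph.Iso.dist_eq {A B : Type*} {Γ : SimpleGraph A} {Δ : SimpleGraph B}
    (φ : Γ ≃g Δ) (x y : A) : Δ.dist (φ x) (φ y) = Γ.dist x y := by
  by_cases h : Γ.Reachable x y
  · refine le_antisymm (h.dist_map_le φ.toHom) ?_
    simpa using (h.map φ.toHom).dist_map_le φ.symm.toHom
  · rw [SimpleGraph.dist_eq_zero_of_not_reachable h, SimpleGraph.dist_eq_zero_of_not_reachable]
    intro h'
    exact h (by simpa using h'.map φ.symm.toHom)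

namespace FormedSpace

open Module Submodule

variable {F V : Type*} [Field F] [AddCommGroup V] [Module F V] {W : FormedSpace F V} {k : ℕ}

/-! ### Transitivity on the geodesics with opposite ends -/

theorem mem_oppositeGeodesics_of_iso {l : ℕ} {p : Fin (l + 1) → W.Singular k}
    (hp : p ∈ W.oppositeGeodesics k l)
    (φ : W.polarGrassmannGraph k ≃g W.polarGrassmannGraph k)
    (hφ : W.Opposite (φ (p 0)) (φ (p (Fin.last l)))) :
    (fun i => φ (p i)) ∈ W.oppositeGeodesics k l :=
  ⟨⟨fun i => φ.map_adj_iff.mpr (hp.1.1 i), by rw [φ.dist_eq]; exact hp.1.2⟩, hφ⟩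

variable [FiniteDimensional F V]

theorem mem_oppositeGeodesics_of_movedBy [Finite F] {l : ℕ} {p p' : Fin (l + 1) → W.Singular k}
    (hp : p ∈ W.oppositeGeodesics k l) (h : MovedBy W.semisimilarityGroup p p') :
    p' ∈ W.oppositeGeodesics k l := by
  obtain ⟨g, hg, hgp⟩ := h
  obtain ⟨φ, hφ⟩ := exists_iso hg k
  have hp' : p' = fun i => φ (p i) := by
    ext i : 1
    exact Subtype.ext (SetLike.coe_injective (by rw [hgp, hφ]))
  rw [hp']
  exact mem_oppositeGeodesics_of_iso hp φ (hp.2.of_image hg (hφ _) (hφ _))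

theorem isOppositePath_of_mem (hk : k < W.wittIndex) {j : ℕ}
    {p : Fin (j + 1 + 1) → W.Singular k} (hp : p ∈ W.oppositeGeodesics k (j + 1)) :
    IsOppositePath j (fun i => p (Fin.ofNat (j + 1 + 1) i)) where
  adj i hi := by
    have := hp.1.1 ⟨i, by omega⟩
    convert this using 2
    · ext; simp; omega
    · ext; simp; omega
  opposite := by
    rw [show Fin.ofNat (j + 1 + 1) (j + 1) = Fin.last (j + 1) by ext; simp]
    exact hp.2
  finrank_inf := by
    have h1 := (hp.2.dist_add hk).2
    rw [hp.1.2] at h1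
    change finrank F ((p (Fin.ofNat _ 0)).1 ⊓ (p (Fin.ofNat _ (j + 1))).1 : Submodule F V) + j = k
    rw [show Fin.ofNat (j + 1 + 1) (j + 1) = Fin.last (j + 1) by ext; simp,
      show Fin.ofNat (j + 1 + 1) 0 = 0 from rfl]
    omega

/-- The geodesics with opposite ends are the paths `framePath` of hyperbolic frames, and the
isometry group is transitive on these frames. -/
theorem movedBy_isometryGroup (hk : k < W.wittIndex) {j : ℕ}
    {p p' : Fin (j + 1 + 1) → W.Singular k} (hp : p ∈ W.oppositeGeodesics k (j + 1))
    (hp' : p' ∈ W.oppositeGeodesics k (j + 1)) : MovedBy W.isometryGroup p p' := by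
  obtain ⟨E, G, hF, hpE⟩ := (isOppositePath_of_mem hk hp).exists_isFrame
  obtain ⟨E', G', hF', hpE'⟩ := (isOppositePath_of_mem hk hp').exists_isFrame
  obtain ⟨g, hg, hgE⟩ := hF.exists_isometry hF'
  refine ⟨g, hg, fun i => ?_⟩
  let f : V →ₗ[F] V := { toFun := g, map_add' := hg.1, map_smul' := hg.2.1 }
  have h1 := hpE i (by omega)
  have h2 := hpE' i (by omega)
  have hi : Fin.ofNat (j + 1 + 1) (i : ℕ) = i := by ext; simp
  simp only [hi] at h1 h2
  have h3 : (p' i).1 = (p i).1.map f := by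
    rw [h1, h2, framePath, framePath, map_span, ← Set.image_comp]
    congr 1
    refine Set.image_congr fun c hc => ?_
    simp only [Finset.mem_coe, Finset.mem_erase, Finset.mem_range] at hc
    simp only [Function.comp_apply]
    split_ifs
    · exact (hgE c hc.2).2.symm
    · exact (hgE c hc.2).1.symm
  rw [h3]
  exact map_coe f _

theorem exists_isFrame_of_le {n : ℕ} (hn : n ≤ W.wittIndex) : ∃ E G, W.IsFrame n E G := by
  obtain ⟨M, hM, hMd⟩ := W.exists_finrank_eq_wittIndex
  let b := finBasisOfFinrankEq F M hMd
  set E : ℕ → V := fun a => if ha : a < W.wittIndex then (b ⟨a, ha⟩ : V) else 0 with hE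
  have hEM : ∀ a, E a ∈ M := by
    intro a
    simp only [hE]
    split_ifs
    · exact (b _).2
    · exact M.zero_mem
  have hli : LinearIndepOn F E (Set.Iio n) := by
    have h1 : LinearIndependent F (fun t : Fin W.wittIndex => (b t : V)) :=
      b.linearIndependent.map' (Submodule.subtype _) (Submodule.ker_subtype _)
    let f : Set.Iio n → Fin W.wittIndex := fun a => ⟨a, lt_of_lt_of_le a.2 hn⟩
    have hf : Function.Injective f := fun a a' haa => Subtype.ext (Fin.mk.inj_iff.mp haa)
    have h2 : LinearIndependent F (fun a : Set.Iio n => E a) := by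
      convert h1.comp f hf using 1
      ext a
      simp only [hE, Function.comp_apply]
      rw [dif_pos (lt_of_lt_of_le a.2 hn)]
    exact h2
  obtain ⟨G, hG, -⟩ := exists_isFrame (m := 0) (G := 0) (Nat.zero_le n) hli
    (fun a _ => hM.2 _ (hEM a)) (fun a _ b _ => hM.1 _ (hEM a) _ (hEM b))
    (fun a ha => absurd ha (Nat.not_lt_zero a)) (fun a ha => absurd ha (Nat.not_lt_zero a))
    (fun a _ b hb => absurd hb (Nat.not_lt_zero b))
  exact ⟨E, G, hG⟩

/-- Opposite vertices meeting in a subspace of dimension `k - j`: in a hyperbolic frame with left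
vectors `E` and right vectors `G`, replace the first `j` vectors of `E` by those of `G`. -/
theorem exists_opposite (hk : k ≤ W.wittIndex) {j : ℕ} (hj : 1 ≤ j) (hjk : j ≤ k) :
    ∃ X Y : W.Singular k, W.Opposite X Y ∧ finrank F (X.1 ⊓ Y.1 : Submodule F V) + j = k := by
  obtain ⟨E, G, hF⟩ := exists_isFrame_of_le hk
  have hX : W.IsSingular (span F (E '' (Finset.range k : Finset ℕ))) := isSingular_span_image
    (fun a ha => hF.quad_left a (by simpa using ha))
    (fun a ha b hb => hF.left_left a (by simpa using ha) b (by simpa using hb))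
  have hY : W.IsSingular (span F ((fun c => if c < j then G c else E c) ''
      (Finset.range k : Finset ℕ))) := by
    refine isSingular_span_image (fun a ha => ?_) (fun a ha b hb => ?_)
    · have ha : a < k := by simpa using ha
      change W.quad (if a < j then G a else E a) = 0
      split_ifs
      · exact hF.quad_right a ha
      · exact hF.quad_left a ha
    · have ha : a < k := by simpa using ha
      have hb : b < k := by simpa using hb
      change W.form (if a < j then G a else E a) (if b < j then G b else E b) = 0
      split_ifs
      · exact hF.right_right a ha b hb
      · rw [hF.right_left ha hb, if_neg (by omega)]
      · rw [hF.left_right a ha b hb, if_neg (by omega)]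
      · exact hF.left_left a ha b hb
  have hEli : LinearIndepOn F E (Finset.range k : Finset ℕ) := by simpa using hF.linearIndepOn 0
  let X : W.Singular k := ⟨_, hX, by
    rw [finrank_span_image_of_linearIndepOn hEli, Finset.card_range]⟩
  let Y : W.Singular k := ⟨_, hY, by
    rw [finrank_span_image_of_linearIndepOn (hF.linearIndepOn j), Finset.card_range]⟩
  have hEX : ∀ a < k, E a ∈ X.1 := fun a ha => subset_span ⟨a, by simpa using ha, rfl⟩
  have hKY : span F (E '' (Finset.Ico j k : Finset ℕ)) ≤ X.1 ⊓ Y.1 := by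
    rw [span_le]
    rintro _ ⟨a, ha, rfl⟩
    rw [Finset.mem_coe, Finset.mem_Ico] at ha
    exact ⟨hEX a ha.2, subset_span ⟨a, by simpa using ha.2, if_neg (by omega)⟩⟩
  have hYK : Y.1 ⊓ W.perp X.1 ≤ span F (E '' (Finset.Ico j k : Finset ℕ)) := by
    rintro y ⟨hy, hyX⟩
    obtain ⟨c, rfl⟩ := (mem_span_image_finset_iff_exists_fun F).mp hy
    refine sum_mem fun a _ => ?_
    have ha : (a : ℕ) < k := Finset.mem_range.mp a.2
    by_cases haj : (a : ℕ) < j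
    · have h1 := hyX (E a) (hEX a ha)
      rw [← formLin_apply, map_sum, Finset.sum_eq_single a] at h1
      · rw [map_smul, formLin_apply, if_pos haj, hF.left_right a ha a ha, if_pos rfl, smul_eq_mul,
          mul_one] at h1
        rw [h1, zero_smul]; exact zero_mem _
      · intro b _ hba
        have hb : (b : ℕ) < k := Finset.mem_range.mp b.2
        rw [map_smul, formLin_apply]
        split_ifs
        · rw [hF.left_right a ha b hb, if_neg (Subtype.coe_injective.ne hba.symm), smul_zero]
        · rw [hF.left_left a ha b hb, smul_zero]
      · intro hh; exact absurd (Finset.mem_univ _) hh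
    · rw [if_neg haj]
      exact smul_mem _ _ (subset_span ⟨a, by simp; omega, rfl⟩)
  have hop : W.Opposite X Y := by
    refine opposite_iff.mpr ⟨fun hXY => ?_, hYK.trans (hKY.trans inf_le_left)⟩
    have h1 : G 0 ∈ X.1 := by
      rw [hXY]; exact subset_span ⟨0, by simp; omega, if_pos (by omega)⟩
    have h2 := hX.1 _ (hEX 0 (by omega)) _ h1
    rw [hF.left_right 0 (by omega) 0 (by omega)] at h2
    simp at h2
  refine ⟨X, Y, hop, ?_⟩
  have h1 : X.1 ⊓ Y.1 = span F (E '' (Finset.Ico j k : Finset ℕ)) :=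
    le_antisymm (le_trans (le_inf inf_le_right (inf_le_left.trans X.2.1.le_perp)) hYK) hKY
  rw [h1, finrank_span_image_of_linearIndepOn (hEli.mono fun a ha => by
    simp only [Finset.coe_Ico, Set.mem_Ico, Finset.coe_range, Set.mem_Iio] at ha ⊢; omega),
    Nat.card_Ico]
  omega

theorem oppositeGeodesics_nonempty (hk : k < W.wittIndex) {j : ℕ} (hj : 1 ≤ j) (hjk : j ≤ k) :
    (W.oppositeGeodesics k (j + 1)).Nonempty := by
  obtain ⟨X, Y, hop, hD⟩ := exists_opposite hk.le hj hjk
  obtain ⟨hr, hdist⟩ := hop.dist_add hk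
  obtain ⟨w, hw⟩ := hr.exists_walk_length_eq_dist
  have hwl : w.length = j + 1 := by omega
  refine ⟨fun i => w.getVert i, ⟨fun i => w.adj_getVert_succ (by have := i.2; simp; omega), ?_⟩, ?_⟩
  · simp only [Fin.val_zero, Fin.val_last, w.getVert_zero]
    rw [← hwl, w.getVert_length, hw]
  · simp only [Fin.val_zero, Fin.val_last, w.getVert_zero]
    rw [← hwl, w.getVert_length]; exact hop

end FormedSpace

/-! ### Subsets of a graph determined by two or three vertices -/

/-- The neighbours of `x` on geodesics from `x` to `y`. -/
def SimpleGraph.towards {A : Type*} (Γ : SimpleGraph A) (x y : A) : Set A :=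
  {z | Γ.Adj x z ∧ Γ.dist z y + 1 = Γ.dist x y}

theorem SimpleGraph.Iso.mem_towards_iff {A B : Type*} {Γ : SimpleGraph A} {Δ : SimpleGraph B}
    (φ : Γ ≃g Δ) {x y z : A} : φ z ∈ Δ.towards (φ x) (φ y) ↔ z ∈ Γ.towards x y := by
  simp only [SimpleGraph.towards, Set.mem_ofPred_eq, φ.map_adj_iff, φ.dist_eq]

/-- The vertices equal or adjacent to each of `x`, `y`, `z`. -/
def SimpleGraph.triangleHull {A : Type*} (Γ : SimpleGraph A) (x y z : A) : Set A :=
  {t | (t = x ∨ Γ.Adj t x) ∧ (t = y ∨ Γ.Adj t y) ∧ (t = z ∨ Γ.Adj t z)}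

theorem SimpleGraph.Iso.ncard_triangleHull {A B : Type*} {Γ : SimpleGraph A}
    {Δ : SimpleGraph B} (φ : Γ ≃g Δ) (x y z : A) :
    (Δ.triangleHull (φ x) (φ y) (φ z)).ncard = (Γ.triangleHull x y z).ncard := by
  rw [← Set.ncard_image_of_injective _ φ.injective]
  congr 1
  ext t
  obtain ⟨t, rfl⟩ := φ.surjective t
  simp [SimpleGraph.triangleHull, φ.map_adj_iff]

namespace FormedSpace

open Module Submodule

variable {F V : Type*} [Field F] [AddCommGroup V] [Module F V] {W : FormedSpace F V}
  [FiniteDimensional F V] {k : ℕ} {X Y Z Z₁ Z₂ : W.Singular k}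

/-! ### The first layer between two nonopposite vertices -/

/-- On a geodesic between nonopposite vertices `X` and `Y`, the vertex `Z` next to `X` is spanned
by a hyperplane of `X` and a subspace of `Y ∩ Xᗮ`, both containing `X ∩ Y`. -/
theorem towards_of_not_opposite (hk : k < W.wittIndex) (hXY : X ≠ Y) (hop : ¬ W.Opposite X Y)
    (hZ : Z ∈ (W.polarGrassmannGraph k).towards X Y) :
    finrank F (Z.1 ⊓ Y.1 : Submodule F V) = finrank F (X.1 ⊓ Y.1 : Submodule F V) + 1 ∧
    X.1 ⊓ Y.1 ≤ Z.1 ∧ (X.1 ⊓ Z.1) ⊔ (Z.1 ⊓ Y.1) = Z.1 ∧ (Z = Y ∨ ¬ W.Opposite Z Y) := by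
  obtain ⟨hadj, hdist⟩ := hZ
  obtain ⟨hr, hd⟩ := dist_add_of_not_opposite hXY hop
  have hr' : (W.polarGrassmannGraph k).Reachable Z Y := hadj.symm.reachable.trans hr
  obtain ⟨w, hw⟩ := hr'.exists_walk_length_eq_dist
  have h1 := le_finrank_inf_add_length w
  have h2 := Adj.finrank_inf_le (Y := Y) hadj
  have h3 := Adj.finrank_inf hadj
  have h4 : (X.1 ⊓ Z.1) ⊓ (Z.1 ⊓ Y.1) ≤ X.1 ⊓ Y.1 := inf_le_inf inf_le_left inf_le_right
  have h5 := finrank_add_finrank_le_of_le (A := X.1 ⊓ Z.1) (B := Z.1 ⊓ Y.1) inf_le_right inf_le_left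
  rw [Z.2.2] at h5
  have h6 := eq_of_le_of_finrank_le h4 (by omega)
  have h7 := finrank_sup_add_finrank_inf_eq (X.1 ⊓ Z.1) (Z.1 ⊓ Y.1)
  rw [h6] at h7
  refine ⟨by omega, h6 ▸ inf_le_left.trans inf_le_right,
    eq_of_le_of_finrank_le (sup_le inf_le_right inf_le_left) (by rw [Z.2.2]; omega), ?_⟩
  by_contra! hc
  have := (hc.2.dist_add hk).2
  omega

/-- Vertices of the first layer with the same intersection with `X` are adjacent. -/
theorem Adj.of_inf_left_eq (hk : k < W.wittIndex) (hXY : X ≠ Y) (hop : ¬ W.Opposite X Y)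
    (h1 : Z₁ ∈ (W.polarGrassmannGraph k).towards X Y)
    (h2 : Z₂ ∈ (W.polarGrassmannGraph k).towards X Y) (h12 : Z₁ ≠ Z₂)
    (hH : X.1 ⊓ Z₁.1 = X.1 ⊓ Z₂.1) : (W.polarGrassmannGraph k).Adj Z₁ Z₂ := by
  obtain ⟨-, -, hs1, -⟩ := towards_of_not_opposite hk hXY hop h1
  obtain ⟨-, -, hs2, -⟩ := towards_of_not_opposite hk hXY hop h2
  refine adj_of_le_finrank_inf h12 ?_ ?_
  · rw [← hs2, ← hH]
    refine sup_le (inf_le_right.trans Z₁.2.1.le_perp) ?_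
    rw [← hs1, le_perp_comm]
    refine sup_le ?_ ?_
    · rw [le_perp_comm]
      exact inf_le_left.trans ((Adj.le_perp h2.1).trans (perp_anti inf_le_left))
    · exact inf_le_right.trans (Y.2.1.le_perp.trans (perp_anti inf_le_right))
  · have h3 := Adj.finrank_inf h1.1
    have h4 := finrank_mono (le_inf inf_le_right (hH.le.trans inf_le_right) :
      X.1 ⊓ Z₁.1 ≤ Z₁.1 ⊓ Z₂.1)
    omega

/-- Vertices of the first layer with the same intersection with `Y` are adjacent. -/
theorem Adj.of_inf_right_eq (hk : k < W.wittIndex) (hXY : X ≠ Y) (hop : ¬ W.Opposite X Y)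
    (h1 : Z₁ ∈ (W.polarGrassmannGraph k).towards X Y)
    (h2 : Z₂ ∈ (W.polarGrassmannGraph k).towards X Y) (h12 : Z₁ ≠ Z₂)
    (hP : Z₁.1 ⊓ Y.1 = Z₂.1 ⊓ Y.1) : (W.polarGrassmannGraph k).Adj Z₁ Z₂ := by
  obtain ⟨-, -, hs2, -⟩ := towards_of_not_opposite hk hXY hop h2
  refine adj_of_le h1.1.1 h1.1.2 le_sup_right ?_ h12
  rw [← hs2, ← hP]
  exact sup_le_sup inf_le_left inf_le_left

/-- Two nonadjacent vertices in the first layer have a common neighbour in the first layer. -/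
theorem exists_adj_of_not_opposite (hk : k < W.wittIndex) (hXY : X ≠ Y) (hop : ¬ W.Opposite X Y)
    (h1 : Z₁ ∈ (W.polarGrassmannGraph k).towards X Y)
    (h2 : Z₂ ∈ (W.polarGrassmannGraph k).towards X Y) (h12 : Z₁ ≠ Z₂)
    (hadj : ¬ (W.polarGrassmannGraph k).Adj Z₁ Z₂) :
    ∃ Z ∈ (W.polarGrassmannGraph k).towards X Y, (W.polarGrassmannGraph k).Adj Z Z₁ ∧
      (W.polarGrassmannGraph k).Adj Z Z₂ ∧ Z.1 ≤ X.1 ⊔ Z₂.1 := by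
  have hH : X.1 ⊓ Z₁.1 ≠ X.1 ⊓ Z₂.1 := fun h => hadj (Adj.of_inf_left_eq hk hXY hop h1 h2 h12 h)
  have hP : Z₁.1 ⊓ Y.1 ≠ Z₂.1 ⊓ Y.1 := fun h => hadj (Adj.of_inf_right_eq hk hXY hop h1 h2 h12 h)
  obtain ⟨hd1, hD1, hs1, ho1⟩ := towards_of_not_opposite hk hXY hop h1
  obtain ⟨hd2, hD2, hs2, ho2⟩ := towards_of_not_opposite hk hXY hop h2
  obtain ⟨-, hdist⟩ := dist_add_of_not_opposite hXY hop
  have hf1 := Adj.finrank_inf h1.1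
  have hf2 := Adj.finrank_inf h2.1
  -- the common neighbour is `(X ∩ Z₁) + (Z₂ ∩ Y)`
  obtain ⟨y, ⟨hyZ, hyY⟩, hyD⟩ := exists_mem_notMem_of_finrank_lt
    (A := X.1 ⊓ Y.1) (B := Z₂.1 ⊓ Y.1) (by omega)
  have hyX : y ∈ W.perp X.1 := Adj.le_perp h2.1 hyZ
  have hyX' : y ∉ X.1 := fun h => hyD ⟨h, hyY⟩
  have hP2 : X.1 ⊓ Y.1 ⊔ span F {y} = Z₂.1 ⊓ Y.1 :=
    eq_of_le_of_finrank_le (sup_span_singleton_le (le_inf hD2 inf_le_right) ⟨hyZ, hyY⟩)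
      (by rw [finrank_sup_span_singleton hyD]; omega)
  obtain ⟨Z, hZ, hXZ⟩ := exists_adj_hyperplane_sup (inf_le_left : X.1 ⊓ Z₁.1 ≤ X.1) hf1
    (Y.2.1.2 y hyY) hyX hyX'
  have hZY : Z.1 ⊓ Y.1 = Z₂.1 ⊓ Y.1 := by
    rw [← hP2]
    refine le_antisymm ?_ (le_inf (by rw [hZ]; exact sup_le_sup_right (le_inf inf_le_left hD1) _)
      (sup_span_singleton_le inf_le_right hyY))
    rintro x ⟨hx, hxY⟩
    rw [hZ] at hx
    obtain ⟨u, hu, v, hv, rfl⟩ := mem_sup.mp hx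
    have hvY : v ∈ Y.1 := (span_singleton_le_iff_mem y Y.1).mpr hyY hv
    exact add_mem (mem_sup_left ⟨hu.1, by simpa using sub_mem hxY hvY⟩) (mem_sup_right hv)
  have hZT : Z ∈ (W.polarGrassmannGraph k).towards X Y := by
    refine ⟨hXZ, ?_⟩
    by_cases hZeq : Z = Y
    · rw [hZeq, inf_idem] at hZY
      have h3 : finrank F (Z₂.1 ⊓ Y.1 : Submodule F V) = k := by
        rw [← hZY, Y.2.2]
      rw [hZeq, SimpleGraph.dist_self]
      omega
    · have hZop : ¬ W.Opposite Z Y := by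
        have hZ1Y : Z₁ ≠ Y := by
          intro h
          rw [h, inf_idem, Y.2.2] at hd1
          refine hP ?_
          rw [h, inf_idem]
          exact (eq_of_le_of_finrank_le inf_le_right (by rw [Y.2.2]; omega)).symm
        obtain ⟨y₁, ⟨hy₁Y, hy₁Z⟩, hy₁⟩ := Set.not_subset.mp
          (fun hh => (ho1.resolve_left hZ1Y) (opposite_iff.mpr ⟨hZ1Y, hh⟩))
        have h3 : Z₁.1 ⊓ Y.1 ⊔ span F {y₁} ≤ Y.1 ⊓ W.perp (X.1 ⊓ Z₁.1) :=
          sup_span_singleton_le (le_inf inf_le_right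
            (inf_le_left.trans (Z₁.2.1.le_perp.trans (perp_anti inf_le_right))))
            ⟨hy₁Y, perp_anti inf_le_right hy₁Z⟩
        have h4 := finrank_mono h3
        rw [finrank_sup_span_singleton (fun hh => hy₁ (mem_inf.mp hh).1)] at h4
        obtain ⟨y', ⟨hy'Y, hy'H⟩, hy'⟩ := exists_mem_notMem_of_finrank_lt
          (A := Z₂.1 ⊓ Y.1) (B := Y.1 ⊓ W.perp (X.1 ⊓ Z₁.1)) (by omega)
        intro hZop
        have h5 : y' ∈ Z.1 := by
          refine (opposite_iff.mp hZop).2 ⟨hy'Y, ?_⟩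
          rw [hZ]
          exact mem_perp_sup.mpr ⟨hy'H, mem_perp_span_singleton.mpr (Y.2.1.1 y hyY y' hy'Y)⟩
        exact hy' (hZY ▸ ⟨h5, hy'Y⟩)
      have := (dist_add_of_not_opposite hZeq hZop).2
      rw [hZY] at this
      omega
  have hHZ : X.1 ⊓ Z.1 = X.1 ⊓ Z₁.1 := by
    refine (eq_of_le_of_finrank_le (le_inf inf_le_left (by rw [hZ]; exact le_sup_left)) ?_).symm
    have := Adj.finrank_inf hXZ
    omega
  refine ⟨Z, hZT, Adj.of_inf_left_eq hk hXY hop hZT h1 ?_ hHZ,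
    Adj.of_inf_right_eq hk hXY hop hZT h2 ?_ hZY, ?_⟩
  · rintro rfl; exact hP hZY
  · rintro rfl; exact hH hHZ.symm
  · rw [hZ]
    exact sup_span_singleton_le (inf_le_left.trans le_sup_left) (mem_sup_right hyZ)

/-- Adjacent vertices of the first layer agree in one of their two components. -/
theorem Adj.inf_left_eq_or (hk : k < W.wittIndex) (hXY : X ≠ Y) (hop : ¬ W.Opposite X Y)
    (h1 : Z₁ ∈ (W.polarGrassmannGraph k).towards X Y)
    (h2 : Z₂ ∈ (W.polarGrassmannGraph k).towards X Y)
    (hadj : (W.polarGrassmannGraph k).Adj Z₁ Z₂) :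
    X.1 ⊓ Z₁.1 = X.1 ⊓ Z₂.1 ∨ Z₁.1 ⊓ Y.1 = Z₂.1 ⊓ Y.1 := by
  by_contra! hc
  obtain ⟨hd1, hD1, hs1, -⟩ := towards_of_not_opposite hk hXY hop h1
  obtain ⟨hd2, hD2, hs2, -⟩ := towards_of_not_opposite hk hXY hop h2
  have hf1 := Adj.finrank_inf h1.1
  have hf2 := Adj.finrank_inf h2.1
  have hX : X.1 ⊓ Z₁.1 ⊔ X.1 ⊓ Z₂.1 = X.1 := by
    refine eq_of_le_of_finrank_le (sup_le inf_le_left inf_le_left) ?_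
    by_contra! hlt
    rw [X.2.2] at hlt
    have h3 := eq_of_le_of_finrank_le (le_sup_left : X.1 ⊓ Z₁.1 ≤ X.1 ⊓ Z₁.1 ⊔ X.1 ⊓ Z₂.1)
      (by omega)
    have h4 := eq_of_le_of_finrank_le (le_sup_right : X.1 ⊓ Z₂.1 ≤ X.1 ⊓ Z₁.1 ⊔ X.1 ⊓ Z₂.1)
      (by omega)
    exact hc.1 (h3.trans h4.symm)
  obtain ⟨P, hP1, hP2, hP3⟩ : ∃ P : Submodule F V, Z₁.1 ⊓ Y.1 ≤ P ∧ Z₂.1 ⊓ Y.1 ≤ P ∧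
      P ≤ (Z₁.1 ⊔ Z₂.1) ⊓ Y.1 :=
    ⟨_, le_sup_left, le_sup_right, sup_le (inf_le_inf_right _ le_sup_left)
      (inf_le_inf_right _ le_sup_right)⟩
  have hPd : finrank F (X.1 ⊓ Y.1 : Submodule F V) + 2 ≤ finrank F P := by
    by_contra! hlt
    have h3 := eq_of_le_of_finrank_le hP1 (by omega)
    have h4 := eq_of_le_of_finrank_le hP2 (by omega)
    exact hc.2 (h3.trans h4.symm)
  have hXP : X.1 ⊔ P ≤ Z₁.1 ⊔ Z₂.1 := by
    refine sup_le ?_ (hP3.trans inf_le_left)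
    rw [← hX]
    exact sup_le_sup inf_le_right inf_le_right
  have h5 := finrank_mono hXP
  have h6 := finrank_sup_add_finrank_inf_eq X.1 P
  have h7 := finrank_mono (inf_le_inf_left X.1 (hP3.trans inf_le_right))
  rw [hadj.2] at h5
  rw [X.2.2] at h6
  omega

/-- Two nonadjacent vertices in the first layer have at most two common neighbours there. -/
theorem eq_or_eq_of_not_opposite (hk : k < W.wittIndex) (hXY : X ≠ Y) (hop : ¬ W.Opposite X Y)
    (h1 : Z₁ ∈ (W.polarGrassmannGraph k).towards X Y)
    (h2 : Z₂ ∈ (W.polarGrassmannGraph k).towards X Y) (h12 : Z₁ ≠ Z₂)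
    (hadj : ¬ (W.polarGrassmannGraph k).Adj Z₁ Z₂)
    (hZ : Z ∈ (W.polarGrassmannGraph k).towards X Y)
    (ha1 : (W.polarGrassmannGraph k).Adj Z Z₁) (ha2 : (W.polarGrassmannGraph k).Adj Z Z₂) :
    Z.1 = X.1 ⊓ Z₁.1 ⊔ Z₂.1 ⊓ Y.1 ∨ Z.1 = X.1 ⊓ Z₂.1 ⊔ Z₁.1 ⊓ Y.1 := by
  have hH : X.1 ⊓ Z₁.1 ≠ X.1 ⊓ Z₂.1 := fun h => hadj (Adj.of_inf_left_eq hk hXY hop h1 h2 h12 h)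
  have hP : Z₁.1 ⊓ Y.1 ≠ Z₂.1 ⊓ Y.1 := fun h => hadj (Adj.of_inf_right_eq hk hXY hop h1 h2 h12 h)
  obtain ⟨-, -, hs, -⟩ := towards_of_not_opposite hk hXY hop hZ
  rw [← hs]
  rcases Adj.inf_left_eq_or hk hXY hop hZ h1 ha1 with e1 | e1 <;>
    rcases Adj.inf_left_eq_or hk hXY hop hZ h2 ha2 with e2 | e2
  · exact absurd (e1.symm.trans e2) hH
  · exact Or.inl (by rw [e1, e2])
  · exact Or.inr (by rw [e1, e2])
  · exact absurd (e1.symm.trans e2) hP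

/-! ### The first layer between two opposite vertices -/

/-- A singular vector orthogonal to two opposite vertices, and not in their intersection, is not
orthogonal to some singular vector of the same kind. -/
theorem Opposite.exists_partner (h : W.Opposite X Y) {z : V} (hz : W.quad z = 0)
    (hzX : z ∈ W.perp X.1) (hzY : z ∈ W.perp Y.1) (hzD : z ∉ X.1) :
    ∃ z', W.quad z' = 0 ∧ z' ∈ W.perp X.1 ∧ z' ∈ W.perp Y.1 ∧ W.form z z' = 1 := by
  obtain ⟨y, hy, hzy⟩ : ∃ y ∈ W.perp (X.1 ⊔ Y.1), W.form z y ≠ 0 := by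
    by_contra! hc
    obtain ⟨u, hu, hrad⟩ := exists_sub_mem_radical hc
    obtain ⟨x, hx, y, hy, rfl⟩ := mem_sup.mp hu
    have hyX : y ∈ W.perp X.1 := mem_perp_iff.mpr fun x' hx' => by
      have := hrad x'
      rwa [form_sub_left, form_add_left, mem_perp_iff.mp hzX x' hx', X.2.1.1 x hx x' hx', zero_add,
        zero_sub, neg_eq_zero] at this
    have hxy : x + y ∈ X.1 := add_mem hx (h.inf_perp_le ⟨hy, hyX⟩).1
    have hS := X.2.1.sup_span_singleton hz hzX
    have h1 := W.eq_zero_of_form (hS.2 _ (sub_mem (mem_sup_span_singleton_self X.1 z)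
      (mem_sup_left hxy))) hrad
    rw [sub_eq_zero] at h1
    exact hzD (h1 ▸ hxy)
  obtain ⟨c, hc⟩ := W.exists_quad_add_smul_eq_zero hz hzy
  rw [mem_perp_sup] at hy
  refine ⟨(W.form z y)⁻¹ • (y + c • z), ?_, ?_, ?_, ?_⟩
  · rw [quad_smul, hc, mul_zero]
  · exact smul_mem _ _ (add_mem hy.1 (smul_mem _ _ hzX))
  · exact smul_mem _ _ (add_mem hy.2 (smul_mem _ _ hzY))
  · rw [form_smul_right, form_add_right, form_smul_right, W.form_self hz, mul_zero, add_zero,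
      inv_mul_cancel₀ hzy]

theorem Opposite.exists_mem_towards (hk : k < W.wittIndex) (h : W.Opposite X Y)
    {H : Submodule F V} {z : V} (hDH : X.1 ⊓ Y.1 ≤ H)
    (hH : H ≤ X.1) (hHd : finrank F H + 1 = k) (hz : W.quad z = 0) (hzX : z ∈ W.perp X.1)
    (hzY : z ∈ W.perp Y.1) (hzD : z ∉ X.1) :
    ∃ Z ∈ (W.polarGrassmannGraph k).towards X Y, Z.1 = H ⊔ span F {z} := by
  obtain ⟨Z, hZ, hadj, hZY, hop, hD⟩ := h.exists_adj hDH hH hHd hz hzX hzY (fun hh => hzD hh.1)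
  refine ⟨Z, ⟨hadj, ?_⟩, hZ⟩
  have h1 := (dist_add_of_not_opposite hZY hop).2
  have h2 := (h.dist_add hk).2
  rw [hD] at h1
  omega

/-- Conversely, a vertex next to `X` on a geodesic to an opposite vertex `Y` is spanned by a
hyperplane of `X` and a vector orthogonal to both ends. -/
theorem Opposite.towards (hk : k < W.wittIndex) (h : W.Opposite X Y)
    (hZ : Z ∈ (W.polarGrassmannGraph k).towards X Y) : X.1 ⊓ Y.1 ≤ Z.1 ∧
    ∃ w, W.quad w = 0 ∧ w ∈ W.perp X.1 ∧ w ∈ W.perp Y.1 ∧ w ∉ X.1 ∧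
      Z.1 = X.1 ⊓ Z.1 ⊔ span F {w} := by
  obtain ⟨hadj, hdist⟩ := hZ
  obtain ⟨hr, hd⟩ := h.dist_add hk
  have hr' : (W.polarGrassmannGraph k).Reachable Z Y := hadj.symm.reachable.trans hr
  obtain ⟨p, hp⟩ := hr'.exists_walk_length_eq_dist
  have h1 := le_finrank_inf_add_length p
  have h2 : Z.1 ⊓ Y.1 ≤ X.1 ⊓ Y.1 := fun y hy => h.inf_perp_le ⟨hy.2, Adj.le_perp hadj hy.1⟩
  have h3 := eq_of_le_of_finrank_le h2 (by omega)
  have hlt := finrank_inf_lt h.1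
  have hZY : Z ≠ Y := by
    rintro rfl
    rw [inf_idem] at h2
    have := finrank_mono h2
    rw [Z.2.2] at this
    omega
  have hop : ¬ W.Opposite Y Z := by
    intro hc
    have := (hc.symm.dist_add hk).2
    rw [h3] at this
    omega
  obtain ⟨w, ⟨hwZ, hwY⟩, hwY'⟩ := Set.not_subset.mp
    (fun hh => hop (opposite_iff.mpr ⟨hZY.symm, hh⟩))
  have hwX : w ∉ X.1 := fun hh => hwY' (h.inf_perp_le' ⟨hh, hwY⟩).2
  refine ⟨h3 ▸ inf_le_left, w, Z.2.1.2 w hwZ, Adj.le_perp hadj hwZ, hwY, hwX, ?_⟩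
  refine (eq_of_le_of_finrank_le (sup_span_singleton_le inf_le_right hwZ) ?_).symm
  rw [finrank_sup_span_singleton (fun hh => hwX (mem_inf.mp hh).1), Z.2.2,
    Adj.finrank_inf hadj]

/-- If the ends of a geodesic are opposite and `dim (X ∩ Y) ≤ k - 2`, then the first layer contains
nonadjacent vertices without a common neighbour in the layer. -/
theorem Opposite.exists_no_common (hk : k < W.wittIndex) (h : W.Opposite X Y)
    (hD : finrank F (X.1 ⊓ Y.1 : Submodule F V) + 2 ≤ k) :
    ∃ Z₁ ∈ (W.polarGrassmannGraph k).towards X Y, ∃ Z₂ ∈ (W.polarGrassmannGraph k).towards X Y,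
      Z₁ ≠ Z₂ ∧ ¬ (W.polarGrassmannGraph k).Adj Z₁ Z₂ ∧
      ∀ Z ∈ (W.polarGrassmannGraph k).towards X Y,
        (W.polarGrassmannGraph k).Adj Z Z₁ → ¬ (W.polarGrassmannGraph k).Adj Z Z₂ := by
  obtain ⟨z, hz, hzX, hzY, hzD⟩ := X.2.1.exists_mem_perp (T := Y.1) (by rwa [Y.2.2])
  have hzX' : z ∉ X.1 := fun hh => hzD (h.inf_perp_le' ⟨hh, hzY⟩)
  obtain ⟨z', hz', hzX2, hzY2, hzz⟩ := h.exists_partner hz hzX hzY hzX'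
  have hzz' : W.form z z' ≠ 0 := hzz ▸ one_ne_zero
  have hzX2' : z' ∉ X.1 := fun hh => hzz' (W.form_comm_zero (hzX z' hh))
  obtain ⟨H₁, hD1, hX1, hd1⟩ := exists_between_finrank_eq (A := X.1 ⊓ Y.1) (K := X.1) (n := k - 1)
    inf_le_left (by omega) (by rw [X.2.2]; omega)
  obtain ⟨v, hvX, hvH⟩ := exists_mem_notMem_of_finrank_lt (A := H₁) (B := X.1)
    (by rw [X.2.2]; omega)
  obtain ⟨H₂, hD2, hX2, hd2⟩ := exists_between_finrank_eq (A := X.1 ⊓ Y.1 ⊔ span F {v}) (K := X.1)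
    (n := k - 1) (sup_span_singleton_le inf_le_left hvX)
    (by rw [finrank_sup_span_singleton (fun hh => hvH (hD1 hh))]; omega) (by rw [X.2.2]; omega)
  have hH12 : H₁ ⊔ H₂ = X.1 := by
    refine eq_of_le_of_finrank_le (sup_le hX1 hX2) ?_
    by_contra! hlt
    rw [X.2.2] at hlt
    have := eq_of_le_of_finrank_le (le_sup_left : H₁ ≤ H₁ ⊔ H₂) (by omega)
    exact hvH (this ▸ mem_sup_right (hD2 (mem_sup_span_singleton_self _ v)))
  obtain ⟨Z₁, hZ1, hZ1e⟩ := h.exists_mem_towards hk hD1 hX1 (by omega) hz hzX hzY hzX'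
  obtain ⟨Z₂, hZ2, hZ2e⟩ := h.exists_mem_towards hk (le_sup_left.trans hD2) hX2 (by omega) hz'
    hzX2 hzY2 hzX2'
  have hzZ : z ∈ Z₁.1 := hZ1e ▸ mem_sup_span_singleton_self _ _
  have hzZ2 : z' ∈ Z₂.1 := hZ2e ▸ mem_sup_span_singleton_self _ _
  -- a common neighbour contains neither `z` nor `z'`, hence it contains `H₁` and `H₂`
  have key : ∀ {H : Submodule F V} {u : V} {Z Z' : W.Singular k}, H ≤ X.1 →
      finrank F H = k - 1 → W.quad u = 0 → u ∈ W.perp X.1 → u ∈ W.perp Y.1 → u ∉ X.1 →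
      Z'.1 = H ⊔ span F {u} → Z ∈ (W.polarGrassmannGraph k).towards X Y →
      (W.polarGrassmannGraph k).Adj Z Z' → u ∉ Z.1 → H ≤ Z.1 := by
    intro H u Z Z' hHX hHd hu huX huY huX' hZ' hZ hadj huZ
    by_contra hHZ
    obtain ⟨hDZ, w, -, -, hwY, hwX', hZw⟩ := h.towards hk hZ
    have hf := Adj.finrank_inf hZ.1
    have hHH : X.1 ⊓ Z.1 ⊔ H = X.1 := by
      refine eq_of_le_of_finrank_le (sup_le inf_le_left hHX) ?_
      by_contra! hlt
      rw [X.2.2] at hlt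
      have := eq_of_le_of_finrank_le (le_sup_left : X.1 ⊓ Z.1 ≤ X.1 ⊓ Z.1 ⊔ H) (by omega)
      exact hHZ ((le_sup_right.trans this.ge).trans inf_le_right)
    have hS : X.1 ⊔ span F {u} = Z.1 ⊔ Z'.1 := by
      refine eq_of_le_of_finrank_le (sup_span_singleton_le ?_ (mem_sup_right ?_)) ?_
      · rw [← hHH]
        exact sup_le_sup inf_le_right (by rw [hZ']; exact le_sup_left)
      · rw [hZ']; exact mem_sup_span_singleton_self _ _
      · rw [finrank_sup_span_singleton huX', hadj.2, X.2.2]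
    have hw : w ∈ X.1 ⊔ span F {u} := by
      rw [hS]; refine mem_sup_left ?_
      rw [hZw]; exact mem_sup_span_singleton_self _ _
    have hwZ : w ∈ Z.1 := by rw [hZw]; exact mem_sup_span_singleton_self _ _
    obtain ⟨x, hx, cu, hcu, rfl⟩ := mem_sup.mp hw
    obtain ⟨c, rfl⟩ := mem_span_singleton.mp hcu
    have hxY : x ∈ W.perp Y.1 := by simpa using sub_mem hwY (smul_mem _ c huY)
    have hxZ := hDZ (h.inf_perp_le' ⟨hx, hxY⟩)
    have hcZ : c • u ∈ Z.1 := by simpa using sub_mem hwZ hxZ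
    by_cases hc : c = 0
    · exact hwX' (by simpa [hc] using hx)
    · exact huZ ((smul_mem_iff _ hc).mp hcZ)
  refine ⟨Z₁, hZ1, Z₂, hZ2, ?_, ?_, fun Z hZ ha1 ha2 => ?_⟩
  · rintro rfl
    exact hzz' (Z₁.2.1.1 z hzZ z' hzZ2)
  · intro ha
    exact hzz' (Adj.le_perp ha hzZ2 z hzZ)
  · have h1 : H₁ ≤ Z.1 := key hX1 hd1 hz hzX hzY hzX' hZ1e hZ ha1
      (fun hh => hzz' (Adj.le_perp ha2 hzZ2 z hh))
    have h2 : H₂ ≤ Z.1 := key hX2 hd2 hz' hzX2 hzY2 hzX2' hZ2e hZ ha2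
      (fun hh => hzz' (W.form_comm_zero (Adj.le_perp ha1 hzZ z' hh)))
    exact hZ.1.ne (eq_of_le (hH12 ▸ sup_le h1 h2))

end FormedSpace

namespace FormedSpace

open Module Submodule

variable {F V : Type*} [Field F] [AddCommGroup V] [Module F V] {W : FormedSpace F V}

/-! ### Ends meeting in a subspace of dimension `k - 1` -/

theorem exists_tr_eq_zero_or (W : FormedSpace F V) :
    (∃ c, c ≠ 0 ∧ W.tr c = 0) ∨ ∃ Q h, W = orthogonal Q h := by
  cases W with
  | symplectic B alt nd => exact Or.inl ⟨1, one_ne_zero, rfl⟩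
  | orthogonal Q hQ => exact Or.inr ⟨Q, hQ, rfl⟩
  | unitary σ i nt B herm nd =>
    left
    obtain ⟨a, ha⟩ : ∃ a, a - σ a ≠ 0 := by
      by_contra! hc
      exact nt (RingHom.ext fun a => (sub_eq_zero.mp (hc a)).symm)
    refine ⟨a - σ a, ha, ?_⟩
    change a - σ a + σ (a - σ a) = 0
    rw [map_sub, i]; ring

variable [FiniteDimensional F V] {k : ℕ} {X Y Z Z₁ Z₂ : W.Singular k}

theorem two_mul_wittIndex_le (W : FormedSpace F V) : 2 * W.wittIndex ≤ finrank F V := by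
  rcases Nat.eq_zero_or_pos W.wittIndex with h0 | h0
  · omega
  · obtain ⟨X, Y, -, hXY⟩ := exists_opposite (W := W) le_rfl h0 le_rfl
    have h1 := finrank_sup_add_finrank_inf_eq X.1 Y.1
    rw [X.2.2, Y.2.2] at h1
    have h2 := (X.1 ⊔ Y.1).finrank_le
    omega

theorem finrank_le_finrank_perp_add (A : Submodule F V) :
    finrank F V ≤ finrank F (W.perp A) + finrank F A := by
  have h := finrank_inf_perp_le (W := W) ⊤ (bot_le : ⊥ ≤ A)
  have hb : W.perp (⊥ : Submodule F V) = ⊤ :=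
    eq_top_iff.mpr fun y _ x hx => by rw [(mem_bot F).mp hx, form_zero_left]
  rwa [hb, top_inf_eq, top_inf_eq, finrank_top, finrank_bot, add_zero] at h

/-- If the ends are opposite and meet in a subspace of dimension `k - 1`, then the first layer
contains nonadjacent vertices. They are spanned by `X ∩ Y` and a vector of a hyperbolic pair. -/
theorem Opposite.exists_pair (hk : k < W.wittIndex) (h : W.Opposite X Y)
    (hD : finrank F (X.1 ⊓ Y.1 : Submodule F V) + 1 = k) :
    ∃ z z' : V, W.quad z = 0 ∧ z ∈ W.perp X.1 ∧ z ∈ W.perp Y.1 ∧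
      W.quad z' = 0 ∧ z' ∈ W.perp X.1 ∧ z' ∈ W.perp Y.1 ∧ W.form z z' = 1 ∧
    ∃ Z₁ ∈ (W.polarGrassmannGraph k).towards X Y, ∃ Z₂ ∈ (W.polarGrassmannGraph k).towards X Y,
      Z₁.1 = X.1 ⊓ Y.1 ⊔ span F {z} ∧ Z₂.1 = X.1 ⊓ Y.1 ⊔ span F {z'} ∧
      Z₁ ≠ Z₂ ∧ ¬ (W.polarGrassmannGraph k).Adj Z₁ Z₂ := by
  obtain ⟨z, hz, hzX, hzY, hzD⟩ := X.2.1.exists_mem_perp (T := Y.1) (by rwa [Y.2.2])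
  have hzX' : z ∉ X.1 := fun hh => hzD (h.inf_perp_le' ⟨hh, hzY⟩)
  obtain ⟨z', hz', hzX2, hzY2, hzz⟩ := h.exists_partner hz hzX hzY hzX'
  have hzz' : W.form z z' ≠ 0 := hzz ▸ one_ne_zero
  have hzX2' : z' ∉ X.1 := fun hh => hzz' (W.form_comm_zero (hzX z' hh))
  obtain ⟨Z₁, hZ1, hZ1e⟩ := h.exists_mem_towards hk le_rfl inf_le_left hD hz hzX hzY hzX'
  obtain ⟨Z₂, hZ2, hZ2e⟩ := h.exists_mem_towards hk le_rfl inf_le_left hD hz' hzX2 hzY2 hzX2'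
  have hzZ : z ∈ Z₁.1 := hZ1e ▸ mem_sup_span_singleton_self _ _
  have hzZ2 : z' ∈ Z₂.1 := hZ2e ▸ mem_sup_span_singleton_self _ _
  refine ⟨z, z', hz, hzX, hzY, hz', hzX2, hzY2, hzz, Z₁, hZ1, Z₂, hZ2, hZ1e, hZ2e, ?_, ?_⟩
  · rintro rfl
    exact hzz' (Z₁.2.1.1 z hzZ z' hzZ2)
  · intro ha
    exact hzz' (Adj.le_perp ha hzZ2 z hzZ)

theorem Opposite.towards_eq (hk : k < W.wittIndex) (h : W.Opposite X Y)
    (hD : finrank F (X.1 ⊓ Y.1 : Submodule F V) + 1 = k)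
    (hZ : Z ∈ (W.polarGrassmannGraph k).towards X Y) :
    ∃ w, W.quad w = 0 ∧ w ∈ W.perp X.1 ∧ w ∈ W.perp Y.1 ∧ w ∉ X.1 ∧
      Z.1 = X.1 ⊓ Y.1 ⊔ span F {w} := by
  obtain ⟨hDZ, w, hw, hwX, hwY, hwX', hZw⟩ := h.towards hk hZ
  refine ⟨w, hw, hwX, hwY, hwX', ?_⟩
  rw [eq_of_le_of_finrank_le (le_inf inf_le_left hDZ : X.1 ⊓ Y.1 ≤ X.1 ⊓ Z.1)]
  · exact hZw
  · have := Adj.finrank_inf hZ.1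
    omega

/-- A singular vector `u + v + c u'` orthogonal to `U` that is not congruent to `u` modulo `D`.
Outside the orthogonal case some nonzero `c` has trace zero, and `v = 0` works; in the orthogonal
case `v` is taken outside `D` and `c = -Q v`, for which the dimension has to be large enough. -/
theorem exists_quad_add_add_smul_eq_zero {U D : Submodule F V} {u u' : V} (hu : W.quad u = 0)
    (hu' : W.quad u' = 0) (huu : W.form u u' = 1)
    (hUD : (∃ Q h, W = orthogonal Q h) → finrank F U + finrank F D + 2 < finrank F V) :
    ∃ (v : V) (c : F), v ∈ W.perp U ∧ W.form u v = 0 ∧ W.form u' v = 0 ∧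
      W.quad (u + v + c • u') = 0 ∧ (c ≠ 0 ∨ v ∉ D) := by
  rcases W.exists_tr_eq_zero_or with ⟨c, hc0, hc⟩ | hQ
  · refine ⟨0, c, zero_mem _, form_zero_right _ _, form_zero_right _ _, ?_, Or.inl hc0⟩
    rw [add_zero, quad_add, quad_smul, hu, hu', form_smul_right, huu, mul_one, hc]
    ring
  · have hdim := hUD hQ
    have h1 := finrank_add_le_finrank_add_finrank U (span F {u, u'})
    have h2 : finrank F (span F {u, u'} : Submodule F V) ≤ 2 := by
      classical
      have := finrank_span_finset_le_card (R := F) ({u, u'} : Finset V)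
      rw [Finset.coe_pair] at this
      exact this.trans Finset.card_le_two
    have h3 := finrank_le_finrank_perp_add (W := W) (U ⊔ span F {u, u'})
    obtain ⟨v, hv, hvD⟩ := exists_mem_notMem_of_finrank_lt (A := D)
      (B := W.perp (U ⊔ span F {u, u'})) (by omega)
    rw [mem_perp_sup] at hv
    obtain ⟨t, ht⟩ := W.exists_tr v
    have hv1 := hv.2 u (subset_span (by simp))
    have hv2 := hv.2 u' (subset_span (by simp))
    refine ⟨v, -t, hv.1, hv1, hv2, ?_, Or.inr hvD⟩
    rw [quad_add, quad_add, quad_smul, hu, hu', hv1, form_smul_right, form_add_left, huu,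
      W.form_comm_zero hv2, map_zero, ← ht, add_zero (1 : F), mul_one, map_neg, map_neg]
    ring

/-- In the situation of `Opposite.exists_pair`, a singular vector orthogonal to `X`, `Y`, `z` and
`z'` spans together with `X ∩ Y` a common neighbour of `Z₁` and `Z₂` in the first layer. -/
theorem Opposite.exists_adj_adj (hk : k < W.wittIndex) (h : W.Opposite X Y)
    (hD : finrank F (X.1 ⊓ Y.1 : Submodule F V) + 1 = k) {z z' w : V} (hzz' : W.form z z' ≠ 0)
    (hzX : z ∈ W.perp X.1) (hzX2 : z' ∈ W.perp X.1) (hZ1e : Z₁.1 = X.1 ⊓ Y.1 ⊔ span F {z})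
    (hZ2e : Z₂.1 = X.1 ⊓ Y.1 ⊔ span F {z'}) (hw : W.quad w = 0) (hwX : w ∈ W.perp X.1)
    (hwY : w ∈ W.perp Y.1) (hwX' : w ∉ X.1) (hzw : W.form z w = 0) (hzw' : W.form z' w = 0) :
    ∃ Z : W.Singular k, Z.1 = X.1 ⊓ Y.1 ⊔ span F {w} ∧
      Z ∈ (W.polarGrassmannGraph k).towards X Y ∧
      (W.polarGrassmannGraph k).Adj Z Z₁ ∧ (W.polarGrassmannGraph k).Adj Z Z₂ := by
  obtain ⟨Z, hZ, hZe⟩ := h.exists_mem_towards hk le_rfl inf_le_left hD hw hwX hwY hwX'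
  have hadj : ∀ (Z' : W.Singular k) (s t : V), Z'.1 = X.1 ⊓ Y.1 ⊔ span F {s} →
      W.form s w = 0 → s ∈ W.perp X.1 → t ∈ W.perp X.1 → W.form t w = 0 → W.form t s ≠ 0 →
      (W.polarGrassmannGraph k).Adj Z Z' := by
    intro Z' s t hZ' hsw hsX htX htw hts
    refine adj_of_le_finrank_inf ?_ ?_ ?_
    · rintro rfl
      have h1 : s ∈ X.1 ⊓ Y.1 ⊔ span F {w} := by
        rw [← hZe, hZ']; exact mem_sup_span_singleton_self _ _
      have h2 : X.1 ⊓ Y.1 ⊔ span F {w} ≤ W.perp (span F {t}) :=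
        sup_span_singleton_le (inf_le_left.trans (le_perp_comm.mp
          (span_singleton_le_perp.mpr htX))) (mem_perp_span_singleton.mpr htw)
      exact hts (mem_perp_span_singleton.mp (h2 h1))
    · have hDw : X.1 ⊓ Y.1 ≤ W.perp (span F {w}) :=
        inf_le_left.trans (le_perp_comm.mp (span_singleton_le_perp.mpr hwX))
      rw [hZ']
      refine sup_span_singleton_le ?_ ?_ <;> rw [hZe]
      · exact fun d hd => mem_perp_sup.mpr ⟨(X.2.1.mono inf_le_left).le_perp hd, hDw hd⟩
      · exact mem_perp_sup.mpr ⟨perp_anti inf_le_left hsX,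
          mem_perp_span_singleton.mpr (W.form_comm_zero hsw)⟩
    · have := finrank_mono (le_inf (hZe ▸ le_sup_left) (hZ' ▸ le_sup_left) :
        X.1 ⊓ Y.1 ≤ Z.1 ⊓ Z'.1)
      omega
  exact ⟨Z, hZe, hZ, hadj Z₁ z z' hZ1e hzw hzX hzX2 hzw' fun hh => hzz' (W.form_comm_zero hh),
    hadj Z₂ z' z hZ2e hzw' hzX2 hzX hzw hzz'⟩

/-- If the ends are opposite and meet in a subspace of dimension `k - 1`, then the first layer is
the polar space of rank `ω - k` on `(X + Y)ᗮ / (X ∩ Y)`. Unless this is a grid, which happens only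
for `Ω⁺(2k + 4, q)`, two of its points that are not collinear have either no common neighbour or
at least three. -/
theorem Opposite.exists_common (hk : k < W.wittIndex) (h : W.Opposite X Y)
    (hD : finrank F (X.1 ⊓ Y.1 : Submodule F V) + 1 = k)
    (hW : ¬ (W.IsOrthogonalPlus ∧ W.wittIndex = k + 2)) :
    ∃ Z₁ ∈ (W.polarGrassmannGraph k).towards X Y, ∃ Z₂ ∈ (W.polarGrassmannGraph k).towards X Y,
      Z₁ ≠ Z₂ ∧ ¬ (W.polarGrassmannGraph k).Adj Z₁ Z₂ ∧
      ((∀ Z ∈ (W.polarGrassmannGraph k).towards X Y,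
        (W.polarGrassmannGraph k).Adj Z Z₁ → ¬ (W.polarGrassmannGraph k).Adj Z Z₂) ∨
      ∃ f : Fin 3 → W.Singular k, Function.Injective f ∧
        ∀ i, f i ∈ (W.polarGrassmannGraph k).towards X Y ∧
          (W.polarGrassmannGraph k).Adj (f i) Z₁ ∧ (W.polarGrassmannGraph k).Adj (f i) Z₂) := by
  obtain ⟨z, z', hz, hzX, hzY, hz', hzX2, hzY2, hzz, Z₁, hZ1, Z₂, hZ2, hZ1e, hZ2e, hne, hnadj⟩ :=
    h.exists_pair hk hD
  have hzz' : W.form z z' ≠ 0 := hzz ▸ one_ne_zero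
  have hzX' : z ∉ X.1 := fun hh => hzz' (hzX2 z hh)
  have hzY' : z ∉ Y.1 := fun hh => hzz' (hzY2 z hh)
  have hzY2' : z' ∉ Y.1 := fun hh => hzz' (W.form_comm_zero (hzY z' hh))
  have hzZ : z ∈ Z₁.1 := hZ1e ▸ mem_sup_span_singleton_self _ _
  have hzZ2 : z' ∈ Z₂.1 := hZ2e ▸ mem_sup_span_singleton_self _ _
  refine ⟨Z₁, hZ1, Z₂, hZ2, hne, hnadj, ?_⟩
  let X' : W.Singular (k + 1) := ⟨X.1 ⊔ span F {z}, X.2.1.sup_span_singleton hz hzX, by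
    rw [finrank_sup_span_singleton hzX', X.2.2]⟩
  let Y' : W.Singular (k + 1) := ⟨Y.1 ⊔ span F {z'}, Y.2.1.sup_span_singleton hz' hzY2, by
    rw [finrank_sup_span_singleton hzY2', Y.2.2]⟩
  rcases Nat.lt_or_ge (k + 1) W.wittIndex with hk2 | hk2
  swap
  · -- the first layer has no edges
    left
    intro Z hZ ha1 ha2
    obtain ⟨w, hw, hwX, hwY, hwX', hZw⟩ := h.towards_eq hk hD hZ
    have hwZ : w ∈ Z.1 := hZw ▸ mem_sup_span_singleton_self _ _
    have hwz : W.form z w = 0 := W.form_comm_zero (Adj.le_perp ha1 hzZ w hwZ)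
    have hwz' : W.form z' w = 0 := W.form_comm_zero (Adj.le_perp ha2 hzZ2 w hwZ)
    have hS := X'.2.1.sup_span_singleton hw
      (mem_perp_sup.mpr ⟨hwX, mem_perp_span_singleton.mpr hwz⟩)
    have hwX2 : w ∉ X'.1 := by
      intro hh
      obtain ⟨x, hx, cz, hcz, rfl⟩ := mem_sup.mp hh
      obtain ⟨c, rfl⟩ := mem_span_singleton.mp hcz
      rw [form_add_right, W.form_comm_zero (hzX2 x hx), form_smul_right, zero_add] at hwz'
      have hc := (mul_eq_zero.mp hwz').resolve_right (fun hh => hzz' (W.form_comm_zero hh))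
      rw [hc, zero_smul, add_zero] at hwX'
      exact hwX' hx
    have := hS.finrank_le
    rw [finrank_sup_span_singleton hwX2, X'.2.2] at this
    omega
  · right
    have hop : W.Opposite X' Y' := by
      refine opposite_iff.mpr ⟨fun hh => ?_, ?_⟩
      · have h1 : z' ∈ X'.1 := by rw [hh]; exact mem_sup_span_singleton_self _ _
        exact hzz' (X'.2.1.1 z (mem_sup_span_singleton_self _ _) z' h1)
      · rintro _ ⟨hyz, hyX⟩
        obtain ⟨y, hy, cz, hcz, rfl⟩ := mem_sup.mp hyz
        obtain ⟨c, rfl⟩ := mem_span_singleton.mp hcz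
        have h1 := hyX z (mem_sup_span_singleton_self _ _)
        rw [form_add_right, W.form_comm_zero (hzY y hy), form_smul_right, zero_add, hzz,
          mul_one] at h1
        rw [h1, zero_smul, add_zero] at hyX ⊢
        exact mem_sup_left (h.inf_perp_le ⟨hy, perp_anti le_sup_left hyX⟩).1
    obtain ⟨u, hu, huX, huY, huD⟩ := X'.2.1.exists_mem_perp (T := Y'.1) (by rwa [Y'.2.2])
    have huX' : u ∉ X'.1 := fun hh => huD (hop.inf_perp_le' ⟨hh, huY⟩)
    obtain ⟨u', hu', huX2, huY2, huu⟩ := hop.exists_partner hu huX huY huX'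
    have hu'u : W.form u' u ≠ 0 := fun hh => one_ne_zero (huu ▸ W.form_comm_zero hh)
    have hDX' : X.1 ⊓ Y.1 ≤ X'.1 := inf_le_left.trans le_sup_left
    have hDY' : X.1 ⊓ Y.1 ≤ Y'.1 := inf_le_right.trans le_sup_left
    -- a third singular vector `u + v + c u'`
    obtain ⟨v, c, hvXY, hvu, hvu', hq, hvc⟩ : ∃ (v : V) (c : F), v ∈ W.perp (X'.1 ⊔ Y'.1) ∧
        W.form u v = 0 ∧ W.form u' v = 0 ∧ W.quad (u + v + c • u') = 0 ∧
        (c ≠ 0 ∨ v ∉ X.1 ⊓ Y.1) := by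
      refine exists_quad_add_add_smul_eq_zero hu hu' huu fun hQ => ?_
      have h1 := W.two_mul_wittIndex_le
      have h2 : ¬ finrank F V = 2 * W.wittIndex ∨ W.wittIndex ≠ k + 2 := by
        by_contra! hc
        exact hW ⟨⟨hQ, hc.1⟩, hc.2⟩
      have h3 := finrank_sup_add_finrank_inf_eq X'.1 Y'.1
      rw [X'.2.2, Y'.2.2] at h3
      have h4 := finrank_mono (le_inf hDX' hDY')
      omega
    obtain ⟨hvX, hvY⟩ := mem_perp_sup.mp hvXY
    have key : ∀ w, W.quad w = 0 → w ∈ W.perp X'.1 → w ∈ W.perp Y'.1 → w ∉ X.1 → _ :=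
      fun w hw hwX hwY hwX' => h.exists_adj_adj hk hD hzz' hzX hzX2 hZ1e hZ2e hw
        (mem_perp_sup.mp hwX).1 (mem_perp_sup.mp hwY).1 hwX'
        (mem_perp_span_singleton.mp (mem_perp_sup.mp hwX).2)
        (mem_perp_span_singleton.mp (mem_perp_sup.mp hwY).2)
    have huX1 : u ∉ X.1 := fun hh => huX' (mem_sup_left hh)
    have huX2' : u' ∉ X.1 := fun hh => hu'u (huX u' (mem_sup_left hh))
    have hvu2 : W.form v u' = 0 := W.form_comm_zero hvu'
    have h3u' : W.form (u + v + c • u') u' = 1 := by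
      rw [form_add_left, form_add_left, form_smul_left, huu, hvu2, W.form_self hu']
      ring
    have hX3 : u + v + c • u' ∉ X.1 := fun hh => by
      have := huX2 _ (mem_sup_left hh)
      rw [h3u'] at this
      exact one_ne_zero this
    obtain ⟨A, hA, hAT⟩ := key u hu huX huY huX1
    obtain ⟨B, hB, hBT⟩ := key u' hu' huX2 huY2 huX2'
    obtain ⟨C, hC, hCT⟩ := key (u + v + c • u') hq
      (add_mem (add_mem huX hvX) (smul_mem _ _ huX2))
      (add_mem (add_mem huY hvY) (smul_mem _ _ huY2)) hX3
    have hmA : u ∈ A.1 := hA ▸ mem_sup_span_singleton_self _ _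
    have hmB : u' ∈ B.1 := hB ▸ mem_sup_span_singleton_self _ _
    have hmC : u + v + c • u' ∈ C.1 := hC ▸ mem_sup_span_singleton_self _ _
    have hAB : A ≠ B := by
      rintro rfl
      have := A.2.1.1 u hmA u' hmB
      rw [huu] at this
      exact one_ne_zero this
    have hBC : B ≠ C := by
      rintro rfl
      have := B.2.1.1 _ hmC u' hmB
      rw [h3u'] at this
      exact one_ne_zero this
    have hAC : A ≠ C := by
      rintro rfl
      have h1 := A.2.1.1 u hmA _ hmC
      rw [form_add_right, form_add_right, form_smul_right, W.form_self hu, hvu, huu, zero_add,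
        zero_add, mul_one] at h1
      refine (hvc.resolve_left (not_not.mpr h1)) ?_
      rw [h1, zero_smul, add_zero] at hmC
      have h2 : v ∈ A.1 := by simpa using sub_mem hmC hmA
      rw [hA] at h2
      obtain ⟨d, hd, cu, hcu, rfl⟩ := mem_sup.mp h2
      obtain ⟨a, rfl⟩ := mem_span_singleton.mp hcu
      have h3 := hvu'
      rw [form_add_right, form_smul_right, W.form_comm_zero (huX2 d (hDX' hd)), zero_add] at h3
      rw [(mul_eq_zero.mp h3).resolve_right hu'u, zero_smul, add_zero]
      exact hd
    refine ⟨![A, B, C], ?_, ?_⟩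
    · clear * - hAB hAC hBC
      simp [Function.Injective, Fin.forall_fin_succ, hAB, hAC, hBC, hAB.symm, hAC.symm, hBC.symm]
    · exact Fin.forall_fin_succ.mpr ⟨hAT, Fin.forall_fin_two.mpr ⟨hBT, hCT⟩⟩

/-! ### Counting the common neighbours of a triangle -/

/-- The number of hyperplanes of a singular `(k + 1)`-subspace `S` bounds the hull of a triangle
in `S` from below. It suffices to count the hyperplanes of `S` that avoid a fixed vector. -/
theorem pow_le_ncard_triangleHull [Finite F] {S : Submodule F V} (hS : W.IsSingular S)
    (hSd : finrank F S = k + 1) (hX : X.1 ≤ S) (hY : Y.1 ≤ S) (hZ : Z.1 ≤ S) :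
    Nat.card F ^ k ≤ ((W.polarGrassmannGraph k).triangleHull X Y Z).ncard := by
  have : Finite V := Module.finite_of_finite F
  obtain ⟨v, hvS, hvX⟩ := exists_mem_notMem_of_finrank_lt (A := X.1) (B := S)
    (by rw [X.2.2]; omega)
  -- complements of `v` in `S` are the graphs of the functionals on `X`
  let f : (X.1 →ₗ[F] F) → X.1 →ₗ[F] V := fun a => X.1.subtype + a.smulRight v
  have hf : ∀ a x, f a x = x + a x • v := fun a x => rfl
  have hinj : ∀ (a b : X.1 →ₗ[F] F) (x y : X.1), f a x = f b y → x = y ∧ a x = b y := by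
    intro a b x y hxy
    rw [hf, hf] at hxy
    have h1 : (b y - a x) • v = (x : V) - y := by
      rw [sub_smul, sub_eq_sub_iff_add_eq_add, add_comm, ← hxy, add_comm]
    have h2 : b y - a x = 0 := by
      by_contra hne
      exact hvX ((smul_mem_iff _ hne).mp (h1 ▸ sub_mem x.2 y.2))
    rw [h2, zero_smul] at h1
    exact ⟨Subtype.ext (sub_eq_zero.mp h1.symm), (sub_eq_zero.mp h2).symm⟩
  have hfS : ∀ a, LinearMap.range (f a) ≤ S := by
    rintro a _ ⟨x, rfl⟩
    rw [hf]
    exact add_mem (hX x.2) (smul_mem _ _ hvS)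
  let T : (X.1 →ₗ[F] F) → W.Singular k := fun a => ⟨LinearMap.range (f a), hS.mono (hfS a), by
    rw [LinearMap.finrank_range_of_inj (fun x y hxy => (hinj a a x y hxy).1), X.2.2]⟩
  have hT : Function.Injective T := by
    intro a b hab
    ext x
    have h1 : f a x ∈ LinearMap.range (f b) := by
      have hr : LinearMap.range (f a) = LinearMap.range (f b) := congrArg Subtype.val hab
      exact hr.le ⟨x, rfl⟩
    obtain ⟨y, hy⟩ := h1
    obtain ⟨rfl, h2⟩ := hinj b a y x hy
    exact h2.symm
  have hcard : Nat.card (X.1 →ₗ[F] F) = Nat.card F ^ k := by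
    rw [natCard_eq_pow_finrank (K := F) (V := X.1 →ₗ[F] F)]
    congr 1
    exact Subspace.dual_finrank_eq.trans X.2.2
  rw [← hcard, ← Set.ncard_univ, ← Set.ncard_image_of_injective _ hT]
  refine Set.ncard_le_ncard ?_ (Set.toFinite _)
  rintro _ ⟨a, -, rfl⟩
  have key : ∀ U : W.Singular k, U.1 ≤ S → T a = U ∨ (W.polarGrassmannGraph k).Adj (T a) U :=
    fun U hU => (eq_or_ne (T a) U).imp_right fun hne => adj_of_le hS hSd (hfS a) hU hne
  exact ⟨key X hX, key Y hY, key Z hZ⟩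

/-- Suppose that `ω = k + 2` and that the ends `X`, `Y` are opposite and meet in a subspace `D` of
dimension `k - 1`. The hull of a triangle formed by `X` and two vertices of the first layer
consists of subspaces containing `D` and contained in a fixed maximal singular subspace `M`, so it
corresponds to a set of points of the projective plane `M / D`. -/
theorem Opposite.ncard_triangleHull_le [Finite F] (hk : W.wittIndex = k + 2)
    (h : W.Opposite X Y) (hD : finrank F (X.1 ⊓ Y.1 : Submodule F V) + 1 = k)
    (h1 : Z₁ ∈ (W.polarGrassmannGraph k).towards X Y)
    (h2 : Z₂ ∈ (W.polarGrassmannGraph k).towards X Y)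
    (hadj : (W.polarGrassmannGraph k).Adj Z₁ Z₂) :
    ((W.polarGrassmannGraph k).triangleHull X Z₁ Z₂).ncard ≤
      Nat.card F * Nat.card F + Nat.card F + 1 := by
  obtain ⟨w₁, hw1, hwX1, hwY1, hw1', hZ1⟩ := h.towards_eq (by omega) hD h1
  obtain ⟨w₂, hw2, hwX2, hwY2, hw2', hZ2⟩ := h.towards_eq (by omega) hD h2
  obtain ⟨D, hDe⟩ : ∃ D, D = X.1 ⊓ Y.1 := ⟨_, rfl⟩
  rw [← hDe] at hD hZ1 hZ2
  have hDX : D ≤ X.1 := hDe ▸ inf_le_left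
  obtain ⟨e, heX, heD⟩ := exists_mem_notMem_of_finrank_lt (A := D) (B := X.1)
    (by rw [X.2.2]; omega)
  have hXe : X.1 = D ⊔ span F {e} :=
    (eq_of_le_of_finrank_le (sup_span_singleton_le hDX heX)
      (by rw [finrank_sup_span_singleton heD, X.2.2, hD])).symm
  have hm1 : w₁ ∈ Z₁.1 := hZ1 ▸ mem_sup_span_singleton_self _ _
  have hm2 : w₂ ∈ Z₂.1 := hZ2 ▸ mem_sup_span_singleton_self _ _
  have h12 : W.form w₁ w₂ = 0 := Adj.le_perp hadj hm2 w₁ hm1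
  have hS1 := X.2.1.sup_span_singleton hw1 hwX1
  have hw2M : w₂ ∉ X.1 ⊔ span F {w₁} := by
    intro hmem
    obtain ⟨x, hx, cw, hcw, hxc⟩ := mem_sup.mp hmem
    have hxY : x ∈ W.perp Y.1 := by
      rw [eq_sub_of_add_eq hxc]
      obtain ⟨c, rfl⟩ := mem_span_singleton.mp hcw
      exact sub_mem hwY2 (smul_mem _ _ hwY1)
    have hxD : x ∈ D := hDe ▸ h.inf_perp_le' ⟨hx, hxY⟩
    have : Z₂.1 ≤ Z₁.1 := by
      rw [hZ1, hZ2]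
      refine sup_span_singleton_le le_sup_left ?_
      rw [← hxc]
      exact add_mem (mem_sup_left hxD) (mem_sup_right hcw)
    exact hadj.ne (eq_of_le this).symm
  have hw2p : w₂ ∈ W.perp (X.1 ⊔ span F {w₁}) :=
    mem_perp_sup.mpr ⟨hwX2, mem_perp_span_singleton.mpr h12⟩
  have hM := hS1.sup_span_singleton hw2 hw2p
  obtain ⟨M, hMe⟩ : ∃ M, M = X.1 ⊔ span F {w₁} ⊔ span F {w₂} := ⟨_, rfl⟩
  have hMd : finrank F M = k + 2 := by
    rw [hMe, finrank_sup_span_singleton hw2M, finrank_sup_span_singleton hw1', X.2.2]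
  rw [← hMe] at hM
  have hXM : X.1 ≤ M := hMe ▸ le_sup_left.trans le_sup_left
  have hw1M : w₁ ∈ M := hMe ▸ mem_sup_left (mem_sup_span_singleton_self _ _)
  have hw2M' : w₂ ∈ M := hMe ▸ mem_sup_span_singleton_self _ _
  have hZ1M : Z₁.1 ≤ M := hZ1 ▸ sup_span_singleton_le (hDX.trans hXM) hw1M
  have hZ2M : Z₂.1 ≤ M := hZ2 ▸ sup_span_singleton_le (hDX.trans hXM) hw2M'
  have hhull : ∀ T ∈ (W.polarGrassmannGraph k).triangleHull X Z₁ Z₂, D ≤ T.1 ∧ T.1 ≤ M := by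
    rintro T ⟨hTX, hT1, hT2⟩
    have hperp : ∀ {U : W.Singular k}, T = U ∨ (W.polarGrassmannGraph k).Adj T U →
        T.1 ≤ W.perp U.1 := by
      rintro U (rfl | hTU)
      · exact T.2.1.le_perp
      · exact Adj.le_perp hTU.symm
    have hinf : ∀ {U : W.Singular k}, T = U ∨ (W.polarGrassmannGraph k).Adj T U →
        k ≤ finrank F (T.1 ⊓ U.1 : Submodule F V) + 1 := by
      rintro U (rfl | hTU)
      · rw [inf_idem, T.2.2]; omega
      · exact (Adj.finrank_inf hTU).ge
    constructor
    · by_contra hDT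
      -- `T` contains a vector outside `D` of each of `X`, `Z₁` and `Z₂`
      have hmeet : ∀ {U : W.Singular k}, T = U ∨ (W.polarGrassmannGraph k).Adj T U → D ≤ U.1 →
          U.1 ≤ T.1 ⊔ D := by
        intro U hTU hDU
        obtain ⟨t, ht, htD⟩ : ∃ t ∈ T.1 ⊓ U.1, t ∉ D := by
          by_contra! hc
          have := eq_of_le_of_finrank_le (show T.1 ⊓ U.1 ≤ D from hc)
            (by have := hinf hTU; omega)
          exact hDT (this ▸ inf_le_left)
        have : D ⊔ span F {t} = U.1 := eq_of_le_of_finrank_le (sup_span_singleton_le hDU ht.2)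
          (by rw [finrank_sup_span_singleton htD, U.2.2, hD])
        rw [← this]
        exact sup_span_singleton_le le_sup_right (mem_sup_left ht.1)
      have hMT : M ≤ T.1 ⊔ D := by
        rw [hMe]
        exact sup_span_singleton_le (sup_span_singleton_le (hmeet hTX hDX)
          (hmeet hT1 (hZ1 ▸ le_sup_left) hm1)) (hmeet hT2 (hZ2 ▸ le_sup_left) hm2)
      have e1 := finrank_mono hMT
      have e2 := finrank_sup_add_finrank_inf_eq T.1 D
      have e3 := finrank_add_finrank_le_of_le (A := T.1 ⊓ X.1) (B := D) inf_le_right hDX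
      have e4 := finrank_mono (inf_le_inf_right D inf_le_left : T.1 ⊓ X.1 ⊓ D ≤ T.1 ⊓ D)
      have e5 := hinf hTX
      rw [T.2.2] at e2
      rw [X.2.2] at e3
      omega
    · have hMT : M ≤ W.perp T.1 := by
        rw [hMe]
        exact sup_span_singleton_le (sup_span_singleton_le (le_perp_comm.mp (hperp hTX))
          (le_perp_comm.mp (hperp hT1) hm1)) (le_perp_comm.mp (hperp hT2) hm2)
      have := (T.2.1.sup hM hMT).finrank_le
      rw [eq_of_le_of_finrank_le (le_sup_right : M ≤ T.1 ⊔ M) (by omega)]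
      exact le_sup_left
  -- the points of the plane, in normalized coordinates with respect to `e`, `w₁`, `w₂`
  let f : (F × F) ⊕ F ⊕ Unit → Submodule F V :=
    Sum.elim (fun a => D ⊔ span F {e + a.1 • w₁ + a.2 • w₂})
      (Sum.elim (fun a => D ⊔ span F {w₁ + a • w₂}) fun _ => D ⊔ span F {w₂})
  have hcard : (Set.range f).ncard ≤ Nat.card F * Nat.card F + Nat.card F + 1 := by
    rw [← Set.image_univ]
    refine (Set.ncard_image_le (Set.toFinite _)).trans ?_
    rw [Set.ncard_univ, Nat.card_sum, Nat.card_sum, Nat.card_prod,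
      Nat.card_unique (α := Unit), add_assoc]
  have : Finite (Set.range f) := Set.finite_range f
  rw [← Set.ncard_image_of_injective _ Subtype.val_injective]
  refine (Set.ncard_le_ncard ?_ (Set.toFinite _)).trans hcard
  rintro _ ⟨T, hT, rfl⟩
  obtain ⟨hDT, hTM⟩ := hhull T hT
  obtain ⟨t, htT, htD⟩ := exists_mem_notMem_of_finrank_lt (A := D) (B := T.1)
    (by rw [T.2.2]; omega)
  have hpt : ∀ v ∈ T.1, v ∉ D → D ⊔ span F {v} = T.1 := fun v hv hvD =>
    eq_of_le_of_finrank_le (sup_span_singleton_le hDT hv)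
      (by rw [finrank_sup_span_singleton hvD, T.2.2, hD])
  have htM := hTM htT
  rw [hMe, hXe] at htM
  obtain ⟨t', ht', c', hc', rfl⟩ := mem_sup.mp htM
  obtain ⟨t'', ht'', b', hb', rfl⟩ := mem_sup.mp ht'
  obtain ⟨d, hd, a', ha', rfl⟩ := mem_sup.mp ht''
  obtain ⟨a, rfl⟩ := mem_span_singleton.mp ha'
  obtain ⟨b, rfl⟩ := mem_span_singleton.mp hb'
  obtain ⟨c, rfl⟩ := mem_span_singleton.mp hc'
  -- dividing by a nonzero scalar and dropping the part in `D`
  have hnorm : ∀ (s : F) (v : V), s ≠ 0 → d + a • e + b • w₁ + c • w₂ = d + s • v →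
      D ⊔ span F {v} = T.1 := by
    intro s v hs hv
    rw [hv] at htT htD
    have hvT : v ∈ T.1 := (smul_mem_iff _ hs).mp (by simpa using sub_mem htT (hDT hd))
    exact hpt v hvT fun hvD => htD (add_mem hd (smul_mem _ _ hvD))
  by_cases ha : a = 0
  · by_cases hb : b = 0
    · have hc : c ≠ 0 := by
        rintro rfl
        apply htD
        simpa [ha, hb] using hd
      exact ⟨Sum.inr (Sum.inr ()), hnorm c _ hc (by rw [ha, hb]; module)⟩
    · refine ⟨Sum.inr (Sum.inl (b⁻¹ * c)), hnorm b _ hb ?_⟩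
      rw [ha, smul_add, smul_smul, mul_inv_cancel_left₀ hb]; module
  · refine ⟨Sum.inl (a⁻¹ * b, a⁻¹ * c), hnorm a _ ha ?_⟩
    rw [smul_add, smul_add, smul_smul, smul_smul, mul_inv_cancel_left₀ ha,
      mul_inv_cancel_left₀ ha]; module

/-! ### Automorphisms preserve opposite ends -/

/-- An automorphism of the polar Grassmann graph maps opposite vertices at distance `l` to opposite
vertices, apart from the exceptional case. Otherwise it would map the first layer from `X` to `Y` to
the first layer between two nonopposite vertices, whose common neighbours behave differently. -/
theorem opposite_iso [Finite F] {l : ℕ} (hk : k < W.wittIndex)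
    (hW : ¬ (W.IsOrthogonalPlus ∧ W.wittIndex = 4 ∧ k = 2 ∧ l = 2))
    (φ : W.polarGrassmannGraph k ≃g W.polarGrassmannGraph k) (h : W.Opposite X Y)
    (hl : (W.polarGrassmannGraph k).dist X Y = l) : W.Opposite (φ X) (φ Y) := by
  by_contra hop
  have hXY : φ X ≠ φ Y := fun hh => h.1 (φ.injective hh)
  have hd := (h.dist_add hk).2
  have hd' := (dist_add_of_not_opposite hXY hop).2
  rw [φ.dist_eq, hl] at hd'
  rw [hl] at hd
  have hlt := finrank_inf_lt h.1
  have hadj : ∀ A B, (W.polarGrassmannGraph k).Adj A B ↔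
    (W.polarGrassmannGraph k).Adj (φ A) (φ B) := fun A B => φ.map_adj_iff.symm
  by_cases hD : finrank F (X.1 ⊓ Y.1 : Submodule F V) + 2 ≤ k
  · obtain ⟨Z₁, h1, Z₂, h2, h12, hn, hno⟩ := h.exists_no_common hk hD
    obtain ⟨Z, hZ, ha1, ha2, -⟩ := exists_adj_of_not_opposite hk hXY hop (φ.mem_towards_iff.mpr h1)
      (φ.mem_towards_iff.mpr h2) (φ.injective.ne h12) (by rwa [← hadj])
    obtain ⟨Z, rfl⟩ := φ.surjective Z
    exact hno Z (φ.mem_towards_iff.mp hZ) ((hadj _ _).mpr ha1) ((hadj _ _).mpr ha2)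
  have hD : finrank F (X.1 ⊓ Y.1 : Submodule F V) + 1 = k := by omega
  by_cases hexc : W.IsOrthogonalPlus ∧ W.wittIndex = k + 2
  · have hk3 : 3 ≤ k := by
      by_contra hlt
      exact hW ⟨hexc.1, by omega, by omega, by omega⟩
    obtain ⟨-, -, -, -, -, -, -, -, -, Z₁, h1, Z₂, h2, -, -, h12, hn⟩ := h.exists_pair hk hD
    obtain ⟨Z, hZ, -, ha2, hZS⟩ := exists_adj_of_not_opposite hk hXY hop
      (φ.mem_towards_iff.mpr h1) (φ.mem_towards_iff.mpr h2) (φ.injective.ne h12) (by rwa [← hadj])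
    obtain ⟨Z, rfl⟩ := φ.surjective Z
    have hXZ2 := (φ.mem_towards_iff.mpr h2).1
    have e1 := pow_le_ncard_triangleHull hXZ2.1 hXZ2.2 le_sup_left hZS le_sup_right
    rw [φ.ncard_triangleHull] at e1
    have e2 := h.ncard_triangleHull_le hexc.2 hD (φ.mem_towards_iff.mp hZ) h2 ((hadj _ _).mpr ha2)
    have hq : 2 ≤ Nat.card F := Finite.one_lt_card
    have e3 : Nat.card F ^ 3 ≤ Nat.card F ^ k := Nat.pow_le_pow_right (by omega) hk3
    nlinarith [mul_le_mul hq hq (by omega) (by omega)]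
  · obtain ⟨Z₁, h1, Z₂, h2, h12, hn, hno | ⟨f, hf, hfT⟩⟩ := h.exists_common hk hD hexc
    · obtain ⟨Z, hZ, ha1, ha2, -⟩ := exists_adj_of_not_opposite hk hXY hop
        (φ.mem_towards_iff.mpr h1) (φ.mem_towards_iff.mpr h2) (φ.injective.ne h12)
        (by rwa [← hadj])
      obtain ⟨Z, rfl⟩ := φ.surjective Z
      exact hno Z (φ.mem_towards_iff.mp hZ) ((hadj _ _).mpr ha1) ((hadj _ _).mpr ha2)
    · have key := fun i => eq_or_eq_of_not_opposite hk hXY hop (φ.mem_towards_iff.mpr h1)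
        (φ.mem_towards_iff.mpr h2) (φ.injective.ne h12) (by rwa [← hadj])
        (φ.mem_towards_iff.mpr (hfT i).1) ((hadj _ _).mp (hfT i).2.1) ((hadj _ _).mp (hfT i).2.2)
      have hne : ∀ i j, i ≠ j → (φ (f i)).1 ≠ (φ (f j)).1 := fun i j hij hh =>
        hij (hf (φ.injective (Subtype.ext hh)))
      have n01 := hne 0 1 (by decide)
      have n02 := hne 0 2 (by decide)
      have n12 := hne 1 2 (by decide)
      rcases key 0 with k0 | k0 <;> rcases key 1 with k1 | k1 <;> rcases key 2 with k2 | k2 <;>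
        simp_all

end FormedSpace

theorem proposition4p2 {F V : Type*} [Field F] [Finite F] [AddCommGroup V] [Module F V]
    [FiniteDimensional F V] (W : FormedSpace F V) (k l : ℕ)
    (hk : 1 ≤ k) (hkW : k < W.wittIndex) (hl : 2 ≤ l) (hlk : l ≤ k + 1) :
    IsSingleOrbit (FormedSpace.MovedBy W.isometryGroup) (W.oppositeGeodesics k l) ∧
    IsSingleOrbit (FormedSpace.MovedBy W.semisimilarityGroup) (W.oppositeGeodesics k l) ∧
    (¬ (W.IsOrthogonalPlus ∧ W.wittIndex = 4 ∧ k = 2 ∧ l = 2) →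
      IsSingleOrbit FormedSpace.MovedByAut (W.oppositeGeodesics k l)) := by
  open FormedSpace in
  obtain ⟨j, rfl⟩ : ∃ j, l = j + 1 := ⟨l - 1, by omega⟩
  have hne := oppositeGeodesics_nonempty hkW (j := j) (by omega) (by omega)
  refine ⟨⟨hne, fun p hp p' => ⟨fun hp' => movedBy_isometryGroup hkW hp hp', ?_⟩⟩,
    ⟨hne, fun p hp p' => ⟨fun hp' => ?_, mem_oppositeGeodesics_of_movedBy hp⟩⟩,
    fun hW => ⟨hne, fun p hp p' => ⟨fun hp' => ?_, ?_⟩⟩⟩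
  · rintro ⟨g, hg, hgp⟩
    exact mem_oppositeGeodesics_of_movedBy hp ⟨g, W.isometryGroup_le hg, hgp⟩
  · obtain ⟨g, hg, hgp⟩ := movedBy_isometryGroup hkW hp hp'
    exact ⟨g, W.isometryGroup_le hg, hgp⟩
  · obtain ⟨g, hg, hgp⟩ := movedBy_isometryGroup hkW hp hp'
    obtain ⟨φ, hφ⟩ := exists_iso (W.isometryGroup_le hg) k
    exact ⟨φ, fun i => Subtype.ext (SetLike.coe_injective (by rw [hgp, hφ]))⟩
  · rintro ⟨φ, hφ⟩
    obtain rfl : p' = fun i => φ (p i) := funext hφ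
    exact mem_oppositeGeodesics_of_iso hp φ (opposite_iso hkW hW φ hp.2 hp.1.2)
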